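/- Let $\mathfrak a$ be an additive category. For complexes $X,Y$ in $\mathfrak a$ let $\mathrm{Hom}_{\mathfrak a}(X,Y)$ be the Hom-complex, $\mathrm{Hom}_{\mathfrak a}(X,Y)^n=\prod_{p\in\mathbb Z}\mathrm{Hom}_{\mathfrak a}(X^p,Y^{p+n})$ with $(df)^p=d_Y^{p+n}\circ f^p-(-1)^n f^{p+1}\circ d_X^p$, and let $C_{\rm dg}(\mathfrak a)$ be the resulting dg category of complexes. A morphism $f=(f^p)_p$ in it is *bounded* if $f^p=0$ whenever $|p|$ is sufficiently large; the bounded morphisms form a dg ideal, and the *Vogel dg category* $\mathcal V(\mathfrak a)$ is the factor dg category of $C_{\rm dg}(\mathfrak a)$ by this ideal. Let $\mathcal V^-(\mathfrak a)$ and $\mathcal V^+(\mathfrak a)$ be the full dg subcategories of $\mathcal V(\mathfrak a)$ formed by the bounded-above complexes ($X^n=0$ for $n\gg0$) and the bounded-below complexes ($X^n=0$ for $n\ll0$). The homotopy category $H^0(\mathcal C)$ of a dg category $\mathcal C$ has the same objects, and the zeroth cohomology groups of the morphism complexes as morphism groups. For $\mathcal C=\mathcal V(\mathfrak a),\mathcal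 V^-(\mathfrak a),\mathcal V^+(\mathfrak a)$ the shift $\Sigma$ on $H^0(\mathcal C)$ is given by the usual shift of complexes, and the exact triangles are those isomorphic to a standard triangle $X\xrightarrow{f}Y\to C\to\Sigma X$ with $C$ an internal cone in $\mathcal C$ of a closed morphism $f$ of degree zero, that is, an object with morphisms $j\colon Y\to C$, $t\colon C\to Y$, $p\colon C\to X$, $s\colon X\to C$ of degrees $0,0,1,-1$ such that $pj=0=ts$, $\mathrm{Id}_C=sp+jt$, $tj=\mathrm{Id}_Y$, $ps=\mathrm{Id}_X$, $d(j)=0=d(p)$ and $d(s)=jf$; the morphisms $Y\to C$ and $C\to\Sigma X$ are given by $j$ and $-p$. Then $H^0(\mathcal V(\mathfrak a))$, $H^0(\mathcal V^-(\mathfrak a))$ and $H^0(\mathcal V^+(\mathfrak a))$ are triangulated categories, and the following hold. 1. There is an orthogonal decomposition $H^0(\mathcal V(\mathfrak a))=H^0(\mathcal V^-(\mathfrak a))\times H^0(\mathcal V^+(\mathfrak a))$. That is, $H^0(\mathcal V^-(\mathfrak a))$ and $H^0(\mathcal V^+(\mathfrak a))$ are full triangulated subcategories of $H^0(\mathcal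 V(\mathfrak a))$; $\mathrm{Hom}_{H^0(\mathcal V(\mathfrak a))}(Y,X)=0$ and $\mathrm{Hom}_{H^0(\mathcal V(\mathfrak a))}(X,Y)=0$ for every bounded-above $X$ and every bounded-below $Y$; and every object $Z$ of $H^0(\mathcal V(\mathfrak a))$ fits into an exact triangle $Y\to Z\to X\to\Sigma Y$ with $Y$ bounded-below and $X$ bounded-above. 2. Let $\mathbf K^-(\mathfrak a)$, $\mathbf K^+(\mathfrak a)$ and $\mathbf K^b(\mathfrak a)$ be the homotopy categories of bounded-above, bounded-below and bounded complexes. The canonical functors $\mathbf K^{-}(\mathfrak a)\to H^0(\mathcal V^{-}(\mathfrak a))$ and $\mathbf K^{+}(\mathfrak a)\to H^0(\mathcal V^{+}(\mathfrak a))$, which are the identity on objects and send the homotopy class of a cochain map to its class, induce isomorphisms of triangulated categories from the Verdier quotients: $$\mathbf K^-(\mathfrak a)/\mathbf K^b(\mathfrak a)\xrightarrow{\ \sim\ }H^0(\mathcal V^-(\mathfrak a)),\qquad \mathbf K^+(\mathfrak a)/\mathbf K^b(\mathfrak a)\xrightarrow{\ \sim\ }H^0(\mathcal V^+(\mathfrak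 a)).$$ -/

import Mathlib

open CategoryTheory CategoryTheory.Limits CategoryTheory.Pretriangulated

universe w v u

noncomputable section

namespace VogelDG

/-! ### Dg categories -/

/-- A dg category (over `ℤ`) with class of objects `A`.  The morphism complexes are given by their
components `Hom X Y n`, and `d h` is the differential.  Composition is written in diagrammatic
order: `comp f g` is "first `f`, then `g`", so that the last axiom is the graded Leibniz rule
`d (g ∘ f) = d g ∘ f + (-1) ^ |g| g ∘ d f`. -/
class DGCategory (A : Type u) where
  Hom : A → A → ℤ → Type w
  [addCommGroup : ∀ X Y n, AddCommGroup (Hom X Y n)]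
  d : ∀ {X Y : A} {n m : ℤ}, n + 1 = m → (Hom X Y n →+ Hom X Y m)
  id : ∀ X : A, Hom X X 0
  comp : ∀ {X Y Z : A} {p q r : ℤ}, Hom X Y p → Hom Y Z q → p + q = r → Hom X Z r
  add_comp : ∀ {X Y Z : A} {p q r : ℤ} (f f' : Hom X Y p) (g : Hom Y Z q) (h : p + q = r),
    comp (f + f') g h = comp f g h + comp f' g h
  comp_add : ∀ {X Y Z : A} {p q r : ℤ} (f : Hom X Y p) (g g' : Hom Y Z q) (h : p + q = r),
    comp f (g + g') h = comp f g h + comp f g' h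
  id_comp : ∀ {X Y : A} {p : ℤ} (f : Hom X Y p), comp (id X) f (zero_add p) = f
  comp_id : ∀ {X Y : A} {p : ℤ} (f : Hom X Y p), comp f (id Y) (add_zero p) = f
  assoc : ∀ {W X Y Z : A} {p q r pq qr pqr : ℤ} (f : Hom W X p) (g : Hom X Y q) (k : Hom Y Z r)
    (h₁ : p + q = pq) (h₂ : q + r = qr) (h₃ : pq + r = pqr) (h₄ : p + qr = pqr),
    comp (comp f g h₁) k h₃ = comp f (comp g k h₂) h₄
  d_d : ∀ {X Y : A} {n m l : ℤ} (h : n + 1 = m) (h' : m + 1 = l) (f : Hom X Y n), d h' (d h f) = 0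
  d_comp : ∀ {X Y Z : A} {p q r p' q' r' : ℤ} (f : Hom X Y p) (g : Hom Y Z q) (h : p + q = r)
    (hp : p + 1 = p') (hq : q + 1 = q') (hr : r + 1 = r') (h₁ : p + q' = r') (h₂ : p' + q = r'),
    d hr (comp f g h) = comp f (d hq g) h₁ + q.negOnePow • comp (d hp f) g h₂

attribute [reducible, instance] DGCategory.addCommGroup

namespace DGCategory

variable {A : Type u} [DGCategory.{w} A]

/-- Composition as a biadditive map. -/
def compHom {X Y Z : A} {p q r : ℤ} (h : p + q = r) :
    Hom X Y p →+ Hom Y Z q →+ Hom X Z r :=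
  AddMonoidHom.mk' (fun f => AddMonoidHom.mk' (fun g => comp f g h)
    (fun g g' => comp_add f g g' h)) (fun f f' => by ext g; exact add_comp f f' g h)

@[simp]
theorem zero_comp {X Y Z : A} {p q r : ℤ} (g : Hom Y Z q) (h : p + q = r) :
    comp (0 : Hom X Y p) g h = 0 :=
  congrArg (fun k : Hom Y Z q →+ Hom X Z r => k g) (map_zero (compHom (X := X) h))

@[simp]
theorem comp_zero {X Y Z : A} {p q r : ℤ} (f : Hom X Y p) (h : p + q = r) :
    comp f (0 : Hom Y Z q) h = 0 :=
  map_zero (compHom (Z := Z) h f)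

theorem sub_comp {X Y Z : A} {p q r : ℤ} (f f' : Hom X Y p) (g : Hom Y Z q) (h : p + q = r) :
    comp (f - f') g h = comp f g h - comp f' g h :=
  congrArg (fun k : Hom Y Z q →+ Hom X Z r => k g) (map_sub (compHom (X := X) h) f f')

theorem comp_sub {X Y Z : A} {p q r : ℤ} (f : Hom X Y p) (g g' : Hom Y Z q) (h : p + q = r) :
    comp f (g - g') h = comp f g h - comp f g' h :=
  map_sub (compHom (Z := Z) h f) g g'

theorem d_id (X : A) {m : ℤ} (h : 0 + 1 = m) : d h (id X) = 0 := by
  have e := d_comp (id X) (id X) (zero_add 0) h h h (by simp) (by simp)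
  obtain rfl : (1 : ℤ) = m := by simpa using h
  rw [id_comp, id_comp, comp_id] at e
  simpa using e

/-- The composition of closed morphisms is closed. -/
theorem d_comp_eq_zero {X Y Z : A} {p q r p' q' r' : ℤ} (f : Hom X Y p) (g : Hom Y Z q)
    (h : p + q = r) (hp : p + 1 = p') (hq : q + 1 = q') (hr : r + 1 = r')
    (hf : d hp f = 0) (hg : d hq g = 0) : d hr (comp f g h) = 0 := by
  rw [d_comp f g h hp hq hr (by lia) (by lia), hf, hg]
  simp

end DGCategory

open DGCategory

/-! ### Full dg subcategories and factor dg categories -/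

/-- The full dg subcategory formed by the objects that satisfy `P`. -/
structure FullDG {A : Type u} (P : A → Prop) where
  obj : A
  property : P obj

instance {A : Type u} [DGCategory.{w} A] (P : A → Prop) : DGCategory.{w} (FullDG P) where
  Hom X Y n := Hom X.obj Y.obj n
  d h := d h
  id X := DGCategory.id X.obj
  comp f g h := comp f g h
  add_comp := add_comp
  comp_add := comp_add
  id_comp := id_comp
  comp_id := comp_id
  assoc := assoc
  d_d := d_d
  d_comp := d_comp

/-- A dg ideal: subcomplexes of the morphism complexes, closed under compositions with arbitrary
morphisms on both sides. -/
structure DGIdeal (A : Type u) [DGCategory.{w} A] where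
  carrier : ∀ (X Y : A) (n : ℤ), AddSubgroup (Hom X Y n)
  d_mem : ∀ {X Y : A} {n m : ℤ} (h : n + 1 = m) (f : Hom X Y n),
    f ∈ carrier X Y n → d h f ∈ carrier X Y m
  mem_comp : ∀ {X Y Z : A} {p q r : ℤ} (f : Hom X Y p) (g : Hom Y Z q) (h : p + q = r),
    f ∈ carrier X Y p → comp f g h ∈ carrier X Z r
  comp_mem : ∀ {X Y Z : A} {p q r : ℤ} (f : Hom X Y p) (g : Hom Y Z q) (h : p + q = r),
    g ∈ carrier Y Z q → comp f g h ∈ carrier X Z r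

/-- The objects of the factor dg category of `A` by the dg ideal `I`: the objects of `A`. -/
structure Factor {A : Type u} [DGCategory.{w} A] (I : DGIdeal A) where
  as : A

namespace Factor

variable {A : Type u} [DGCategory.{w} A] (I : DGIdeal A)

/-- The composition in the factor dg category, induced by the one in `A`. -/
def comp {X Y Z : A} {p q r : ℤ} (f : Hom X Y p ⧸ I.carrier X Y p)
    (g : Hom Y Z q ⧸ I.carrier Y Z q) (h : p + q = r) : Hom X Z r ⧸ I.carrier X Z r :=
  Quotient.map₂ (fun f g => DGCategory.comp f g h) (by
    intro f f' hf g g' hg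
    have hf' : f' - f ∈ I.carrier X Y p := by
      rw [sub_eq_neg_add]; exact QuotientAddGroup.leftRel_apply.1 hf
    have hg' : g' - g ∈ I.carrier Y Z q := by
      rw [sub_eq_neg_add]; exact QuotientAddGroup.leftRel_apply.1 hg
    refine QuotientAddGroup.leftRel_apply.2 ?_
    have e : -DGCategory.comp f g h + DGCategory.comp f' g' h =
        DGCategory.comp (f' - f) g h + DGCategory.comp f' (g' - g) h := by
      rw [sub_comp, comp_sub]; abel
    rw [e]
    exact add_mem (I.mem_comp _ _ h hf') (I.comp_mem _ _ h hg')) f g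

instance : DGCategory.{w} (Factor I) where
  Hom X Y n := Hom X.as Y.as n ⧸ I.carrier X.as Y.as n
  d h := QuotientAddGroup.map _ _ (d h) (fun f hf => I.d_mem h f hf)
  id X := QuotientAddGroup.mk (DGCategory.id X.as)
  comp f g h := Factor.comp I f g h
  add_comp := by
    rintro X Y Z p q r ⟨f⟩ ⟨f'⟩ ⟨g⟩ h
    exact congrArg QuotientAddGroup.mk (DGCategory.add_comp f f' g h)
  comp_add := by
    rintro X Y Z p q r ⟨f⟩ ⟨g⟩ ⟨g'⟩ h
    exact congrArg QuotientAddGroup.mk (DGCategory.comp_add f g g' h)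
  id_comp := by
    rintro X Y p ⟨f⟩
    exact congrArg QuotientAddGroup.mk (DGCategory.id_comp f)
  comp_id := by
    rintro X Y p ⟨f⟩
    exact congrArg QuotientAddGroup.mk (DGCategory.comp_id f)
  assoc := by
    rintro W X Y Z p q r pq qr pqr ⟨f⟩ ⟨g⟩ ⟨k⟩ h₁ h₂ h₃ h₄
    exact congrArg QuotientAddGroup.mk (DGCategory.assoc f g k h₁ h₂ h₃ h₄)
  d_d := by
    rintro X Y n m l h h' ⟨f⟩
    exact congrArg QuotientAddGroup.mk (DGCategory.d_d h h' f)
  d_comp := by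
    rintro X Y Z p q r p' q' r' ⟨f⟩ ⟨g⟩ h hp hq hr h₁ h₂
    exact congrArg QuotientAddGroup.mk (DGCategory.d_comp f g h hp hq hr h₁ h₂)

end Factor

/-! ### The homotopy category of a dg category -/

/-- The objects of the homotopy category `H⁰(A)` of a dg category: the objects of `A`. -/
structure H0 (A : Type u) where
  as : A

namespace H0

variable {A : Type u} [DGCategory.{w} A]

/-- The group of closed morphisms of degree zero. -/
def cocycles (X Y : A) : AddSubgroup (Hom X Y 0) :=
  (d (X := X) (Y := Y) (zero_add (1 : ℤ))).ker

/-- The coboundaries, as a subgroup of the closed morphisms of degree zero. -/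
def coboundaries (X Y : A) : AddSubgroup (cocycles X Y) :=
  (d (X := X) (Y := Y) (neg_add_cancel (1 : ℤ))).range.addSubgroupOf (cocycles X Y)

theorem mem_cocycles {X Y : A} (f : Hom X Y 0) : f ∈ cocycles X Y ↔ d (zero_add 1) f = 0 :=
  Iff.rfl

/-- The group of morphisms `H⁰(A(X, Y))` in the homotopy category. -/
def HomGroup (X Y : A) : Type w := cocycles X Y ⧸ coboundaries X Y

instance (X Y : A) : AddCommGroup (HomGroup X Y) :=
  inferInstanceAs (AddCommGroup (cocycles X Y ⧸ coboundaries X Y))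

/-- The class in `H⁰` of a closed morphism of degree zero. -/
def cls {X Y : A} (f : Hom X Y 0) (hf : d (zero_add 1) f = 0) : HomGroup X Y :=
  QuotientAddGroup.mk (⟨f, hf⟩ : cocycles X Y)

theorem cls_surjective {X Y : A} (F : HomGroup X Y) : ∃ f hf, cls f hf = F := by
  obtain ⟨⟨f, hf⟩, rfl⟩ := QuotientAddGroup.mk_surjective F
  exact ⟨f, hf, rfl⟩

theorem cls_eq_iff {X Y : A} (f g : Hom X Y 0) (hf : d (zero_add 1) f = 0)
    (hg : d (zero_add 1) g = 0) :
    cls f hf = cls g hg ↔ ∃ k : Hom X Y (-1), d (neg_add_cancel 1) k = g - f := by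
  refine QuotientAddGroup.eq.trans ?_
  rw [coboundaries, AddSubgroup.mem_addSubgroupOf, AddMonoidHom.mem_range]
  simp [sub_eq_neg_add]

/-- Composition in the homotopy category. -/
def comp {X Y Z : A} (F : HomGroup X Y) (G : HomGroup Y Z) : HomGroup X Z :=
  Quotient.map₂ (fun (f : cocycles X Y) (g : cocycles Y Z) =>
    (⟨DGCategory.comp f.1 g.1 (zero_add 0),
      d_comp_eq_zero _ _ _ (zero_add 1) (zero_add 1) _ f.2 g.2⟩ : cocycles X Z)) (by
    rintro ⟨f, hf⟩ ⟨f', hf'⟩ h ⟨g, hg⟩ ⟨g', hg'⟩ h'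
    obtain ⟨k, hk⟩ := (cls_eq_iff f f' hf hf').1 (Quotient.sound h)
    obtain ⟨l, hl⟩ := (cls_eq_iff g g' hg hg').1 (Quotient.sound h')
    refine Quotient.exact ((cls_eq_iff _ _ _ _).2
      ⟨DGCategory.comp k g (add_zero _) + DGCategory.comp f' l (zero_add _), ?_⟩)
    rw [mem_cocycles] at hf' hg
    rw [map_add, d_comp k g (add_zero _) (neg_add_cancel 1) (zero_add 1) _ (by lia) (by lia),
      d_comp f' l (zero_add _) (zero_add 1) (neg_add_cancel 1) _ (by lia) (by lia),
      hg, hf', hk, hl, sub_comp, comp_sub]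
    simp) F G

instance : Category (H0 A) where
  Hom X Y := HomGroup X.as Y.as
  id X := cls (DGCategory.id X.as) (d_id _ _)
  comp F G := comp F G
  id_comp := by
    rintro X Y ⟨f, hf⟩
    exact congrArg QuotientAddGroup.mk (Subtype.ext (DGCategory.id_comp f))
  comp_id := by
    rintro X Y ⟨f, hf⟩
    exact congrArg QuotientAddGroup.mk (Subtype.ext (DGCategory.comp_id f))
  assoc := by
    rintro W X Y Z ⟨f, hf⟩ ⟨g, hg⟩ ⟨k, hk⟩
    exact congrArg QuotientAddGroup.mk (Subtype.ext (DGCategory.assoc f g k _ _ _ _))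

/-- The morphism of the homotopy category given by a closed morphism of degree zero. -/
def homMk {X Y : A} (f : Hom X Y 0) (hf : d (zero_add 1) f = 0) : (⟨X⟩ : H0 A) ⟶ ⟨Y⟩ :=
  cls f hf

theorem homMk_surjective {X Y : A} (F : (⟨X⟩ : H0 A) ⟶ ⟨Y⟩) : ∃ f hf, homMk f hf = F :=
  cls_surjective F

theorem homMk_comp {X Y Z : A} (f : Hom X Y 0) (hf : d (zero_add 1) f = 0)
    (g : Hom Y Z 0) (hg : d (zero_add 1) g = 0) :
    homMk f hf ≫ homMk g hg = homMk (DGCategory.comp f g (zero_add 0))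
      (d_comp_eq_zero _ _ _ (zero_add 1) (zero_add 1) _ hf hg) := rfl

theorem homMk_congr {X Y : A} {f g : Hom X Y 0} (h : f = g) (hf : d (zero_add 1) f = 0)
    (hg : d (zero_add 1) g = 0) : homMk f hf = homMk g hg := by
  subst h; rfl

instance : Preadditive (H0 A) where
  homGroup X Y := inferInstanceAs (AddCommGroup (HomGroup X.as Y.as))
  add_comp := by
    rintro X Y Z ⟨f, hf⟩ ⟨f', hf'⟩ ⟨g, hg⟩
    exact congrArg QuotientAddGroup.mk (Subtype.ext (DGCategory.add_comp f f' g _))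
  comp_add := by
    rintro X Y Z ⟨f, hf⟩ ⟨g, hg⟩ ⟨g', hg'⟩
    exact congrArg QuotientAddGroup.mk (Subtype.ext (DGCategory.comp_add f g g' _))

/-- The inclusion `H⁰(A') ⥤ H⁰(A)` for the full dg subcategory `A'` of `A` formed by the objects
that satisfy `P`. -/
def incl (P : A → Prop) : H0 (FullDG P) ⥤ H0 A where
  obj X := ⟨X.as.obj⟩
  map F := F

end H0

/-! ### Internal shifts, internal cones, and exact triangles -/

/-- A choice of internal shifts of objects: for each `n` and `X`, an object `X[n]` and closed
mutually inverse morphisms `σ : X → X[n]` of degree `-n` and `τ : X[n] → X` of degree `n`. -/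
class DGShift (A : Type u) [DGCategory.{w} A] where
  shift : ℤ → A → A
  σ : ∀ (n : ℤ) (X : A), Hom X (shift n X) (-n)
  τ : ∀ (n : ℤ) (X : A), Hom (shift n X) X n
  d_σ : ∀ (n : ℤ) (X : A) {m : ℤ} (h : -n + 1 = m), d h (σ n X) = 0
  d_τ : ∀ (n : ℤ) (X : A) {m : ℤ} (h : n + 1 = m), d h (τ n X) = 0
  σ_τ : ∀ (n : ℤ) (X : A), comp (σ n X) (τ n X) (neg_add_cancel n) = DGCategory.id X
  τ_σ : ∀ (n : ℤ) (X : A), comp (τ n X) (σ n X) (add_neg_cancel n) = DGCategory.id (shift n X)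

open DGShift

instance {A : Type u} [DGCategory.{w} A] [DGShift A] (I : DGIdeal A) : DGShift (Factor I) where
  shift n X := ⟨shift n X.as⟩
  σ n X := QuotientAddGroup.mk (σ n X.as)
  τ n X := QuotientAddGroup.mk (τ n X.as)
  d_σ n X _ h := congrArg QuotientAddGroup.mk (d_σ n X.as h)
  d_τ n X _ h := congrArg QuotientAddGroup.mk (d_τ n X.as h)
  σ_τ n X := congrArg QuotientAddGroup.mk (σ_τ n X.as)
  τ_σ n X := congrArg QuotientAddGroup.mk (τ_σ n X.as)

/-- A full dg subcategory which is closed under the shifts inherits them. -/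
@[reducible]
def FullDG.dgShift {A : Type u} [DGCategory.{w} A] [DGShift A] (P : A → Prop)
    (hP : ∀ n X, P X → P (shift n X)) : DGShift (FullDG P) where
  shift n X := ⟨shift n X.obj, hP n _ X.property⟩
  σ n X := σ n X.obj
  τ n X := τ n X.obj
  d_σ n X _ h := d_σ n X.obj h
  d_τ n X _ h := d_τ n X.obj h
  σ_τ n X := σ_τ n X.obj
  τ_σ n X := τ_σ n X.obj

/-- The objects of the category `Gr A` of homogeneous morphisms of arbitrary degrees (it is only
used in order to verify identities between composites). -/
structure Gr (A : Type u) where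
  as : A

namespace Gr

variable {A : Type u} [DGCategory.{w} A]

theorem sigma_ext {X Y : A} {p q : ℤ} (h : p = q) {f : Hom X Y p} {g : Hom X Y q}
    (e : ∀ (r : ℤ) (h : p + 0 = r) (h' : q + 0 = r),
      comp f (DGCategory.id Y) h = comp g (DGCategory.id Y) h') :
    (⟨p, f⟩ : Σ n, Hom X Y n) = ⟨q, g⟩ := by
  subst h
  have := e p (add_zero p) (add_zero p)
  rw [comp_id, comp_id] at this
  rw [this]

instance : Category (Gr A) where
  Hom X Y := Σ n, Hom X.as Y.as n
  id X := ⟨0, DGCategory.id X.as⟩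
  comp f g := ⟨f.1 + g.1, comp f.2 g.2 rfl⟩
  id_comp := by
    rintro X Y ⟨p, f⟩
    refine sigma_ext (zero_add p) (fun r h h' => ?_)
    rw [assoc _ _ _ rfl h' _ (by lia), DGCategory.id_comp]
  comp_id := by
    rintro X Y ⟨p, f⟩
    refine sigma_ext (add_zero p) (fun r h h' => ?_)
    rw [assoc _ _ _ rfl (add_zero 0) _ (by lia), DGCategory.id_comp]
  assoc := by
    rintro W X Y Z ⟨p, f⟩ ⟨q, g⟩ ⟨n, k⟩
    refine sigma_ext (add_assoc p q n) (fun r h h' => ?_)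
    rw [assoc f g k rfl rfl rfl (by lia)]
    obtain rfl : p + q + n = r := by simpa using h
    rw [assoc f _ _ rfl (add_zero _) h' (by lia), DGCategory.comp_id, DGCategory.comp_id]

/-- A homogeneous morphism, as a morphism in `Gr A`. -/
def hom {X Y : A} {n : ℤ} (f : Hom X Y n) : (⟨X⟩ : Gr A) ⟶ ⟨Y⟩ := ⟨n, f⟩

theorem hom_injective {X Y : A} {n : ℤ} {f g : Hom X Y n} (h : hom f = hom g) : f = g := by
  exact eq_of_heq (Sigma.mk.inj h).2

theorem hom_comp {X Y Z : A} {p q r : ℤ} (f : Hom X Y p) (g : Hom Y Z q) (h : p + q = r) :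
    hom (comp f g h) = hom f ≫ hom g := by
  subst h; rfl

theorem hom_id (X : A) : hom (DGCategory.id X) = 𝟙 (⟨X⟩ : Gr A) := rfl

variable [DGShift A]

@[simp]
theorem hom_σ_τ (n : ℤ) (X : A) : hom (σ n X) ≫ hom (τ n X) = 𝟙 _ := by
  rw [← hom_comp _ _ (neg_add_cancel n), σ_τ, hom_id]

@[simp]
theorem hom_τ_σ (n : ℤ) (X : A) : hom (τ n X) ≫ hom (σ n X) = 𝟙 _ := by
  rw [← hom_comp _ _ (add_neg_cancel n), τ_σ, hom_id]

@[simp]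
theorem hom_σ_τ_assoc (n : ℤ) (X : A) {Z : Gr A} (f : (⟨X⟩ : Gr A) ⟶ Z) :
    hom (σ n X) ≫ hom (τ n X) ≫ f = f := by
  rw [← Category.assoc, hom_σ_τ, Category.id_comp]

@[simp]
theorem hom_τ_σ_assoc (n : ℤ) (X : A) {Z : Gr A} (f : (⟨shift n X⟩ : Gr A) ⟶ Z) :
    hom (τ n X) ≫ hom (σ n X) ≫ f = f := by
  rw [← Category.assoc, hom_τ_σ, Category.id_comp]

end Gr

namespace H0

variable {A : Type u} [DGCategory.{w} A] [DGShift A]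

/-- The shift of a closed morphism `f` of degree zero: the composition `X[n] → X → Y → Y[n]`. -/
def shiftHom (n : ℤ) {X Y : A} (f : Hom X Y 0) : Hom (shift n X) (shift n Y) 0 :=
  DGCategory.comp (DGCategory.comp (τ n X) f (add_zero n)) (σ n Y) (add_neg_cancel n)

theorem d_shiftHom (n : ℤ) {X Y : A} (f : Hom X Y 0) (hf : d (zero_add 1) f = 0) :
    d (zero_add 1) (shiftHom n f) = 0 :=
  d_comp_eq_zero _ _ _ rfl rfl _
    (d_comp_eq_zero _ _ _ rfl (zero_add 1) _ (d_τ n X _) hf) (d_σ n Y _)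

theorem shiftHom_sub (n : ℤ) {X Y : A} (f g : Hom X Y 0) :
    shiftHom n (f - g) = shiftHom n f - shiftHom n g := by
  rw [shiftHom, comp_sub, sub_comp]; rfl

theorem hom_shiftHom (n : ℤ) {X Y : A} (f : Hom X Y 0) :
    Gr.hom (shiftHom n f) = Gr.hom (τ n X) ≫ Gr.hom f ≫ Gr.hom (σ n Y) := by
  simp [shiftHom, Gr.hom_comp]

/-- The shift functors of the homotopy category. -/
def shiftFun (n : ℤ) : H0 A ⥤ H0 A where
  obj X := ⟨shift n X.as⟩
  map {X Y} F := Quotient.map (fun (f : cocycles X.as Y.as) =>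
    (⟨shiftHom n f.1, d_shiftHom n f.1 f.2⟩ : cocycles (shift n X.as) (shift n Y.as))) (by
      rintro ⟨f, hf⟩ ⟨g, hg⟩ h
      obtain ⟨k, hk⟩ := (cls_eq_iff f g hf hg).1 (Quotient.sound h)
      refine Quotient.exact ((cls_eq_iff _ _ _ _).2 ⟨n.negOnePow • DGCategory.comp
        (DGCategory.comp (τ n X.as) k rfl) (σ n Y.as) (by lia), ?_⟩)
      rw [Units.smul_def, map_zsmul, d_comp _ _ _ (show n + -1 + 1 = n by lia) rfl (neg_add_cancel 1) (by lia) (by lia), d_σ,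
        d_comp _ _ _ rfl (neg_add_cancel 1) _ (by lia) (by lia), d_τ, hk]
      rw [DGCategory.comp_zero, DGCategory.zero_comp, smul_zero, add_zero, zero_add, ← Units.smul_def, smul_smul,
        Int.negOnePow_neg, Int.units_mul_self, one_smul, comp_sub, sub_comp]
      rfl) F
  map_id X := congrArg QuotientAddGroup.mk (Subtype.ext (Gr.hom_injective (by
    rw [hom_shiftHom]; simp [Gr.hom_id])))
  map_comp := by
    rintro X Y Z ⟨f, hf⟩ ⟨g, hg⟩
    refine congrArg QuotientAddGroup.mk (Subtype.ext (Gr.hom_injective ?_))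
    simp [hom_shiftHom, Gr.hom_comp]

theorem shiftFun_map_homMk (n : ℤ) {X Y : A} (f : Hom X Y 0) (hf : d (zero_add 1) f = 0) :
    (shiftFun n).map (homMk f hf) = homMk (shiftHom n f) (d_shiftHom n f hf) := rfl

/-- An isomorphism in the homotopy category, given by mutually inverse closed morphisms. -/
def isoMk {X Y : A} (f : Hom X Y 0) (hf : d (zero_add 1) f = 0) (g : Hom Y X 0)
    (hg : d (zero_add 1) g = 0) (hfg : DGCategory.comp f g (zero_add 0) = DGCategory.id X)
    (hgf : DGCategory.comp g f (zero_add 0) = DGCategory.id Y) : (⟨X⟩ : H0 A) ≅ ⟨Y⟩ where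
  hom := homMk f hf
  inv := homMk g hg
  hom_inv_id := homMk_congr hfg _ _
  inv_hom_id := homMk_congr hgf _ _

theorem eqToHom_shift {m n : ℤ} (h : m = n) (X : A)
    (e : (⟨shift m X⟩ : H0 A) = ⟨shift n X⟩) :
    eqToHom e = homMk (DGCategory.comp (τ m X) (σ n X) (by lia))
      (d_comp_eq_zero _ _ _ rfl rfl _ (d_τ m X _) (d_σ n X _)) := by
  subst h
  exact homMk_congr (τ_σ m X).symm (d_id _ _) _

theorem shiftHom_τ (n : ℤ) {X Y : A} (f : Hom X Y 0) :
    DGCategory.comp (shiftHom n f) (τ n Y) (zero_add n) =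
      DGCategory.comp (τ n X) f (add_zero n) :=
  Gr.hom_injective (by simp [hom_shiftHom, Gr.hom_comp])

/-- The structure morphism `X → X[0]`, as a morphism of degree zero. -/
def toShiftZero (X : A) : Hom X (shift 0 X) 0 := σ 0 X

theorem d_toShiftZero (X : A) : d (zero_add 1) (toShiftZero X) = 0 := d_σ 0 X _

theorem hom_toShiftZero (X : A) : Gr.hom (toShiftZero X) = Gr.hom (σ 0 X) := rfl

/-- The identification of `X[0]` with `X`. -/
def shiftZero : shiftFun 0 ≅ 𝟭 (H0 A) :=
  NatIso.ofComponents (fun X => isoMk (τ 0 X.as) (d_τ 0 X.as _)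
    (toShiftZero X.as) (d_toShiftZero X.as)
    (τ_σ 0 X.as) (σ_τ 0 X.as)) (by
      rintro X Y ⟨f, hf⟩
      exact homMk_congr (shiftHom_τ 0 f) _ _)

/-- The canonical morphism `X[m + n] → X → X[m] → X[m][n]`. -/
def shiftAddHom (m n : ℤ) (X : A) : Hom (shift (m + n) X) (shift n (shift m X)) 0 :=
  DGCategory.comp (DGCategory.comp (τ (m + n) X) (σ m X) rfl) (σ n (shift m X)) (by lia)

/-- The canonical morphism `X[m][n] → X[m] → X → X[m + n]`. -/
def shiftAddInv (m n : ℤ) (X : A) : Hom (shift n (shift m X)) (shift (m + n) X) 0 :=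
  DGCategory.comp (DGCategory.comp (τ n (shift m X)) (τ m X) rfl) (σ (m + n) X) (by lia)

theorem d_shiftAddHom (m n : ℤ) (X : A) : d (zero_add 1) (shiftAddHom m n X) = 0 :=
  d_comp_eq_zero _ _ _ rfl rfl _
    (d_comp_eq_zero _ _ _ rfl rfl _ (d_τ _ _ _) (d_σ _ _ _)) (d_σ _ _ _)

theorem d_shiftAddInv (m n : ℤ) (X : A) : d (zero_add 1) (shiftAddInv m n X) = 0 :=
  d_comp_eq_zero _ _ _ rfl rfl _
    (d_comp_eq_zero _ _ _ rfl rfl _ (d_τ _ _ _) (d_τ _ _ _)) (d_σ _ _ _)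

theorem hom_shiftAddHom (m n : ℤ) (X : A) : Gr.hom (shiftAddHom m n X) =
    Gr.hom (τ (m + n) X) ≫ Gr.hom (σ m X) ≫ Gr.hom (σ n (shift m X)) := by
  simp [shiftAddHom, Gr.hom_comp]

theorem hom_shiftAddInv (m n : ℤ) (X : A) : Gr.hom (shiftAddInv m n X) =
    Gr.hom (τ n (shift m X)) ≫ Gr.hom (τ m X) ≫ Gr.hom (σ (m + n) X) := by
  simp [shiftAddInv, Gr.hom_comp]

theorem shiftAddHom_naturality (m n : ℤ) {X Y : A} (f : Hom X Y 0) :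
    DGCategory.comp (shiftHom (m + n) f) (shiftAddHom m n Y) (zero_add 0) =
      DGCategory.comp (shiftAddHom m n X) (shiftHom n (shiftHom m f)) (zero_add 0) :=
  Gr.hom_injective (by simp [hom_shiftHom, hom_shiftAddHom, Gr.hom_comp])

theorem shiftAddHom_inv (m n : ℤ) (X : A) :
    DGCategory.comp (shiftAddHom m n X) (shiftAddInv m n X) (zero_add 0) =
      DGCategory.id (shift (m + n) X) :=
  Gr.hom_injective (by simp [hom_shiftAddHom, hom_shiftAddInv, Gr.hom_comp, Gr.hom_id])

theorem shiftAddInv_hom (m n : ℤ) (X : A) :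
    DGCategory.comp (shiftAddInv m n X) (shiftAddHom m n X) (zero_add 0) =
      DGCategory.id (shift n (shift m X)) :=
  Gr.hom_injective (by simp [hom_shiftAddHom, hom_shiftAddInv, Gr.hom_comp, Gr.hom_id])

/-- The identification of `X[m + n]` with `X[m][n]`, through the structure morphisms to `X`. -/
def shiftAdd (m n : ℤ) : shiftFun (A := A) (m + n) ≅ shiftFun m ⋙ shiftFun n :=
  NatIso.ofComponents (fun X => isoMk (shiftAddHom m n X.as) (d_shiftAddHom m n X.as)
    (shiftAddInv m n X.as) (d_shiftAddInv m n X.as)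
    (shiftAddHom_inv m n X.as) (shiftAddInv_hom m n X.as)) (by
      rintro X Y ⟨f, hf⟩
      exact homMk_congr (shiftAddHom_naturality m n f) _ _)

theorem shiftAdd_assoc (m₁ m₂ m₃ : ℤ) (X : A) :
    DGCategory.comp (shiftAddHom (m₁ + m₂) m₃ X) (shiftHom m₃ (shiftAddHom m₁ m₂ X))
        (zero_add 0) =
      DGCategory.comp (DGCategory.comp (τ (m₁ + m₂ + m₃) X) (σ (m₁ + (m₂ + m₃)) X) (by lia))
        (DGCategory.comp (shiftAddHom m₁ (m₂ + m₃) X) (shiftAddHom m₂ m₃ (shift m₁ X))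
          (zero_add 0)) (zero_add 0) :=
  Gr.hom_injective (by simp [hom_shiftHom, hom_shiftAddHom, Gr.hom_comp])

theorem zero_shiftAdd (n : ℤ) (X : A) :
    shiftAddHom 0 n X = DGCategory.comp (DGCategory.comp (τ (0 + n) X) (σ n X) (by lia))
      (shiftHom n (toShiftZero X)) (zero_add 0) :=
  Gr.hom_injective (by simp [hom_shiftHom, hom_shiftAddHom, hom_toShiftZero, Gr.hom_comp])

theorem shiftAdd_zero (n : ℤ) (X : A) :
    shiftAddHom n 0 X = DGCategory.comp (DGCategory.comp (τ (n + 0) X) (σ n X) (by lia))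
      (toShiftZero (shift n X)) (zero_add 0) :=
  Gr.hom_injective (by simp [hom_toShiftZero, hom_shiftAddHom, Gr.hom_comp])

instance : HasShift (H0 A) ℤ :=
  hasShiftMk (H0 A) ℤ
    { F := shiftFun
      zero := shiftZero
      add := shiftAdd
      assoc_hom_app := fun m₁ m₂ m₃ X =>
        (homMk_congr (shiftAdd_assoc m₁ m₂ m₃ X.as) _ _).trans
          (congrArg (fun z => z ≫ homMk (shiftAddHom m₁ (m₂ + m₃) X.as) (d_shiftAddHom _ _ _) ≫
            homMk (shiftAddHom m₂ m₃ (shift m₁ X.as)) (d_shiftAddHom _ _ _))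
            (eqToHom_shift (add_assoc m₁ m₂ m₃) X.as _).symm)
      zero_add_hom_app := fun n X =>
        (homMk_congr (zero_shiftAdd n X.as) _ _).trans
          (congrArg (fun z => z ≫ homMk (shiftHom n (toShiftZero X.as))
            (d_shiftHom n _ (d_toShiftZero _))) (eqToHom_shift (zero_add n) X.as _).symm)
      add_zero_hom_app := fun n X =>
        (homMk_congr (shiftAdd_zero n X.as) _ _).trans
          (congrArg (fun z => z ≫ homMk (toShiftZero (shift n X.as)) (d_toShiftZero _))
            (eqToHom_shift (add_zero n) X.as _).symm) }

end H0

/-- An internal cone of a closed morphism `f : X → Y` of degree zero. -/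
structure InternalCone {A : Type u} [DGCategory.{w} A] {X Y : A} (f : Hom X Y 0) where
  obj : A
  j : Hom Y obj 0
  t : Hom obj Y 0
  p : Hom obj X 1
  s : Hom X obj (-1)
  j_p : comp j p (zero_add 1) = 0
  s_t : comp s t (add_zero (-1)) = 0
  id_obj : comp p s (add_neg_cancel 1) + comp t j (zero_add 0) = DGCategory.id obj
  j_t : comp j t (zero_add 0) = DGCategory.id Y
  s_p : comp s p (neg_add_cancel 1) = DGCategory.id X
  d_j : d (zero_add 1) j = 0
  d_p : d one_add_one_eq_two p = 0
  d_s : d (neg_add_cancel 1) s = comp f j (zero_add 0)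

namespace H0

variable {A : Type u} [DGCategory.{w} A] [DGShift A]

/-- The standard triangle `X → Y → C → X[1]` given by an internal cone `C` of `f : X → Y`.  The
last morphism is the negative of `C → X → X[1]`; this is the sign convention of Mathlib for the
homotopy category of complexes. -/
def coneTriangle {X Y : A} (f : Hom X Y 0) (hf : d (zero_add 1) f = 0) (c : InternalCone f) :
    Triangle (H0 A) :=
  Triangle.mk (X := ⟨X⟩) (Y := ⟨Y⟩) (Z := ⟨c.obj⟩) (homMk f hf) (homMk c.j c.d_j)
    (-homMk (Y := shift 1 X) (DGCategory.comp c.p (σ 1 X) (add_neg_cancel 1))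
      (d_comp_eq_zero _ _ _ one_add_one_eq_two (neg_add_cancel 1) _ c.d_p (d_σ 1 X _)))

variable (A) in
/-- The exact triangles of the homotopy category: the triangles which are isomorphic to the
standard triangle of an internal cone. -/
def exactTriangles : Set (Triangle (H0 A)) :=
  {T | ∃ (X Y : A) (f : Hom X Y 0) (hf : d (zero_add 1) f = 0) (c : InternalCone f),
    Nonempty (T ≅ coneTriangle f hf c)}

end H0

/-! ### The dg category of complexes and the Vogel dg category -/

section Complexes

variable (𝔞 : Type u) [Category.{v} 𝔞] [Preadditive 𝔞]

/-- The objects of the dg category of complexes `C_dg(𝔞)`: the cochain complexes in `𝔞`. -/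
structure Cdg where
  cpx : CochainComplex 𝔞 ℤ

open CochainComplex.HomComplex in
instance : DGCategory.{v} (Cdg 𝔞) where
  Hom X Y n := Cochain X.cpx Y.cpx n
  d {X Y n m} _ := (δ_hom ℤ X.cpx Y.cpx n m).toAddMonoidHom
  id X := Cochain.ofHom (𝟙 X.cpx)
  comp f g h := f.comp g h
  add_comp f f' g h := Cochain.add_comp f f' g h
  comp_add f g g' h := Cochain.comp_add f g g' h
  id_comp f := Cochain.id_comp f
  comp_id f := Cochain.comp_id f
  assoc f g k h₁ h₂ h₃ _ := by
    subst h₁ h₂ h₃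
    exact Cochain.comp_assoc f g k rfl rfl rfl
  d_d _ _ f := δ_δ _ _ _ f
  d_comp f g h hp hq hr _ _ := δ_comp f g h _ _ _ hr hp hq

open CochainComplex.HomComplex in
/-- The internal shifts of complexes are the usual shifts `(X[n])ᵖ = Xᵖ⁺ⁿ` (with differential
`(-1)ⁿ d`), where `X → X[n]` and `X[n] → X` are the identities in each degree. -/
instance : DGShift (Cdg 𝔞) where
  shift n X := ⟨X.cpx⟦n⟧⟩
  σ n X := Cochain.mk fun p q _ => (X.cpx.shiftFunctorObjXIso n q p (by lia)).inv
  τ n X := Cochain.mk fun p q _ => (X.cpx.shiftFunctorObjXIso n p q (by lia)).hom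
  d_σ n X m h := by
    refine Cochain.ext _ _ fun p q hpq => ?_
    refine (δ_v _ m h _ p q hpq _ _ rfl rfl).trans ?_
    subst h
    simp [Int.negOnePow_succ, Int.negOnePow_neg, CochainComplex.shiftFunctorObjXIso]
    have e (z : X.cpx.X p ⟶ X.cpx.X (q + n)) : n.negOnePow • z + -n.negOnePow • z = 0 := by
      rw [Units.neg_smul, add_neg_cancel]
    exact e _
  d_τ n X m h := by
    refine Cochain.ext _ _ fun p q hpq => ?_
    refine (δ_v _ m h _ p q hpq _ _ rfl rfl).trans ?_
    subst h
    simp [Int.negOnePow_succ, CochainComplex.shiftFunctorObjXIso]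
    have e (z : X.cpx.X (p + n) ⟶ X.cpx.X q) : z + -n.negOnePow • n.negOnePow • z = 0 := by
      rw [Units.neg_smul, smul_smul, Int.units_mul_self, one_smul, add_neg_cancel]
    exact e _
  σ_τ n X := by
    refine Cochain.ext₀ _ _ fun p => ?_
    refine (Cochain.comp_v _ _ _ p (p - n) p (by lia) (by lia)).trans ?_
    simp
    exact (Cochain.ofHom_v (𝟙 X.cpx) p).symm
  τ_σ n X := by
    refine Cochain.ext₀ _ _ fun p => ?_
    refine (Cochain.comp_v _ _ _ p (p + n) p (by lia) (by lia)).trans ?_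
    simp
    exact (Cochain.ofHom_v (𝟙 (X.cpx⟦n⟧)) p).symm

open CochainComplex.HomComplex in
/-- The dg ideal of bounded morphisms: those with `fᵖ = 0` whenever `|p|` is sufficiently large. -/
def boundedIdeal : DGIdeal (Cdg 𝔞) where
  carrier X Y n :=
    { carrier := {f : Cochain X.cpx Y.cpx n |
        ∃ N : ℕ, ∀ (p q : ℤ) (h : p + n = q), N ≤ |p| → f.v p q h = 0}
      zero_mem' := ⟨0, fun _ _ _ _ => rfl⟩
      add_mem' := by
        rintro f g ⟨N, hf⟩ ⟨M, hg⟩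
        refine ⟨max N M, fun p q h hp => ?_⟩
        push_cast at hp
        rw [Cochain.add_v, hf p q h (by lia), hg p q h (by lia), add_zero]
      neg_mem' := by
        rintro f ⟨N, hf⟩
        exact ⟨N, fun p q h hp => by rw [Cochain.neg_v, hf p q h hp, neg_zero]⟩ }
  d_mem := by
    rintro X Y n m h f ⟨N, hf⟩
    refine ⟨N + 1, fun p q hpq hp => ?_⟩
    push_cast at hp
    refine (δ_v n m h f p q hpq _ _ rfl rfl).trans ?_
    rw [Int.abs_eq_natAbs] at hp
    rw [hf _ _ _ (by rw [Int.abs_eq_natAbs]; omega), hf _ _ _ (by rw [Int.abs_eq_natAbs]; omega)]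
    simp
  mem_comp := by
    rintro X Y Z p q r f g h ⟨N, hf⟩
    refine ⟨N, fun i k hik hi => ?_⟩
    refine (Cochain.comp_v f g h i _ k rfl (by lia)).trans ?_
    rw [hf _ _ _ hi, Limits.zero_comp]
  comp_mem := by
    rintro X Y Z p q r f g h ⟨N, hg⟩
    refine ⟨N + p.natAbs, fun i k hik hi => ?_⟩
    refine (Cochain.comp_v f g h i _ k rfl (by lia)).trans ?_
    rw [Int.abs_eq_natAbs] at hi
    rw [hg _ _ _ (by rw [Int.abs_eq_natAbs]; omega), Limits.comp_zero]

/-- The Vogel dg category `V(𝔞)`: the factor dg category of `C_dg(𝔞)` by the bounded morphisms. -/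
abbrev Vogel := Factor (boundedIdeal 𝔞)

variable {𝔞} in
/-- The complex `X` is bounded-above: `Xᵖ = 0` for `p` sufficiently large. -/
def IsBoundedAbove (X : CochainComplex 𝔞 ℤ) : Prop := ∃ n : ℤ, ∀ p : ℤ, n < p → IsZero (X.X p)

variable {𝔞} in
/-- The complex `X` is bounded-below: `Xᵖ = 0` for `-p` sufficiently large. -/
def IsBoundedBelow (X : CochainComplex 𝔞 ℤ) : Prop := ∃ n : ℤ, ∀ p : ℤ, p < n → IsZero (X.X p)

variable {𝔞} in
/-- The complex `X` is bounded. -/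
def IsBounded (X : CochainComplex 𝔞 ℤ) : Prop := IsBoundedAbove X ∧ IsBoundedBelow X

/-- `V⁻(𝔞)`, the full dg subcategory of `V(𝔞)` formed by the bounded-above complexes. -/
abbrev VogelMinus := FullDG fun X : Vogel 𝔞 => IsBoundedAbove X.as.cpx

/-- `V⁺(𝔞)`, the full dg subcategory of `V(𝔞)` formed by the bounded-below complexes. -/
abbrev VogelPlus := FullDG fun X : Vogel 𝔞 => IsBoundedBelow X.as.cpx

variable {𝔞} in
theorem IsBoundedAbove.shift {X : CochainComplex 𝔞 ℤ} (hX : IsBoundedAbove X) (k : ℤ) :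
    IsBoundedAbove (X⟦k⟧) := by
  obtain ⟨n, hn⟩ := hX
  exact ⟨n - k, fun p hp => hn (p + k) (by lia)⟩

variable {𝔞} in
theorem IsBoundedBelow.shift {X : CochainComplex 𝔞 ℤ} (hX : IsBoundedBelow X) (k : ℤ) :
    IsBoundedBelow (X⟦k⟧) := by
  obtain ⟨n, hn⟩ := hX
  exact ⟨n - k, fun p hp => hn (p + k) (by lia)⟩

variable {𝔞} in
theorem IsBounded.shift {X : CochainComplex 𝔞 ℤ} (hX : IsBounded X) (k : ℤ) :
    IsBounded (X⟦k⟧) := ⟨hX.1.shift k, hX.2.shift k⟩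

instance : DGShift (VogelMinus 𝔞) := FullDG.dgShift _ fun n _ hX => hX.shift n

instance : DGShift (VogelPlus 𝔞) := FullDG.dgShift _ fun n _ hX => hX.shift n

/-! ### The homotopy categories of complexes and their Verdier quotients -/

/-- The homotopy category `K(𝔞)` of complexes. -/
abbrev K := HomotopyCategory 𝔞 (ComplexShape.up ℤ)

/-- The objects of `K(𝔞)` given by the bounded-above complexes. -/
def boundedAbove : ObjectProperty (K 𝔞) := fun X => IsBoundedAbove X.as

/-- The objects of `K(𝔞)` given by the bounded-below complexes. -/
def boundedBelow : ObjectProperty (K 𝔞) := fun X => IsBoundedBelow X.as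

/-- The objects of `K(𝔞)` given by the bounded complexes. -/
def bounded : ObjectProperty (K 𝔞) := fun X => IsBounded X.as

/-- The full subcategory `K⁻(𝔞)` of `K(𝔞)`. -/
abbrev KMinus := (boundedAbove 𝔞).FullSubcategory

/-- The full subcategory `K⁺(𝔞)` of `K(𝔞)`. -/
abbrev KPlus := (boundedBelow 𝔞).FullSubcategory

variable {𝔞} in
open CochainComplex.HomComplex in
/-- The canonical functor from complexes in `𝔞` to `H⁰(V(𝔞))`, which is the identity on objects and
sends a cochain map to its class. -/
def fromComplexes : CochainComplex 𝔞 ℤ ⥤ H0 (Vogel 𝔞) where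
  obj X := ⟨⟨⟨X⟩⟩⟩
  map f := H0.homMk (X := (⟨⟨_⟩⟩ : Vogel 𝔞)) (Y := (⟨⟨_⟩⟩ : Vogel 𝔞))
    (QuotientAddGroup.mk (Cochain.ofHom f)) (congrArg QuotientAddGroup.mk (δ_ofHom f))
  map_id _ := rfl
  map_comp f g := by
    exact H0.homMk_congr (congrArg QuotientAddGroup.mk (Cochain.ofHom_comp f g)) _ _

open CochainComplex.HomComplex in
/-- The canonical functor `K(𝔞) ⥤ H⁰(V(𝔞))` induced by the projection `C_dg(𝔞) → V(𝔞)`. -/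
def fromK : K 𝔞 ⥤ H0 (Vogel 𝔞) :=
  CategoryTheory.Quotient.lift _ fromComplexes (by
    rintro X Y f g ⟨h⟩
    refine ((H0.cls_eq_iff _ _ _ _).2 ⟨QuotientAddGroup.mk (Cochain.ofHomotopy h), ?_⟩).symm
    exact congrArg QuotientAddGroup.mk (δ_ofHomotopy h))

/-- The canonical functor `K⁻(𝔞) ⥤ H⁰(V⁻(𝔞))`, the restriction of `K(𝔞) ⥤ H⁰(V(𝔞))`. -/
def fromKMinus : KMinus 𝔞 ⥤ H0 (VogelMinus 𝔞) where
  obj X := ⟨⟨⟨⟨X.obj.as⟩⟩, X.property⟩⟩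
  map f := (fromK 𝔞).map f.hom
  map_id X := (fromK 𝔞).map_id X.obj
  map_comp f g := (fromK 𝔞).map_comp f.hom g.hom

/-- The canonical functor `K⁺(𝔞) ⥤ H⁰(V⁺(𝔞))`, the restriction of `K(𝔞) ⥤ H⁰(V(𝔞))`. -/
def fromKPlus : KPlus 𝔞 ⥤ H0 (VogelPlus 𝔞) where
  obj X := ⟨⟨⟨⟨X.obj.as⟩⟩, X.property⟩⟩
  map f := (fromK 𝔞).map f.hom
  map_id X := (fromK 𝔞).map_id X.obj
  map_comp f g := (fromK 𝔞).map_comp f.hom g.hom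

variable {𝔞} in
theorem IsBounded.of_isZero {X : CochainComplex 𝔞 ℤ} (hX : IsZero X) : IsBounded X :=
  ⟨⟨0, fun p _ => (HomologicalComplex.eval 𝔞 _ p).map_isZero hX⟩,
    ⟨0, fun p _ => (HomologicalComplex.eval 𝔞 _ p).map_isZero hX⟩⟩

variable {𝔞} in
theorem IsBoundedAbove.mappingCone [HasBinaryBiproducts 𝔞] {X Y : CochainComplex 𝔞 ℤ} (f : X ⟶ Y)
    (hX : IsBoundedAbove X) (hY : IsBoundedAbove Y) :
    IsBoundedAbove (CochainComplex.mappingCone f) := by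
  obtain ⟨n, hn⟩ := hX
  obtain ⟨m, hm⟩ := hY
  refine ⟨max n m, fun p hp => ?_⟩
  rw [CochainComplex.mappingCone.isZero_X_iff]
  exact ⟨hn _ (by lia), hm _ (by lia)⟩

variable {𝔞} in
theorem IsBoundedBelow.mappingCone [HasBinaryBiproducts 𝔞] {X Y : CochainComplex 𝔞 ℤ} (f : X ⟶ Y)
    (hX : IsBoundedBelow X) (hY : IsBoundedBelow Y) :
    IsBoundedBelow (CochainComplex.mappingCone f) := by
  obtain ⟨n, hn⟩ := hX
  obtain ⟨m, hm⟩ := hY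
  refine ⟨min (n - 1) m, fun p hp => ?_⟩
  rw [CochainComplex.mappingCone.isZero_X_iff]
  exact ⟨hn _ (by lia), hm _ (by lia)⟩

end Complexes

section Verdier

variable (𝔞 : Type u) [Category.{v} 𝔞] [Preadditive 𝔞] [HasZeroObject 𝔞] [HasBinaryBiproducts 𝔞]

open ZeroObject in
/-- A class of complexes which contains the zero complexes and is closed under shifts and mapping
cones defines a triangulated subcategory of the homotopy category. -/
theorem isTriangulated_of_cone (Q : CochainComplex 𝔞 ℤ → Prop) (h₀ : ∀ X, IsZero X → Q X)
    (h₁ : ∀ X (k : ℤ), Q X → Q (X⟦k⟧))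
    (h₂ : ∀ X Y (f : X ⟶ Y), Q X → Q Y → Q (CochainComplex.mappingCone f)) :
    ObjectProperty.IsTriangulated (C := K 𝔞) (fun X => Q X.as) :=
  letI P : ObjectProperty (K 𝔞) := fun X => Q X.as
  haveI : P.ContainsZero := ⟨⟨(HomotopyCategory.quotient _ _).obj
    (0 : CochainComplex 𝔞 ℤ), Functor.map_isZero _ (isZero_zero _), h₀ _ (isZero_zero _)⟩⟩
  haveI : P.IsStableUnderShift ℤ := ⟨fun n => ⟨fun X hX => by
    obtain ⟨X : CochainComplex 𝔞 ℤ, rfl⟩ := X.quotient_obj_surjective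
    rw [ObjectProperty.prop_shift_iff, HomotopyCategory.shift_quotient_obj]
    exact h₁ X n hX⟩⟩
  haveI : P.IsTriangulatedClosed₃ := ⟨by
    intro T hT hX hY
    obtain ⟨f : T.obj₁.as ⟶ T.obj₂.as, hf⟩ :=
      (HomotopyCategory.quotient _ _).map_surjective T.mor₁
    exact ⟨_, h₂ _ _ f hX hY,
      ⟨Triangle.π₃.mapIso (isoTriangleOfIso₁₂ T _ hT
        (HomotopyCategory.mappingCone_triangleh_distinguished f)
        (Iso.refl _) (Iso.refl _)
          ((Category.comp_id _).trans (hf.symm.trans (Category.id_comp _).symm)))⟩⟩⟩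
  { toIsTriangulatedClosed₂ := .of_isTriangulatedClosed₃ }

instance : (boundedAbove 𝔞).IsTriangulated :=
  isTriangulated_of_cone 𝔞 IsBoundedAbove (fun _ hX => (IsBounded.of_isZero hX).1)
    (fun _ k hX => hX.shift k) (fun _ _ f hX hY => hX.mappingCone f hY)

instance : (boundedBelow 𝔞).IsTriangulated :=
  isTriangulated_of_cone 𝔞 IsBoundedBelow (fun _ hX => (IsBounded.of_isZero hX).2)
    (fun _ k hX => hX.shift k) (fun _ _ f hX hY => hX.mappingCone f hY)

instance : (bounded 𝔞).IsTriangulated :=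
  isTriangulated_of_cone 𝔞 IsBounded (fun _ hX => IsBounded.of_isZero hX)
    (fun _ k hX => hX.shift k)
    (fun _ _ f hX hY => ⟨hX.1.mappingCone f hY.1, hX.2.mappingCone f hY.2⟩)

/-- A triangulated subcategory `Q` contained in another one `P` is a triangulated subcategory
of `P`. -/
theorem isTriangulated_inverseImage_ι {T : Type*} [Category* T] [HasZeroObject T] [HasShift T ℤ]
    [Preadditive T] [∀ n : ℤ, (shiftFunctor T n).Additive] [Pretriangulated T]
    (P Q : ObjectProperty T) [P.IsTriangulated] [Q.IsTriangulated] (h : Q ≤ P) :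
    (Q.inverseImage P.ι).IsTriangulated :=
  letI R := Q.inverseImage P.ι
  haveI : R.ContainsZero := by
    obtain ⟨Z, hZ, hQ⟩ := Q.exists_prop_of_containsZero
    refine ⟨⟨⟨Z, h _ hQ⟩, ?_, hQ⟩⟩
    rw [IsZero.iff_id_eq_zero]
    exact P.ι.map_injective (hZ.eq_of_src _ _)
  haveI : R.IsStableUnderShift ℤ := ⟨fun n => ⟨fun X hX => by
    have e : ((shiftFunctor P.FullSubcategory n).obj X).obj = (shiftFunctor T n).obj X.obj := by
      delta ObjectProperty.hasShift
      rfl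
    change Q ((shiftFunctor P.FullSubcategory n).obj X).obj
    rw [e]
    exact Q.le_shift n X.obj hX⟩⟩
  haveI : R.IsTriangulatedClosed₂ := ⟨by
    intro X hX h₁ h₃
    obtain ⟨Y, hY, ⟨e⟩⟩ := Q.ext_of_isTriangulatedClosed₂' _ (P.ι.map_distinguished X hX) h₁ h₃
    exact ⟨⟨Y, h _ hY⟩, hY, ⟨P.fullyFaithfulι.preimageIso e⟩⟩⟩
  { }

/-- The bounded complexes, as a triangulated subcategory `Kᵇ(𝔞)` of `K⁻(𝔞)`. -/
def boundedInMinus : ObjectProperty (KMinus 𝔞) := (bounded 𝔞).inverseImage (boundedAbove 𝔞).ι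

/-- The bounded complexes, as a triangulated subcategory `Kᵇ(𝔞)` of `K⁺(𝔞)`. -/
def boundedInPlus : ObjectProperty (KPlus 𝔞) := (bounded 𝔞).inverseImage (boundedBelow 𝔞).ι

instance : (boundedInMinus 𝔞).IsTriangulated :=
  isTriangulated_inverseImage_ι _ _ fun _ hX => hX.1

instance : (boundedInPlus 𝔞).IsTriangulated :=
  isTriangulated_inverseImage_ι _ _ fun _ hX => hX.2

end Verdier

/-- The Verdier quotient of a triangulated category by a triangulated subcategory `P`: the
localization at the morphisms whose cone is isomorphic to an object of `P`. -/
abbrev VerdierQuotient {T : Type u} [Category.{v} T] [HasZeroObject T] [HasShift T ℤ]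
    [Preadditive T] [∀ n : ℤ, (shiftFunctor T n).Additive] [Pretriangulated T]
    (P : ObjectProperty T) := P.trW.Localization

/-! ### Triangulated categories and decompositions -/

/-- The category `C`, with its shift and the class `𝒯` of exact triangles, is a triangulated
category (including the octahedral axiom). -/
def IsTriangulatedCategory (C : Type u) [Category.{v} C] [Preadditive C] [HasShift C ℤ]
    (𝒯 : Set (Triangle C)) : Prop :=
  ∃ (_ : HasZeroObject C) (_ : ∀ n : ℤ, (shiftFunctor C n).Additive) (_ : Pretriangulated C),
    distTriang C = 𝒯 ∧ IsTriangulated C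

section

variable {C : Type*} [Category* C] [Preadditive C] [HasShift C ℤ]
  {D : Type*} [Category* D] [Preadditive D] [HasShift D ℤ]
  {E : Type*} [Category* E] [Preadditive E] [HasShift E ℤ]

/-- The functor `F` identifies `C`, with the class `𝒮` of exact triangles, with a full triangulated
subcategory of `D`, with the class `𝒯` of exact triangles: it is fully faithful, and it commutes
with the shifts in such a way that a triangle in `C` is exact if and only if its image is exact. -/
structure IsTriangleEmbedding (F : C ⥤ D) (𝒮 : Set (Triangle C)) (𝒯 : Set (Triangle D)) :
    Prop where
  full : F.Full
  faithful : F.Faithful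
  exact_iff : ∃ _ : F.CommShift ℤ, ∀ T : Triangle C, T ∈ 𝒮 ↔ F.mapTriangle.obj T ∈ 𝒯

/-- The functor `F` is an isomorphism of triangulated categories: a triangle functor which is
fully faithful and bijective on objects. -/
structure IsTriangleIsomorphism (F : C ⥤ D) (𝒮 : Set (Triangle C)) (𝒯 : Set (Triangle D)) :
    Prop extends IsTriangleEmbedding F 𝒮 𝒯 where
  bijective : Function.Bijective F.obj

/-- A semi-orthogonal decomposition `E = ⟨C, D⟩` of a triangulated category into two full
triangulated subcategories, given by their inclusion functors `i` and `j`. -/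
structure IsSemiorthogonalDecomposition (i : C ⥤ E) (j : D ⥤ E) (𝒮 : Set (Triangle C))
    (𝒮' : Set (Triangle D)) (𝒯 : Set (Triangle E)) : Prop where
  embedding_left : IsTriangleEmbedding i 𝒮 𝒯
  embedding_right : IsTriangleEmbedding j 𝒮' 𝒯
  hom_eq_zero : ∀ (Y : D) (X : C) (f : j.obj Y ⟶ i.obj X), f = 0
  exists_triangle : ∀ Z : E, ∃ (Y : D) (X : C) (f : j.obj Y ⟶ Z) (g : Z ⟶ i.obj X)
    (h : i.obj X ⟶ (j.obj Y)⟦(1 : ℤ)⟧), Triangle.mk f g h ∈ 𝒯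

/-- An orthogonal decomposition `E = C × D`: a semi-orthogonal decomposition such that there are no
nonzero morphisms from `C` to `D` either. -/
structure IsOrthogonalDecomposition (i : C ⥤ E) (j : D ⥤ E) (𝒮 : Set (Triangle C))
    (𝒮' : Set (Triangle D)) (𝒯 : Set (Triangle E)) : Prop
    extends IsSemiorthogonalDecomposition i j 𝒮 𝒮' 𝒯 where
  hom_eq_zero' : ∀ (X : C) (Y : D) (f : i.obj X ⟶ j.obj Y), f = 0

end

end VogelDG

end

open VogelDG

noncomputable section

namespace VogelDG

/-! ### Homogeneous morphisms as operators -/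

namespace DGCategory

variable {A : Type u} [DGCategory.{w} A]

-- The triangulated structure exists for every nonempty dg category with internal shifts in which
-- all closed morphisms of degree zero have internal cones. An internal cone is described by
-- equations between `j`, `t`, `p`, `s`, so the axioms reduce to explicit homotopies between words
-- in these morphisms. To compute with such words, each homogeneous morphism is represented
-- faithfully by an additive operator (`opr_injective`). The differential becomes an operator as
-- well, and `d f` is its graded commutator with `f` (`opr_diff`). Degrees then disappear from the
-- calculations, and every identity is one between endomorphism-like words in a preadditive
-- category. For the octahedral axiom, one and the same object is the cone of both relevant
-- composites (`InternalCone.compInclusion`).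
--
-- The Vogel dg category has internal cones although a closed morphism in it need not come from a
-- cochain map: its differential vanishes only outside a finite range of degrees. Deleting that
-- range from source and target changes neither object up to closed isomorphism (`restrictIso`) and
-- turns the morphism into a cochain map, whose mapping cone is then transported back
-- (`exists_internalCone_vogel`). The construction preserves bounds above and below, so it also
-- serves the two subcategories.
--
-- Orthogonality holds already for the morphism complexes: between a bounded-above and a
-- bounded-below complex, in either direction, every homogeneous morphism is bounded. The
-- decomposition triangle of `Z` is split, because `Z` differs from the direct sum of its parts in
-- degrees `≥ 0` and `< 0` only by the component of `d` from degree `-1` to degree `0`, which is a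
-- bounded morphism (`restrict_triangle_mem`).
--
-- For the Verdier quotients, bounded complexes have zero identity in the Vogel category, so the
-- canonical functors are defined on the quotients; they are bijective on objects. Full faithfulness
-- is a calculus of fractions. Between bounded-above complexes, a closed morphism or a homotopy in
-- the Vogel category becomes an honest one after projecting the target to degrees `≤ -N`; the
-- kernel of this projection is bounded, so left fractions result. Between bounded-below complexes,
-- the source is restricted to degrees `≥ N`, which gives right fractions.

/-- The group of all families of homogeneous morphisms to `X`. -/
def rep (X : A) : AddCommGrpCat.{max u w} := AddCommGrpCat.of (∀ (W : A) (m : ℤ), Hom W X m)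

/-- The homogeneous morphism `f` as an operator: the postcomposition with `f`. -/
def opr {X Y : A} {n : ℤ} (f : Hom X Y n) : rep X ⟶ rep Y :=
  AddCommGrpCat.ofHom (AddMonoidHom.mk'
    (fun (x : ∀ (W : A) (m : ℤ), Hom W X m) (W : A) (m : ℤ) =>
      comp (x W (m - n)) f (sub_add_cancel m n))
    (fun x y => by funext W m; exact add_comp _ _ _ _))

/-- The differential as an operator. -/
def diff (X : A) : rep X ⟶ rep X :=
  AddCommGrpCat.ofHom (AddMonoidHom.mk'
    (fun (x : ∀ (W : A) (m : ℤ), Hom W X m) (W : A) (m : ℤ) =>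
      d (sub_add_cancel m 1) (x W (m - 1)))
    (fun x y => by funext W m; exact map_add _ _ _))

/-- The components of an element of `rep X`. -/
def ev {X : A} (x : rep X) (W : A) (m : ℤ) : Hom W X m := x W m

/-- The source degree is a variable constrained by an equation, so it matches any expression equal
to `m - n` without transport between equal degrees. -/
theorem ev_opr {X Y : A} {n : ℤ} (f : Hom X Y n) (x : rep X) {W : A} {k m : ℤ} (h : k + n = m) :
    ev ((opr f).hom x) W m = comp (ev x W k) f h := by
  obtain rfl : k = m - n := by lia
  rfl

theorem ev_diff {X : A} (x : rep X) {W : A} {k m : ℤ} (h : k + 1 = m) :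
    ev ((diff X).hom x) W m = d h (ev x W k) := by
  obtain rfl : k = m - 1 := by lia
  rfl

theorem rep_hom_ext {X Y : A} {F G : rep X ⟶ rep Y}
    (h : ∀ (x : rep X) (W : A) (m : ℤ), ev (F.hom x) W m = ev (G.hom x) W m) : F = G := by
  ext x
  exact funext fun W => funext fun m => h x W m

/-- Yoneda: the operator is evaluated on the family that is the identity at `(X, 0)` and zero
elsewhere. Identities between homogeneous morphisms may therefore be checked on operators. -/
theorem opr_injective {X Y : A} {n : ℤ} {f g : Hom X Y n} (h : opr f = opr g) : f = g := by
  classical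
  let x : rep X := fun (W : A) (m : ℤ) =>
    if e : X = W ∧ 0 = m then e.1 ▸ e.2 ▸ id X else (0 : Hom W X m)
  have hx : ev x X 0 = id X := by simp [x, ev]
  have e : ev ((opr f).hom x) X n = ev ((opr g).hom x) X n := by rw [h]
  rw [ev_opr f x (zero_add n), ev_opr g x (zero_add n), hx, id_comp, id_comp] at e
  exact e

theorem opr_comp {X Y Z : A} {p q r : ℤ} (f : Hom X Y p) (g : Hom Y Z q) (h : p + q = r) :
    opr (comp f g h) = opr f ≫ opr g := by
  refine rep_hom_ext fun x W m => ?_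
  rw [AddCommGrpCat.hom_comp, AddMonoidHom.comp_apply, ev_opr _ _ (show m - r + r = m by lia),
    ev_opr _ _ (show m - q + q = m by lia),
    ev_opr f _ (show m - r + p = m - q by lia), assoc _ _ _ _ h _ (by lia)]

theorem opr_id (X : A) : opr (id X) = 𝟙 (rep X) := by
  refine rep_hom_ext fun x W m => ?_
  rw [ev_opr _ _ (add_zero m), comp_id]
  rfl

theorem opr_add {X Y : A} {n : ℤ} (f g : Hom X Y n) : opr (f + g) = opr f + opr g :=
  rep_hom_ext fun _ _ _ => comp_add _ _ _ _

theorem opr_sub {X Y : A} {n : ℤ} (f g : Hom X Y n) : opr (f - g) = opr f - opr g :=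
  rep_hom_ext fun _ _ _ => comp_sub _ _ _ _

theorem opr_zero (X Y : A) (n : ℤ) : opr (0 : Hom X Y n) = 0 :=
  rep_hom_ext fun _ _ _ => comp_zero _ _

theorem opr_neg {X Y : A} {n : ℤ} (f : Hom X Y n) : opr (-f) = -opr f := by
  rw [← zero_sub, opr_sub, opr_zero, zero_sub]

/-- The Leibniz rule, read as a commutation rule. The criteria below specialise it to degrees `0`,
`1`, `-1`, turning each statement about `d f` into a rule for moving `diff` to the left of `opr f`.
-/
theorem opr_diff {X Y : A} {n m : ℤ} (f : Hom X Y n) (h : n + 1 = m) :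
    opr f ≫ diff Y = opr (d h f) + n.negOnePow • (diff X ≫ opr f) := by
  refine rep_hom_ext fun x W k => ?_
  change ev ((diff Y).hom ((opr f).hom x)) W k =
    ev ((opr (d h f)).hom x) W k + n.negOnePow • ev ((opr f).hom ((diff X).hom x)) W k
  rw [ev_diff _ (show k - 1 + 1 = k by lia),
    ev_opr _ _ (show k - 1 - n + n = k - 1 by lia),
    ev_opr _ _ (show k - 1 - n + m = k by lia), ev_opr _ _ (show k - n + n = k by lia),
    ev_diff _ (show k - 1 - n + 1 = k - n by lia),
    d_comp _ _ _ (show k - 1 - n + 1 = k - n by lia) h _ (by lia) (by lia)]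

theorem d_eq_iff₀ {X Y : A} (f : Hom X Y 0) (g : Hom X Y 1) :
    d (zero_add 1) f = g ↔ opr f ≫ diff Y = opr g + diff X ≫ opr f := by
  have e := opr_diff f (zero_add 1)
  rw [Int.negOnePow_zero, one_smul] at e
  rw [e, add_left_inj]
  exact ⟨fun h => by rw [h], fun h => opr_injective h⟩

theorem d_eq_zero_iff₀ {X Y : A} (f : Hom X Y 0) :
    d (zero_add 1) f = 0 ↔ opr f ≫ diff Y = diff X ≫ opr f := by
  rw [d_eq_iff₀, opr_zero, zero_add]

theorem d_eq_iff_one {X Y : A} (f : Hom X Y 1) (g : Hom X Y 2) :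
    d one_add_one_eq_two f = g ↔ opr f ≫ diff Y = opr g - diff X ≫ opr f := by
  have e := opr_diff f one_add_one_eq_two
  rw [Int.negOnePow_one, Units.neg_smul, one_smul, ← sub_eq_add_neg] at e
  rw [e, sub_left_inj]
  exact ⟨fun h => by rw [h], fun h => opr_injective h⟩

theorem d_eq_zero_iff_one {X Y : A} (f : Hom X Y 1) {m : ℤ} (h : 1 + 1 = m) :
    d h f = 0 ↔ opr f ≫ diff Y = -(diff X ≫ opr f) := by
  obtain rfl : m = 2 := by lia
  exact (d_eq_iff_one f 0).trans (by rw [opr_zero, zero_sub])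

theorem d_eq_iff_neg_one {X Y : A} (f : Hom X Y (-1)) (g : Hom X Y 0) :
    d (neg_add_cancel 1) f = g ↔ opr f ≫ diff Y = opr g - diff X ≫ opr f := by
  have e := opr_diff f (neg_add_cancel 1)
  rw [Int.negOnePow_neg, Int.negOnePow_one, Units.neg_smul, one_smul, ← sub_eq_add_neg] at e
  rw [e, sub_left_inj]
  exact ⟨fun h => by rw [h], fun h => opr_injective h⟩

theorem d_eq_zero_iff_neg_one {X Y : A} (f : Hom X Y (-1)) {m : ℤ} (h : -1 + 1 = m) :
    d h f = 0 ↔ opr f ≫ diff Y = -(diff X ≫ opr f) := by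
  obtain rfl : m = 0 := by lia
  exact (d_eq_iff_neg_one f 0).trans (by rw [opr_zero, zero_sub])

end DGCategory

end VogelDG

-- Operator calculus for internal cones and shifts

namespace VogelDG

open DGCategory DGShift

attribute [simp] opr_id opr_add opr_sub opr_neg opr_zero

namespace InternalCone

variable {A : Type u} [DGCategory.{w} A] {X Y : A} {f : Hom X Y 0} (c : InternalCone f)

@[simp]
theorem opr_j_p : opr c.j ≫ opr c.p = 0 := by
  rw [← opr_comp _ _ (zero_add 1), c.j_p, opr_zero]

@[simp]
theorem opr_s_t : opr c.s ≫ opr c.t = 0 := by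
  rw [← opr_comp _ _ (add_zero (-1)), c.s_t, opr_zero]

@[simp]
theorem opr_j_t : opr c.j ≫ opr c.t = 𝟙 _ := by
  rw [← opr_comp _ _ (zero_add 0), c.j_t, opr_id]

@[simp]
theorem opr_s_p : opr c.s ≫ opr c.p = 𝟙 _ := by
  rw [← opr_comp _ _ (neg_add_cancel 1), c.s_p, opr_id]

-- The relation is oriented so as to eliminate `p` followed by `s`. With the rules that move `diff`
-- to the front, this gives normal forms which are sums of words, to be compared by `abel`.
@[simp]
theorem opr_p_s : opr c.p ≫ opr c.s = 𝟙 _ - opr c.t ≫ opr c.j := by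
  rw [eq_sub_iff_add_eq, ← opr_comp _ _ (add_neg_cancel 1), ← opr_comp _ _ (zero_add 0), ← opr_add,
    c.id_obj, opr_id]

@[simp]
theorem opr_j_diff : opr c.j ≫ diff _ = diff _ ≫ opr c.j := (d_eq_zero_iff₀ _).1 c.d_j

@[simp]
theorem opr_p_diff : opr c.p ≫ diff _ = -(diff _ ≫ opr c.p) := (d_eq_zero_iff_one _ _).1 c.d_p

@[simp]
theorem opr_s_diff : opr c.s ≫ diff _ = opr f ≫ opr c.j - diff _ ≫ opr c.s := by
  rw [(d_eq_iff_neg_one _ _).1 c.d_s, opr_comp]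

section

variable {Z : AddCommGrpCat.{max u w}}

@[simp]
theorem opr_j_p_assoc (g : rep X ⟶ Z) : opr c.j ≫ opr c.p ≫ g = 0 := by
  rw [← Category.assoc, opr_j_p, Limits.zero_comp]

@[simp]
theorem opr_s_t_assoc (g : rep Y ⟶ Z) : opr c.s ≫ opr c.t ≫ g = 0 := by
  rw [← Category.assoc, opr_s_t, Limits.zero_comp]

@[simp]
theorem opr_j_t_assoc (g : rep Y ⟶ Z) : opr c.j ≫ opr c.t ≫ g = g := by
  rw [← Category.assoc, opr_j_t, Category.id_comp]

@[simp]
theorem opr_s_p_assoc (g : rep X ⟶ Z) : opr c.s ≫ opr c.p ≫ g = g := by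
  rw [← Category.assoc, opr_s_p, Category.id_comp]

@[simp]
theorem opr_p_s_assoc (g : rep c.obj ⟶ Z) :
    opr c.p ≫ opr c.s ≫ g = g - opr c.t ≫ opr c.j ≫ g := by
  rw [← Category.assoc, opr_p_s, Preadditive.sub_comp, Category.id_comp, Category.assoc]

@[simp]
theorem opr_j_diff_assoc (g : rep c.obj ⟶ Z) :
    opr c.j ≫ diff _ ≫ g = diff _ ≫ opr c.j ≫ g := by
  rw [← Category.assoc, opr_j_diff, Category.assoc]

@[simp]
theorem opr_p_diff_assoc (g : rep X ⟶ Z) :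
    opr c.p ≫ diff _ ≫ g = -(diff _ ≫ opr c.p ≫ g) := by
  rw [← Category.assoc, opr_p_diff, Preadditive.neg_comp, Category.assoc]

@[simp]
theorem opr_s_diff_assoc (g : rep c.obj ⟶ Z) :
    opr c.s ≫ diff _ ≫ g = opr f ≫ opr c.j ≫ g - diff _ ≫ opr c.s ≫ g := by
  rw [← Category.assoc, opr_s_diff, Preadditive.sub_comp, Category.assoc, Category.assoc]

end

/-- The differential of `t` is not among the axioms but is forced by them: insert `Id = sp + jt`
between `t` and what precedes it, after the differential, in the form `p ≫ s + t ≫ j`, and use the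
known differentials of `j` and `s`. -/
theorem opr_t_diff (hf : d (zero_add 1) f = 0) :
    opr c.t ≫ diff _ = diff _ ≫ opr c.t - opr c.p ≫ opr f := by
  have hf' := (d_eq_zero_iff₀ f).1 hf
  have e : opr c.t ≫ diff _ = (opr c.p ≫ opr c.s + opr c.t ≫ opr c.j) ≫ diff _ ≫ opr c.t
      - opr c.p ≫ opr f := by
    simp only [Preadditive.add_comp, Category.assoc, opr_s_diff_assoc, opr_j_diff_assoc, opr_s_t,
      opr_j_t, Limits.comp_zero, sub_zero, Category.comp_id]
    abel
  rw [e, opr_p_s, sub_add_cancel, Category.id_comp]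

theorem opr_t_diff_assoc (hf : d (zero_add 1) f = 0) {Z : AddCommGrpCat.{max u w}}
    (g : rep Y ⟶ Z) :
    opr c.t ≫ diff _ ≫ g = diff _ ≫ opr c.t ≫ g - opr c.p ≫ opr f ≫ g := by
  rw [← Category.assoc, c.opr_t_diff hf, Preadditive.sub_comp, Category.assoc, Category.assoc]

end InternalCone

section Shift

variable {A : Type u} [DGCategory.{w} A] [DGShift A]

@[simp]
theorem opr_σ_τ (n : ℤ) (X : A) : opr (σ n X) ≫ opr (τ n X) = 𝟙 _ := by
  rw [← opr_comp _ _ (neg_add_cancel n), σ_τ, opr_id]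

@[simp]
theorem opr_τ_σ (n : ℤ) (X : A) : opr (τ n X) ≫ opr (σ n X) = 𝟙 _ := by
  rw [← opr_comp _ _ (add_neg_cancel n), τ_σ, opr_id]

@[simp]
theorem opr_σ_one_diff (X : A) : opr (σ 1 X) ≫ diff _ = -(diff _ ≫ opr (σ 1 X)) :=
  (d_eq_zero_iff_neg_one _ _).1 (d_σ 1 X (neg_add_cancel 1))

@[simp]
theorem opr_τ_one_diff (X : A) : opr (τ 1 X) ≫ diff _ = -(diff _ ≫ opr (τ 1 X)) :=
  (d_eq_zero_iff_one _ _).1 (d_τ 1 X one_add_one_eq_two)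

@[simp]
theorem opr_σ_neg_one_diff (X : A) : opr (σ (-1) X) ≫ diff _ = -(diff _ ≫ opr (σ (-1) X)) := by
  rw [opr_diff _ (show -(-1) + 1 = (2 : ℤ) by lia), d_σ, opr_zero]
  simp

@[simp]
theorem opr_τ_neg_one_diff (X : A) : opr (τ (-1) X) ≫ diff _ = -(diff _ ≫ opr (τ (-1) X)) :=
  (d_eq_zero_iff_neg_one _ _).1 (d_τ (-1) X (neg_add_cancel 1))

section

variable {Z : AddCommGrpCat.{max u w}}

@[simp]
theorem opr_σ_τ_assoc (n : ℤ) (X : A) (g : rep X ⟶ Z) : opr (σ n X) ≫ opr (τ n X) ≫ g = g := by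
  rw [← Category.assoc, opr_σ_τ, Category.id_comp]

@[simp]
theorem opr_τ_one_diff_assoc (X : A) (g : rep X ⟶ Z) :
    opr (τ 1 X) ≫ diff _ ≫ g = -(diff _ ≫ opr (τ 1 X) ≫ g) := by
  rw [← Category.assoc, opr_τ_one_diff, Preadditive.neg_comp, Category.assoc]

@[simp]
theorem opr_τ_neg_one_diff_assoc (X : A) (g : rep X ⟶ Z) :
    opr (τ (-1) X) ≫ diff _ ≫ g = -(diff _ ≫ opr (τ (-1) X) ≫ g) := by
  rw [← Category.assoc, opr_τ_neg_one_diff, Preadditive.neg_comp, Category.assoc]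

end

namespace H0

theorem homMk_eq_iff {B : Type u} [DGCategory.{w} B] {X Y : B} (f g : Hom X Y 0)
    (hf : d (zero_add 1) f = 0) (hg : d (zero_add 1) g = 0) :
    homMk f hf = homMk g hg ↔ ∃ k : Hom X Y (-1), d (neg_add_cancel 1) k = g - f :=
  cls_eq_iff f g hf hg

/-- Two closed morphisms agree in the homotopy category if their operators differ by the
graded commutator of the differential with a morphism of degree `-1`. -/
theorem homMk_eq_of_opr {B : Type u} [DGCategory.{w} B] {X Y : B} {f g : Hom X Y 0}
    {hf : d (zero_add 1) f = 0} {hg : d (zero_add 1) g = 0} (k : Hom X Y (-1))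
    (h : opr k ≫ diff Y = opr g - opr f - diff X ≫ opr k) : homMk f hf = homMk g hg :=
  (homMk_eq_iff _ _ _ _).2 ⟨k, (d_eq_iff_neg_one _ _).2 (by rw [h, opr_sub])⟩

@[simp]
theorem opr_shiftHom (n : ℤ) {X Y : A} (f : Hom X Y 0) :
    opr (shiftHom n f) = opr (τ n X) ≫ opr f ≫ opr (σ n Y) := by
  rw [shiftHom, opr_comp, opr_comp, Category.assoc]

/-- The identification of `X[m][n]` with `X[n][m]`, through the structure morphisms to `X`. -/
def shiftCommHom (m n : ℤ) (X : A) : Hom (shift n (shift m X)) (shift m (shift n X)) 0 :=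
  DGCategory.comp (DGCategory.comp (τ n (shift m X)) (τ m X) rfl)
    (DGCategory.comp (σ n X) (σ m (shift n X)) rfl) (by lia)

theorem d_shiftCommHom (m n : ℤ) (X : A) : d (zero_add 1) (shiftCommHom m n X) = 0 :=
  d_comp_eq_zero _ _ _ rfl rfl _
    (d_comp_eq_zero _ _ _ rfl rfl _ (d_τ _ _ _) (d_τ _ _ _))
    (d_comp_eq_zero _ _ _ rfl rfl _ (d_σ _ _ _) (d_σ _ _ _))

theorem shiftAddInv_comp (m n : ℤ) (X : A) :
    DGCategory.comp (shiftAddInv m n X)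
      (DGCategory.comp (DGCategory.comp (τ (m + n) X) (σ (n + m) X) (by lia))
        (shiftAddHom n m X) (zero_add 0)) (zero_add 0) = shiftCommHom m n X := by
  apply opr_injective
  simp [opr_comp, shiftCommHom, shiftAddHom, shiftAddInv]

/-- The commutation of shifts passes through `X` itself and carries no sign; the signs of a shifted
triangle come only from `Triangle.shiftFunctor`. This formula is needed for the third square in
`shiftTriangleIso`. -/
theorem shiftFunctorComm_hom_app (m n : ℤ) (X : A) :
    (shiftFunctorComm (H0 A) m n).hom.app ⟨X⟩ =
      homMk (shiftCommHom m n X) (d_shiftCommHom m n X) := by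
  have e : (shiftFunctorComm (H0 A) m n).hom.app ⟨X⟩ =
      (shiftFunctorAdd (H0 A) m n).inv.app ⟨X⟩ ≫
        (shiftFunctorAdd' (H0 A) n m (m + n) (add_comm n m)).hom.app ⟨X⟩ := rfl
  have e₁ : (shiftFunctorAdd (H0 A) m n).inv.app ⟨X⟩ =
      homMk (shiftAddInv m n X) (d_shiftAddInv m n X) := rfl
  have e₂ : (shiftFunctorAdd (H0 A) n m).hom.app ⟨X⟩ =
      homMk (shiftAddHom n m X) (d_shiftAddHom n m X) := rfl
  have e₃ : (shiftFunctorAdd' (H0 A) n m (m + n) (add_comm n m)).hom.app ⟨X⟩ =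
      homMk (DGCategory.comp (τ (m + n) X) (σ (n + m) X) (by lia))
        (d_comp_eq_zero _ _ _ rfl rfl _ (d_τ _ X _) (d_σ _ X _)) ≫
      homMk (shiftAddHom n m X) (d_shiftAddHom n m X) := by
    rw [← e₂, ← eqToHom_shift (add_comm m n) X (by rw [add_comm])]
    simp [shiftFunctorAdd']
    rfl
  exact (e.trans (congrArg₂ (fun x y => x ≫ y) e₁ e₃)).trans
    (homMk_congr (shiftAddInv_comp m n X) _ _)

end H0

end Shift

end VogelDG

-- The triangulated structure on the homotopy category of a dg category with cones

namespace VogelDG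

open DGCategory DGShift

/-- Every closed morphism of degree zero has an internal cone. -/
class HasInternalCones (A : Type u) [DGCategory.{w} A] : Prop where
  exists_cone : ∀ {X Y : A} (f : Hom X Y 0), d (zero_add 1) f = 0 → Nonempty (InternalCone f)

/-- The internal cone of the identity is contractible. -/
theorem InternalCone.isZero {A : Type u} [DGCategory.{w} A] {X : A}
    (c : InternalCone (DGCategory.id X)) : IsZero (⟨c.obj⟩ : H0 A) := by
  rw [IsZero.iff_id_eq_zero]
  -- The contraction is `C → X → C`, first `t` and then `s`: the terms `d(s) = j` and `d(t) = -p`,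
  -- up to order and sign, reassemble the decomposition of the identity of `C`.
  refine Eq.symm (H0.homMk_eq_of_opr (f := 0) (g := DGCategory.id c.obj) (hf := map_zero _)
    (hg := d_id _ _) (DGCategory.comp c.t c.s (zero_add (-1))) ?_)
  have := c.opr_t_diff_assoc (d_id _ _) (opr c.s)
  simp [opr_comp, this]
  abel

namespace H0

instance (A : Type u) [DGCategory.{w} A] [HasInternalCones A] [Nonempty A] :
    HasZeroObject (H0 A) :=
  let X : A := Classical.arbitrary A
  ⟨_, (HasInternalCones.exists_cone (DGCategory.id X) (d_id _ _)).some.isZero⟩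

variable {A : Type u} [DGCategory.{w} A] [DGShift A]

instance (n : ℤ) : (shiftFunctor (H0 A) n).Additive where
  map_add := by
    rintro X Y ⟨f, hf⟩ ⟨g, hg⟩
    refine homMk_congr (X := shift n X.as) (Y := shift n Y.as) (f := shiftHom n (f + g))
      (g := shiftHom n f + shiftHom n g) (opr_injective ?_)
      (d_shiftHom _ _ ((cocycles _ _).add_mem hf hg))
      ((cocycles _ _).add_mem (d_shiftHom _ _ hf) (d_shiftHom _ _ hg))
    simp

end H0

section Cones

variable {A : Type u} [DGCategory.{w} A] {X Y X' Y' : A} {f : Hom X Y 0} {f' : Hom X' Y' 0}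

/-- The morphism of internal cones given by a square which commutes up to the homotopy `k`. -/
def coneMap (c : InternalCone f) (c' : InternalCone f') (a : Hom X X' 0) (b : Hom Y Y' 0)
    (k : Hom X Y' (-1)) : Hom c.obj c'.obj 0 :=
  DGCategory.comp (DGCategory.comp c.t b (zero_add 0)) c'.j (zero_add 0) +
    DGCategory.comp (DGCategory.comp c.p a (add_zero 1)) c'.s (add_neg_cancel 1) +
    DGCategory.comp (DGCategory.comp c.p k (add_neg_cancel 1)) c'.j (zero_add 0)

theorem opr_coneMap (c : InternalCone f) (c' : InternalCone f') (a : Hom X X' 0) (b : Hom Y Y' 0)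
    (k : Hom X Y' (-1)) : opr (coneMap c c' a b k) = opr c.t ≫ opr b ≫ opr c'.j +
      opr c.p ≫ opr a ≫ opr c'.s + opr c.p ≫ opr k ≫ opr c'.j := by
  simp [coneMap, opr_comp]

/-- The terms with `b` and `a` fail to be closed by `p ≫ f ≫ b ≫ j'` and `p ≫ a ≫ f' ≫ j'`, with
opposite signs; the differential of the term with `k` cancels exactly this difference. -/
theorem d_coneMap (c : InternalCone f) (c' : InternalCone f') (a : Hom X X' 0) (b : Hom Y Y' 0)
    (k : Hom X Y' (-1)) (hf : d (zero_add 1) f = 0) (ha : d (zero_add 1) a = 0)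
    (hb : d (zero_add 1) b = 0)
    (hk : d (neg_add_cancel 1) k = DGCategory.comp f b (zero_add 0) -
      DGCategory.comp a f' (zero_add 0)) :
    d (zero_add 1) (coneMap c c' a b k) = 0 := by
  have hk' := (d_eq_iff_neg_one _ _).1 hk
  rw [d_eq_zero_iff₀] at ha hb ⊢
  have e₁ := congrArg (fun z => z ≫ opr c'.s) ha
  have e₂ := congrArg (fun z => z ≫ opr c'.j) hb
  have e₃ := congrArg (fun z => z ≫ opr c'.j) hk'
  have e₄ := c.opr_t_diff_assoc hf (opr b ≫ opr c'.j)
  simp only [Category.assoc, opr_sub, opr_comp, Preadditive.sub_comp] at e₁ e₂ e₃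
  simp [opr_coneMap, e₁, e₂, e₃, e₄]
  abel

/-- The homotopy equivalence from the internal cone of the inclusion `j` to `X[1]`. -/
def rotateHom [DGShift A] (c : InternalCone f) (c' : InternalCone c.j) :
    Hom c'.obj (shift 1 X) 0 :=
  -DGCategory.comp (DGCategory.comp c'.t c.p (zero_add 1)) (σ 1 X) (add_neg_cancel 1)

/-- The homotopy inverse of `rotateHom`. -/
def rotateInv [DGShift A] (c : InternalCone f) (c' : InternalCone c.j) :
    Hom (shift 1 X) c'.obj 0 :=
  DGCategory.comp (τ 1 X) (DGCategory.comp f c'.s (zero_add (-1)) -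
    DGCategory.comp c.s c'.j (add_zero (-1))) (add_neg_cancel 1)

theorem opr_rotateHom [DGShift A] (c : InternalCone f) (c' : InternalCone c.j) :
    opr (rotateHom c c') = -(opr c'.t ≫ opr c.p ≫ opr (σ 1 X)) := by
  simp [rotateHom, opr_comp]

theorem opr_rotateInv [DGShift A] (c : InternalCone f) (c' : InternalCone c.j) :
    opr (rotateInv c c') = opr (τ 1 X) ≫ opr f ≫ opr c'.s - opr (τ 1 X) ≫ opr c.s ≫ opr c'.j := by
  simp [rotateInv, opr_comp]

theorem d_rotateHom [DGShift A] (c : InternalCone f) (c' : InternalCone c.j) :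
    d (zero_add 1) (rotateHom c c') = 0 := by
  rw [d_eq_zero_iff₀, opr_rotateHom]
  simp [c'.opr_t_diff_assoc c.d_j]

theorem d_rotateInv [DGShift A] (c : InternalCone f) (c' : InternalCone c.j)
    (hf : d (zero_add 1) f = 0) : d (zero_add 1) (rotateInv c c') = 0 := by
  rw [d_eq_zero_iff₀, opr_rotateInv] at *
  have e := congrArg (fun z => z ≫ opr c'.s) hf
  simp only [Category.assoc] at e
  simp [e]

namespace H0

variable [DGShift A]

/-- The internal cone of the inclusion `j` is isomorphic to `X[1]` in the homotopy category. -/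
def rotateIso (c : InternalCone f) (c' : InternalCone c.j) (hf : d (zero_add 1) f = 0) :
    (⟨c'.obj⟩ : H0 A) ≅ ⟨shift 1 X⟩ where
  hom := homMk (rotateHom c c') (d_rotateHom c c')
  inv := homMk (rotateInv c c') (d_rotateInv c c' hf)
  hom_inv_id := by
    -- The cone of `j` contains `Y` twice, once shifted, as a contractible part. The homotopy `C' →
    -- C → Y → C'` moves one copy to the other. The opposite composite is the identity on the nose.
    refine homMk_eq_of_opr (f := DGCategory.comp (rotateHom c c') (rotateInv c c') (zero_add 0))
      (g := DGCategory.id _)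
      (DGCategory.comp (DGCategory.comp c'.t c.t (zero_add 0)) c'.s (zero_add (-1))) ?_
    simp [opr_comp, opr_rotateHom, opr_rotateInv, c'.opr_t_diff_assoc c.d_j,
      c.opr_t_diff_assoc hf]
    abel
  inv_hom_id := by
    refine homMk_congr (f := DGCategory.comp (rotateInv c c') (rotateHom c c') (zero_add 0))
      (opr_injective ?_) _ _
    simp [opr_comp, opr_rotateHom, opr_rotateInv]

/-- The rotation of a standard triangle is isomorphic to a standard triangle. -/
def rotateTriangleIso (c : InternalCone f) (c' : InternalCone c.j) (hf : d (zero_add 1) f = 0) :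
    coneTriangle c.j c.d_j c' ≅ (coneTriangle f hf c).rotate :=
  Triangle.isoMk _ _ (Iso.refl _) (Iso.refl _) (rotateIso c c' hf)
    ((Category.comp_id _).trans (Category.id_comp _).symm) (by
      refine homMk_congr (f := DGCategory.comp c'.j (rotateHom c c') (zero_add 0))
        (g := DGCategory.comp (DGCategory.id _)
          (-DGCategory.comp c.p (σ 1 X) (add_neg_cancel 1)) (zero_add 0)) (opr_injective ?_) _ _
      simp [opr_comp, opr_rotateHom]) (by
      -- Only this last square needs a homotopy: the projection of `C'` to `Y`, followed by `Y →
      -- Y[1]`.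
      refine homMk_eq_of_opr
        (f := DGCategory.comp (-DGCategory.comp c'.p (σ 1 Y) (add_neg_cancel 1))
          (shiftHom 1 (DGCategory.id Y)) (zero_add 0))
        (g := DGCategory.comp (rotateHom c c') (-shiftHom 1 f) (zero_add 0))
        (DGCategory.comp (DGCategory.comp c'.t c.t (zero_add 0)) (σ 1 Y) (zero_add (-1))) ?_
      simp [opr_comp, opr_rotateHom, c'.opr_t_diff_assoc c.d_j, c.opr_t_diff_assoc hf]
      abel)

end H0

/-- The internal cone of a shifted morphism. -/
def InternalCone.shift [DGShift A] (c : InternalCone f) :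
    InternalCone (H0.shiftHom (-1) f) where
  obj := DGShift.shift (-1) c.obj
  j := H0.shiftHom (-1) c.j
  t := H0.shiftHom (-1) c.t
  -- The structure morphisms of the shift by `-1` are odd, so the differential changes sign when
  -- passing them. The sign on `s` makes the equation for `d(s)` hold, and that on `p` keeps `ps =
  -- Id`.
  p := -DGCategory.comp (DGCategory.comp (τ (-1) c.obj) c.p (neg_add_cancel 1)) (σ (-1) X)
    (zero_add 1)
  s := -DGCategory.comp (DGCategory.comp (τ (-1) X) c.s rfl) (σ (-1) c.obj) (by lia)
  j_p := opr_injective (by simp [opr_comp])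
  s_t := opr_injective (by simp [opr_comp])
  id_obj := opr_injective (by simp [opr_comp])
  j_t := opr_injective (by simp [opr_comp])
  s_p := opr_injective (by simp [opr_comp])
  d_j := H0.d_shiftHom _ _ c.d_j
  d_p := by
    rw [d_eq_zero_iff_one]
    simp [opr_comp]
  d_s := by
    rw [d_eq_iff_neg_one]
    simp [opr_comp]

/-- The shift of a standard triangle by `-1` is isomorphic to a standard triangle. -/
def H0.shiftTriangleIso [DGShift A] (c : InternalCone f) (hf : d (zero_add 1) f = 0) :
    coneTriangle (shiftHom (-1) f) (d_shiftHom _ _ hf) c.shift ≅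
      (Triangle.shiftFunctor (H0 A) (-1)).obj (coneTriangle f hf c) :=
  have hn {U V : H0 A} (z : U ⟶ V) : (-1 : ℤ).negOnePow • z = -z := by
    rw [Int.negOnePow_neg, Int.negOnePow_one, Units.neg_smul, one_smul]
  -- The shift by `-1` negates all three morphisms of a triangle. The minus sign at the middle
  -- vertex absorbs two of these signs; the third is matched by the sign of `p` in
  -- `InternalCone.shift`.
  Triangle.isoMk _ _ (Iso.refl _) (-Iso.refl _) (Iso.refl _) (by
      refine Eq.trans ?_ (congrArg (fun z => 𝟙 _ ≫ z) (hn _)).symm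
      refine homMk_congr (f := DGCategory.comp (shiftHom (-1) f) (-DGCategory.id _) (zero_add 0))
        (g := DGCategory.comp (DGCategory.id _) (-shiftHom (-1) f) (zero_add 0))
        (opr_injective ?_) _ _
      simp [opr_comp]) (by
      refine Eq.trans ?_ (congrArg (fun z => (-𝟙 _) ≫ z) (hn _)).symm
      refine homMk_congr (f := DGCategory.comp (shiftHom (-1) c.j) (DGCategory.id _) (zero_add 0))
        (g := DGCategory.comp (-DGCategory.id _) (-shiftHom (-1) c.j) (zero_add 0))
        (opr_injective ?_) _ _
      simp [opr_comp]) (by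
      refine Eq.trans ?_ (congrArg (fun z => 𝟙 _ ≫ z) (hn _)).symm
      refine Eq.trans ?_ (congrArg (fun z => 𝟙 _ ≫ (-(_ ≫ z)))
        (shiftFunctorComm_hom_app 1 (-1) X)).symm
      refine homMk_congr
        (f := DGCategory.comp (-DGCategory.comp (-DGCategory.comp (DGCategory.comp
            (τ (-1) c.obj) c.p (neg_add_cancel 1)) (σ (-1) X) (zero_add 1))
            (σ 1 _) (add_neg_cancel 1))
          (shiftHom 1 (DGCategory.id _)) (zero_add 0))
        (g := DGCategory.comp (DGCategory.id _) (-DGCategory.comp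
          (shiftHom (-1) (-DGCategory.comp c.p (σ 1 _) (add_neg_cancel 1)))
          (shiftCommHom 1 (-1) X) (zero_add 0)) (zero_add 0))
        (opr_injective ?_) _ _
      simp [opr_comp, shiftCommHom])

/-- The morphism from an internal cone of `g` to an internal cone of `g ≫ j`, where `j` is the
inclusion of an internal cone of `f`. -/
def InternalCone.compMap {W : A} {g : Hom W Y 0} (c : InternalCone f)
    (c' : InternalCone g) (c'' : InternalCone (DGCategory.comp g c.j (zero_add 0))) :
    Hom c'.obj c''.obj 0 :=
  DGCategory.comp (DGCategory.comp c'.t c.j (zero_add 0)) c''.j (zero_add 0) +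
    DGCategory.comp c'.p c''.s (add_neg_cancel 1)

theorem InternalCone.opr_compMap {W : A} {g : Hom W Y 0} (c : InternalCone f)
    (c' : InternalCone g) (c'' : InternalCone (DGCategory.comp g c.j (zero_add 0))) :
    opr (c.compMap c' c'') = opr c'.t ≫ opr c.j ≫ opr c''.j + opr c'.p ≫ opr c''.s := by
  simp [compMap, opr_comp]

/-- The internal cone of `f ≫ j`, where `j` is the inclusion of an internal cone of `g`. -/
def InternalCone.compInclusion {W : A} {g : Hom W Y 0} (c : InternalCone f)
    (c' : InternalCone g) (c'' : InternalCone (DGCategory.comp g c.j (zero_add 0)))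
    (hg : d (zero_add 1) g = 0) :
    InternalCone (DGCategory.comp f c'.j (zero_add 0)) where
  -- As a graded object this is `Y ⊕ X[1] ⊕ W[1]`, the cone of `X ⊕ W → Y`. Grouping `Y` with `X[1]`
  -- gives the cone over `W`; grouping `Y` with `W[1]` gives the cone over `X`.
  obj := c''.obj
  j := c.compMap c' c''
  t := DGCategory.comp (DGCategory.comp c''.t c.t (zero_add 0)) c'.j (zero_add 0) +
    DGCategory.comp c''.p c'.s (add_neg_cancel 1)
  p := DGCategory.comp c''.t c.p (zero_add 1)
  s := DGCategory.comp c.s c''.j (add_zero (-1))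
  j_p := opr_injective (by simp [opr_comp, opr_compMap])
  s_t := opr_injective (by simp [opr_comp])
  id_obj := opr_injective (by simp [opr_comp, opr_compMap]; abel)
  j_t := opr_injective (by simp [opr_comp, opr_compMap])
  s_p := opr_injective (by simp [opr_comp])
  d_j := by
    rw [d_eq_zero_iff₀]
    simp [opr_comp, opr_compMap, c'.opr_t_diff_assoc hg]
    abel
  d_p := by
    rw [d_eq_zero_iff_one]
    simp [opr_comp, c''.opr_t_diff_assoc (d_comp_eq_zero _ _ _ _ _ _ hg c.d_j)]
  d_s := by
    rw [d_eq_iff_neg_one]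
    simp [opr_comp, opr_compMap]

end Cones

theorem complete_triangle_morphism_of_iso {C : Type*} [Category* C] [HasShift C ℤ]
    {T T' S S' : Triangle C} (e : T ≅ S) (e' : T' ≅ S')
    (h : ∀ (a : S.obj₁ ⟶ S'.obj₁) (b : S.obj₂ ⟶ S'.obj₂), S.mor₁ ≫ b = a ≫ S'.mor₁ →
      ∃ φ : S.obj₃ ⟶ S'.obj₃, S.mor₂ ≫ φ = b ≫ S'.mor₂ ∧ S.mor₃ ≫ a⟦1⟧' = φ ≫ S'.mor₃)
    (a : T.obj₁ ⟶ T'.obj₁) (b : T.obj₂ ⟶ T'.obj₂) (fac : T.mor₁ ≫ b = a ≫ T'.mor₁) :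
    ∃ φ : T.obj₃ ⟶ T'.obj₃, T.mor₂ ≫ φ = b ≫ T'.mor₂ ∧ T.mor₃ ≫ a⟦1⟧' = φ ≫ T'.mor₃ := by
  obtain ⟨φ, h₁, h₂⟩ := h (e.inv.hom₁ ≫ a ≫ e'.hom.hom₁) (e.inv.hom₂ ≫ b ≫ e'.hom.hom₂) (by
    rw [e.inv.comm₁_assoc, reassoc_of% fac, e'.hom.comm₁, Category.assoc, Category.assoc])
  refine ⟨e.hom.hom₃ ≫ φ ≫ e'.inv.hom₃, ?_, ?_⟩
  · rw [e.hom.comm₂_assoc, reassoc_of% h₁]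
    simp
  · rw [Category.assoc, Category.assoc, ← e'.inv.comm₃, ← reassoc_of% h₂,
      ← e.hom.comm₃_assoc, ← Functor.map_comp, ← Functor.map_comp]
    simp

namespace H0

variable {A : Type u} [DGCategory.{w} A] [DGShift A]

theorem mem_exactTriangles_of_iso {T T' : Triangle (H0 A)} (e : T ≅ T')
    (hT : T' ∈ exactTriangles A) : T ∈ exactTriangles A := by
  obtain ⟨X, Y, f, hf, c, ⟨e'⟩⟩ := hT
  exact ⟨X, Y, f, hf, c, ⟨e ≪≫ e'⟩⟩

theorem coneTriangle_mem {X Y : A} (f : Hom X Y 0) (hf : d (zero_add 1) f = 0)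
    (c : InternalCone f) : coneTriangle f hf c ∈ exactTriangles A :=
  ⟨X, Y, f, hf, c, ⟨Iso.refl _⟩⟩

theorem exists_coneTriangle_morphism {X Y X' Y' : A} {f : Hom X Y 0} {f' : Hom X' Y' 0}
    (hf : d (zero_add 1) f = 0) (hf' : d (zero_add 1) f' = 0) (c : InternalCone f)
    (c' : InternalCone f') (a : (⟨X⟩ : H0 A) ⟶ ⟨X'⟩) (b : (⟨Y⟩ : H0 A) ⟶ ⟨Y'⟩)
    (fac : homMk f hf ≫ b = a ≫ homMk f' hf') :
    ∃ φ : (⟨c.obj⟩ : H0 A) ⟶ ⟨c'.obj⟩, (coneTriangle f hf c).mor₂ ≫ φ =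
      b ≫ (coneTriangle f' hf' c').mor₂ ∧
      (coneTriangle f hf c).mor₃ ≫ a⟦1⟧' = φ ≫ (coneTriangle f' hf' c').mor₃ := by
  obtain ⟨a, ha, rfl⟩ := homMk_surjective a
  obtain ⟨b, hb, rfl⟩ := homMk_surjective b
  obtain ⟨k, hk⟩ := (homMk_eq_iff _ _ _ _).1 fac.symm
  refine ⟨homMk (coneMap c c' a b k) (d_coneMap c c' a b k hf ha hb hk), ?_, ?_⟩
  · refine homMk_congr (f := DGCategory.comp c.j (coneMap c c' a b k) (zero_add 0))
      (g := DGCategory.comp b c'.j (zero_add 0)) (opr_injective ?_) _ _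
    simp [opr_comp, opr_coneMap]
  · refine homMk_congr
      (f := DGCategory.comp (-DGCategory.comp c.p (σ 1 X) (add_neg_cancel 1)) (shiftHom 1 a)
        (zero_add 0))
      (g := DGCategory.comp (coneMap c c' a b k)
        (-DGCategory.comp c'.p (σ 1 X') (add_neg_cancel 1)) (zero_add 0)) (opr_injective ?_) _ _
    simp [opr_comp, opr_coneMap]

theorem exists_triangle_morphism {T T' : Triangle (H0 A)} (hT : T ∈ exactTriangles A)
    (hT' : T' ∈ exactTriangles A) (a : T.obj₁ ⟶ T'.obj₁) (b : T.obj₂ ⟶ T'.obj₂)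
    (fac : T.mor₁ ≫ b = a ≫ T'.mor₁) :
    ∃ φ : T.obj₃ ⟶ T'.obj₃, T.mor₂ ≫ φ = b ≫ T'.mor₂ ∧ T.mor₃ ≫ a⟦1⟧' = φ ≫ T'.mor₃ := by
  obtain ⟨X, Y, f, hf, c, ⟨e⟩⟩ := hT
  obtain ⟨X', Y', f', hf', c', ⟨e'⟩⟩ := hT'
  refine complete_triangle_morphism_of_iso e e' (fun a b fac => ?_) a b fac
  exact exists_coneTriangle_morphism hf hf' c c' a b fac

theorem rotate_mem [HasInternalCones A] {T : Triangle (H0 A)} (hT : T ∈ exactTriangles A) :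
    T.rotate ∈ exactTriangles A := by
  obtain ⟨X, Y, f, hf, c, ⟨e⟩⟩ := hT
  obtain ⟨c'⟩ := HasInternalCones.exists_cone c.j c.d_j
  exact ⟨_, _, _, _, c', ⟨(rotate _).mapIso e ≪≫ (rotateTriangleIso c c' hf).symm⟩⟩

theorem shift_neg_one_mem {T : Triangle (H0 A)} (hT : T ∈ exactTriangles A) :
    (Triangle.shiftFunctor (H0 A) (-1)).obj T ∈ exactTriangles A := by
  obtain ⟨X, Y, f, hf, c, ⟨e⟩⟩ := hT
  exact ⟨_, _, _, _, c.shift, ⟨Functor.mapIso _ e ≪≫ (shiftTriangleIso c hf).symm⟩⟩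

/-- The inverse rotation is the double rotation shifted by `-1`, so no separate construction with
cones is required. -/
theorem invRotate_mem [HasInternalCones A] {T : Triangle (H0 A)} (hT : T ∈ exactTriangles A) :
    T.invRotate ∈ exactTriangles A :=
  mem_exactTriangles_of_iso ((invRotateIsoRotateRotateShiftFunctorNegOne _).app T)
    (shift_neg_one_mem (rotate_mem (rotate_mem hT)))

theorem contractible_mem [HasInternalCones A] [Nonempty A] (X : H0 A) :
    contractibleTriangle X ∈ exactTriangles A := by
  obtain ⟨c⟩ := HasInternalCones.exists_cone (DGCategory.id X.as) (d_id _ _)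
  refine ⟨_, _, _, d_id _ _, c, ⟨Triangle.isoMk _ _ (Iso.refl _) (Iso.refl _)
    ((isZero_zero _).iso c.isZero) rfl (c.isZero.eq_of_tgt _ _) ((isZero_zero _).eq_of_src _ _)⟩⟩

/-- The homotopy category of a dg category with internal shifts and internal cones is
pretriangulated. -/
instance pretriangulated [HasInternalCones A] [Nonempty A] : Pretriangulated (H0 A) where
  distinguishedTriangles := exactTriangles A
  isomorphic_distinguished _ hT _ e := mem_exactTriangles_of_iso e hT
  contractible_distinguished := contractible_mem
  distinguished_cocone_triangle {X Y} F := by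
    obtain ⟨f, hf, rfl⟩ := homMk_surjective F
    obtain ⟨c⟩ := HasInternalCones.exists_cone f hf
    exact ⟨_, _, _, coneTriangle_mem f hf c⟩
  rotate_distinguished_triangle T :=
    ⟨rotate_mem, fun hT => mem_exactTriangles_of_iso ((triangleRotation _).unitIso.app T)
      (invRotate_mem hT)⟩
  complete_distinguished_triangle_morphism _ _ hT hT' a b fac :=
    exists_triangle_morphism hT hT' a b fac

/-- The homotopy category of a dg category with internal shifts and internal cones is
triangulated. -/
instance isTriangulated [HasInternalCones A] [Nonempty A] : IsTriangulated (H0 A) :=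
  IsTriangulated.mk' fun X Y Z u v => by
    -- Completing `v` on the left makes `Z` isomorphic to the cone of some `q : W ⟶ Y`, with `v`
    -- corresponding to its inclusion `b.j`. The composite of `u` and `b.j` then has as a cone the
    -- object `c'`, chosen as a cone of `q` followed by `c.j`, and the octahedron consists of
    -- explicit morphisms.
    obtain ⟨W, q, r, hT⟩ := distinguished_cocone_triangle₁ v
    obtain ⟨u, hu, rfl⟩ := homMk_surjective u
    obtain ⟨q, hq, rfl⟩ := homMk_surjective q
    obtain ⟨b⟩ := HasInternalCones.exists_cone q hq
    obtain ⟨c⟩ := HasInternalCones.exists_cone u hu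
    have hqj := d_comp_eq_zero q c.j (zero_add 0) _ _ (zero_add 1) hq c.d_j
    obtain ⟨c'⟩ := HasInternalCones.exists_cone _ hqj
    let e := isoTriangleOfIso₁₂ _ _ hT (coneTriangle_mem q hq b) (Iso.refl _) (Iso.refl _)
      ((Category.comp_id _).trans (Category.id_comp _).symm)
    have he : v ≫ e.hom.hom₃ = 𝟙 Y ≫ homMk b.j b.d_j := e.hom.comm₂
    refine ⟨X, Y, ⟨b.obj⟩, ⟨c.obj⟩, ⟨DGShift.shift 1 W.as⟩, ⟨c'.obj⟩, homMk u hu, homMk b.j b.d_j,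
      Iso.refl _, Iso.refl _, Triangle.π₃.mapIso e,
      (Category.comp_id _).trans (Category.id_comp _).symm, he, _, _, coneTriangle_mem u hu c,
      _, _, rotate_mem (coneTriangle_mem q hq b), _, _,
      coneTriangle_mem _ (d_comp_eq_zero u b.j (zero_add 0) _ _ _ hu b.d_j)
        (c.compInclusion b c' hq), ⟨?_⟩⟩
    refine
      { m₁ := homMk c'.j c'.d_j
        m₃ := (coneTriangle _ hqj c').mor₃
        comm₁ := ?_
        comm₂ := ?_
        comm₃ := ?_
        comm₄ := ?_
        mem := ?_ }
    · refine homMk_congr (f := DGCategory.comp c.j c'.j (zero_add 0))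
        (g := DGCategory.comp b.j (c.compMap b c') (zero_add 0)) (opr_injective ?_) _ _
      simp [opr_comp, c.opr_compMap]
    · refine homMk_congr (f := DGCategory.comp c'.j (-DGCategory.comp (DGCategory.comp c'.t c.p
          (zero_add 1)) (σ 1 X.as) (add_neg_cancel 1)) (zero_add 0))
        (g := -DGCategory.comp c.p (σ 1 X.as) (add_neg_cancel 1)) (opr_injective ?_) _ _
      simp [opr_comp]
    · refine homMk_congr (f := DGCategory.comp (c.compMap b c')
          (-DGCategory.comp c'.p (σ 1 W.as) (add_neg_cancel 1)) (zero_add 0))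
        (g := -DGCategory.comp b.p (σ 1 W.as) (add_neg_cancel 1)) (opr_injective ?_) _ _
      simp [opr_comp, c.opr_compMap]
    -- As for rotation, this is the one square that commutes only up to homotopy; the homotopy
    -- projects the double cone to `Y` and then passes to `Y[1]`.
    · refine homMk_eq_of_opr (f := DGCategory.comp (-DGCategory.comp (DGCategory.comp c'.t c.p
          (zero_add 1)) (σ 1 X.as) (add_neg_cancel 1)) (shiftHom 1 u) (zero_add 0))
        (g := DGCategory.comp (-DGCategory.comp c'.p (σ 1 W.as) (add_neg_cancel 1))
          (-shiftHom 1 q) (zero_add 0))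
        (DGCategory.comp (DGCategory.comp c'.t c.t (zero_add 0)) (σ 1 Y.as) (zero_add (-1))) ?_
      simp [opr_comp, c'.opr_t_diff_assoc hqj, c.opr_t_diff_assoc hu]
      abel
    · refine mem_exactTriangles_of_iso ?_ (rotate_mem (coneTriangle_mem _ hqj c'))
      refine Triangle.isoMk _ _ (Iso.refl _) (Iso.refl _) (Iso.refl _)
        ((Category.comp_id _).trans (Category.id_comp _).symm)
        ((Category.comp_id _).trans (Category.id_comp _).symm) ?_
      refine homMk_congr (f := DGCategory.comp (DGCategory.comp (-shiftHom 1 q) (shiftHom 1 c.j)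
          (zero_add 0)) (shiftHom 1 (DGCategory.id _)) (zero_add 0))
        (g := DGCategory.comp (DGCategory.id _) (-shiftHom 1 (DGCategory.comp q c.j (zero_add 0)))
          (zero_add 0)) (opr_injective ?_) _ _
      simp [opr_comp]

end H0

end VogelDG

-- Internal cones in factors and full dg subcategories; split triangles

namespace VogelDG

open DGCategory DGShift

section Generic

/-- The image of an internal cone in a factor dg category. -/
def InternalCone.factor {A : Type u} [DGCategory.{w} A] (I : DGIdeal A) {X Y : A} {f : Hom X Y 0}
    (c : InternalCone f) :
    InternalCone (X := (⟨X⟩ : Factor I)) (Y := ⟨Y⟩) (QuotientAddGroup.mk f) where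
  obj := ⟨c.obj⟩
  j := QuotientAddGroup.mk c.j
  t := QuotientAddGroup.mk c.t
  p := QuotientAddGroup.mk c.p
  s := QuotientAddGroup.mk c.s
  j_p := congrArg QuotientAddGroup.mk c.j_p
  s_t := congrArg QuotientAddGroup.mk c.s_t
  id_obj := congrArg QuotientAddGroup.mk c.id_obj
  j_t := congrArg QuotientAddGroup.mk c.j_t
  s_p := congrArg QuotientAddGroup.mk c.s_p
  d_j := congrArg QuotientAddGroup.mk c.d_j
  d_p := congrArg QuotientAddGroup.mk c.d_p
  d_s := congrArg QuotientAddGroup.mk c.d_s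

/-- An internal cone in a full dg subcategory. -/
def InternalCone.full {A : Type u} [DGCategory.{w} A] {P : A → Prop} {X Y : FullDG P}
    {f : Hom X Y 0} (c : InternalCone (X := X.obj) (Y := Y.obj) f) (h : P c.obj) :
    InternalCone f where
  obj := ⟨c.obj, h⟩
  j := c.j
  t := c.t
  p := c.p
  s := c.s
  j_p := c.j_p
  s_t := c.s_t
  id_obj := c.id_obj
  j_t := c.j_t
  s_p := c.s_p
  d_j := c.d_j
  d_p := c.d_p
  d_s := c.d_s

/-- An internal cone in a full dg subcategory, as an internal cone in the ambient dg category. -/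
def InternalCone.ofFull {A : Type u} [DGCategory.{w} A] {P : A → Prop} {X Y : FullDG P}
    {f : Hom X Y 0} (c : InternalCone f) : InternalCone (X := X.obj) (Y := Y.obj) f where
  obj := c.obj.obj
  j := c.j
  t := c.t
  p := c.p
  s := c.s
  j_p := c.j_p
  s_t := c.s_t
  id_obj := c.id_obj
  j_t := c.j_t
  s_p := c.s_p
  d_j := c.d_j
  d_p := c.d_p
  d_s := c.d_s

/-- A closed isomorphism of degree zero. -/
structure ClosedIso {A : Type u} [DGCategory.{w} A] (X Y : A) where
  hom : Hom X Y 0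
  inv : Hom Y X 0
  d_hom : d (zero_add 1) hom = 0
  d_inv : d (zero_add 1) inv = 0
  hom_inv : comp hom inv (zero_add 0) = DGCategory.id X
  inv_hom : comp inv hom (zero_add 0) = DGCategory.id Y

/-- Transport of an internal cone along closed isomorphisms. -/
def InternalCone.ofIso {A : Type u} [DGCategory.{w} A] {X Y X' Y' : A} {f : Hom X Y 0}
    {f' : Hom X' Y' 0} (c : InternalCone f') (α : ClosedIso X X') (β : ClosedIso Y Y')
    (h : comp f β.hom (zero_add 0) = comp α.hom f' (zero_add 0)) : InternalCone f :=
  have α₁ : opr α.hom ≫ opr α.inv = 𝟙 _ := by rw [← opr_comp _ _ (zero_add 0), α.hom_inv, opr_id]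
  have α₂ : opr α.inv ≫ opr α.hom = 𝟙 _ := by rw [← opr_comp _ _ (zero_add 0), α.inv_hom, opr_id]
  have β₁ : opr β.hom ≫ opr β.inv = 𝟙 _ := by rw [← opr_comp _ _ (zero_add 0), β.hom_inv, opr_id]
  have β₂ : opr β.inv ≫ opr β.hom = 𝟙 _ := by rw [← opr_comp _ _ (zero_add 0), β.inv_hom, opr_id]
  have d₁ := (d_eq_zero_iff₀ _).1 α.d_hom
  have d₂ := (d_eq_zero_iff₀ _).1 α.d_inv
  have d₃ := (d_eq_zero_iff₀ _).1 β.d_hom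
  have hf : opr f ≫ opr β.hom = opr α.hom ≫ opr f' := by
    rw [← opr_comp _ _ (zero_add 0), h, opr_comp]
  { obj := c.obj
    j := comp β.hom c.j (zero_add 0)
    t := comp c.t β.inv (zero_add 0)
    p := comp c.p α.inv (add_zero 1)
    s := comp α.hom c.s (zero_add (-1))
    j_p := opr_injective (by simp [opr_comp])
    s_t := opr_injective (by simp [opr_comp])
    id_obj := opr_injective (by simp [opr_comp, reassoc_of% α₂, reassoc_of% β₂])
    j_t := opr_injective (by simp [opr_comp, β₁])
    s_p := opr_injective (by simp [opr_comp, α₁])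
    d_j := by
      rw [d_eq_zero_iff₀]
      simp [opr_comp, reassoc_of% d₃]
    d_p := by
      rw [d_eq_zero_iff_one]
      simp [opr_comp, d₂]
    d_s := by
      rw [d_eq_iff_neg_one]
      simp [opr_comp, reassoc_of% d₁, reassoc_of% hf] }

variable {A : Type u} [DGCategory.{w} A]

instance (P : A → Prop) : (H0.incl P).Full := ⟨fun F => ⟨F, rfl⟩⟩

instance (P : A → Prop) : (H0.incl P).Faithful := ⟨fun h => h⟩

/-- The inclusion of a full dg subcategory which is closed under the shifts commutes with
the shifts. -/
@[reducible]
def inclCommShift [DGShift A] (P : A → Prop) (hP : ∀ n X, P X → P (shift n X)) :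
    letI := FullDG.dgShift P hP
    (H0.incl P).CommShift ℤ :=
  letI := FullDG.dgShift P hP
  -- The shifts of the full dg subcategory are those of `A`, so identities serve; the coherence
  -- conditions reduce to an isomorphism composed with its inverse.
  { commShiftIso := fun n => NatIso.ofComponents (fun X => Iso.refl _)
      (fun f => (Category.comp_id _).trans (Category.id_comp _).symm)
    commShiftIso_zero := by
      ext X
      refine Eq.trans ?_ (Functor.CommShift.isoZero_hom_app (H0.incl P) ℤ X).symm
      exact ((shiftFunctorZero (H0 A) ℤ).app ((H0.incl P).obj X)).hom_inv_id.symm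
    commShiftIso_add := fun m n => by
      ext X
      refine Eq.trans ?_ (Functor.CommShift.isoAdd_hom_app (F := H0.incl P) _ _ X).symm
      refine ((shiftFunctorAdd (H0 A) m n).app ((H0.incl P).obj X)).hom_inv_id.symm.trans ?_
      refine congrArg (fun z => ((shiftFunctorAdd (H0 A) m n).app ((H0.incl P).obj X)).hom ≫ z) ?_
      refine (Category.id_comp _).symm.trans (congrArg (fun z => 𝟙 _ ≫ z) ?_)
      refine (Category.id_comp _).symm.trans (congrArg (fun z => z ≫ _) ?_)
      exact ((shiftFunctor (H0 A) n).map_id _).symm }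

theorem incl_mapTriangle_coneTriangle [DGShift A] (P : A → Prop)
    (hP : ∀ n X, P X → P (shift n X)) {X Y : FullDG P} {f : Hom X Y 0}
    (hf : d (zero_add 1) f = 0) (c : InternalCone f) :
    letI := FullDG.dgShift P hP
    letI := inclCommShift P hP
    (H0.incl P).mapTriangle.obj (H0.coneTriangle f hf c) =
      H0.coneTriangle (X := X.obj) (Y := Y.obj) f hf c.ofFull := by
  let := FullDG.dgShift P hP
  let := inclCommShift P hP
  refine congrArg (Triangle.mk (C := H0 A) _ _) ?_
  exact Category.comp_id _

theorem incl_isTriangulated [DGShift A] (P : A → Prop)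
    (hP : ∀ n X, P X → P (shift n X)) [HasInternalCones A] [Nonempty A]
    [HasInternalCones (FullDG P)] [Nonempty (FullDG P)] :
    letI := FullDG.dgShift P hP
    letI := inclCommShift P hP
    (H0.incl P).IsTriangulated := by
  let := FullDG.dgShift P hP
  let := inclCommShift P hP
  refine ⟨fun T hT => ?_⟩
  obtain ⟨X, Y, f, hf, c, ⟨e⟩⟩ := hT
  refine H0.mem_exactTriangles_of_iso ((H0.incl P).mapTriangle.mapIso e) ?_
  rw [incl_mapTriangle_coneTriangle P hP hf c]
  exact H0.coneTriangle_mem _ _ _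

theorem isTriangleEmbedding_incl [DGShift A] (P : A → Prop)
    (hP : ∀ n X, P X → P (shift n X)) [HasInternalCones A] [Nonempty A]
    [HasInternalCones (FullDG P)] [Nonempty (FullDG P)] :
    letI := FullDG.dgShift P hP
    IsTriangleEmbedding (H0.incl P) (H0.exactTriangles (FullDG P)) (H0.exactTriangles A) := by
  let := FullDG.dgShift P hP
  let := inclCommShift P hP
  have := incl_isTriangulated P hP
  -- A fully faithful triangle functor also reflects exact triangles, which gives the nontrivial
  -- direction.
  exact ⟨inferInstance, inferInstance, inferInstance,
    fun T => ((H0.incl P).map_distinguished_iff T).symm⟩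

theorem binaryBicone_triangle_mem {C : Type*} [Category* C] [Preadditive C] [HasZeroObject C]
    [HasShift C ℤ] [∀ n : ℤ, (shiftFunctor C n).Additive] [Pretriangulated C] {Y Z X : C}
    (i : Y ⟶ Z) (r : Z ⟶ Y) (q : Z ⟶ X) (l : X ⟶ Z) (hir : i ≫ r = 𝟙 Y) (hlq : l ≫ q = 𝟙 X)
    (hiq : i ≫ q = 0) (hlr : l ≫ r = 0) (h : r ≫ i + q ≫ l = 𝟙 Z) :
    Triangle.mk i q (0 : X ⟶ Y⟦(1 : ℤ)⟧) ∈ distTriang C := by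
  let e : Z ≅ Y ⊞ X :=
    { hom := biprod.lift r q
      inv := biprod.desc i l
      hom_inv_id := by rw [biprod.lift_desc, h]
      inv_hom_id := by
        apply biprod.hom_ext <;> apply biprod.hom_ext' <;> simp [hir, hlq, hiq, hlr] }
  have he : e.hom = biprod.lift r q := rfl
  refine isomorphic_distinguished _ (binaryBiproductTriangle_distinguished Y X) _
    (Triangle.isoMk _ _ (Iso.refl _) e (Iso.refl _) ?_ ?_ ?_)
  · change i ≫ e.hom = 𝟙 Y ≫ biprod.inl
    apply biprod.hom_ext <;> simp [he, hir, hiq]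
  · change q ≫ 𝟙 X = e.hom ≫ biprod.snd
    simp [he]
  · change (0 : X ⟶ Y⟦(1 : ℤ)⟧) ≫ (𝟙 Y)⟦(1 : ℤ)⟧' = 𝟙 X ≫ 0
    simp

end Generic

end VogelDG

-- Brutal restrictions of complexes

namespace VogelDG

open DGCategory DGShift CochainComplex.HomComplex

section Restrict

variable {𝔞 : Type u} [Category.{v} 𝔞] [Preadditive 𝔞] [HasZeroObject 𝔞]

open scoped Classical in
open ZeroObject in
/-- The components of the brutal restriction of a complex to the degrees in `S`. -/
def restrictX (S : ℤ → Prop) (X : CochainComplex 𝔞 ℤ) (p : ℤ) : 𝔞 :=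
  if S p then X.X p else 0

/-- The inclusion of the components in the degrees in `S`. -/
def restrictXι (S : ℤ → Prop) (X : CochainComplex 𝔞 ℤ) (p : ℤ) : restrictX S X p ⟶ X.X p :=
  open scoped Classical in if h : S p then eqToHom (by rw [restrictX, if_pos h]) else 0

/-- The projection to the components in the degrees in `S`. -/
def restrictXπ (S : ℤ → Prop) (X : CochainComplex 𝔞 ℤ) (p : ℤ) : X.X p ⟶ restrictX S X p :=
  open scoped Classical in if h : S p then eqToHom (by rw [restrictX, if_pos h]) else 0

theorem restrictXπ_ι {S : ℤ → Prop} (X : CochainComplex 𝔞 ℤ) {p : ℤ} (h : S p) :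
    restrictXπ S X p ≫ restrictXι S X p = 𝟙 _ := by
  simp [restrictXι, restrictXπ, h]

theorem restrictXπ_eq_zero {S : ℤ → Prop} (X : CochainComplex 𝔞 ℤ) {p : ℤ} (h : ¬S p) :
    restrictXπ S X p = 0 := by
  simp [restrictXπ, h]

/-- The brutal restriction of a complex to the degrees in `S`. -/
def restrict (S : ℤ → Prop) (X : CochainComplex 𝔞 ℤ) : CochainComplex 𝔞 ℤ where
  X := restrictX S X
  d p q := restrictXι S X p ≫ X.d p q ≫ restrictXπ S X q
  shape p q h := by rw [X.shape p q h, Limits.zero_comp, Limits.comp_zero]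
  d_comp_d' p q r _ _ := by
    -- The square of the restricted differential vanishes for any `S`, without convexity: if the
    -- middle degree is kept, it comes from `d ∘ d = 0` in `X`; otherwise the composite passes
    -- through zero.
    by_cases h : S q
    · simp only [Category.assoc]
      rw [reassoc_of% restrictXπ_ι X h, X.d_comp_d_assoc, Limits.zero_comp, Limits.comp_zero]
    · rw [restrictXπ_eq_zero X h]
      simp

/-- The inclusion of the restriction in each degree. -/
def restrictι (S : ℤ → Prop) (X : CochainComplex 𝔞 ℤ) (p : ℤ) : (restrict S X).X p ⟶ X.X p :=
  restrictXι S X p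

/-- The projection to the restriction in each degree. -/
def restrictπ (S : ℤ → Prop) (X : CochainComplex 𝔞 ℤ) (p : ℤ) : X.X p ⟶ (restrict S X).X p :=
  restrictXπ S X p

theorem restrict_d (S : ℤ → Prop) (X : CochainComplex 𝔞 ℤ) (p q : ℤ) :
    (restrict S X).d p q = restrictι S X p ≫ X.d p q ≫ restrictπ S X q := rfl

theorem isZero_restrict_X {S : ℤ → Prop} (X : CochainComplex 𝔞 ℤ) {p : ℤ} (h : ¬S p) :
    IsZero ((restrict S X).X p) := by
  change IsZero (restrictX S X p)
  rw [restrictX, if_neg h]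
  exact isZero_zero 𝔞

theorem restrictπ_ι {S : ℤ → Prop} (X : CochainComplex 𝔞 ℤ) {p : ℤ} (h : S p) :
    restrictπ S X p ≫ restrictι S X p = 𝟙 _ := restrictXπ_ι X h

theorem restrictπ_ι_assoc {S : ℤ → Prop} (X : CochainComplex 𝔞 ℤ) {p : ℤ} (h : S p) {Z : 𝔞}
    (g : X.X p ⟶ Z) : restrictπ S X p ≫ restrictι S X p ≫ g = g := by
  rw [← Category.assoc, restrictπ_ι X h, Category.id_comp]

theorem restrictι_eq_zero {S : ℤ → Prop} (X : CochainComplex 𝔞 ℤ) {p : ℤ} (h : ¬S p) :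
    restrictι S X p = 0 := (isZero_restrict_X X h).eq_of_src _ _

theorem restrictπ_eq_zero {S : ℤ → Prop} (X : CochainComplex 𝔞 ℤ) {p : ℤ} (h : ¬S p) :
    restrictπ S X p = 0 := (isZero_restrict_X X h).eq_of_tgt _ _

@[simp]
theorem restrictι_π (S : ℤ → Prop) (X : CochainComplex 𝔞 ℤ) (p : ℤ) :
    restrictι S X p ≫ restrictπ S X p = 𝟙 _ := by
  by_cases h : S p
  · have e : restrictXι S X p ≫ restrictXπ S X p = 𝟙 _ := by simp [restrictXι, restrictXπ, h]
    exact e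
  · exact (isZero_restrict_X X h).eq_of_src _ _

theorem isZero_restrict_X_of_isZero (S : ℤ → Prop) {X : CochainComplex 𝔞 ℤ} {p : ℤ}
    (h : IsZero (X.X p)) : IsZero ((restrict S X).X p) := by
  rw [IsZero.iff_id_eq_zero, ← restrictι_π, h.eq_of_tgt (restrictι S X p) 0, Limits.zero_comp]

/-- The inclusion of the brutal restriction, as a cochain. -/
def restrictInc (S : ℤ → Prop) (X : CochainComplex 𝔞 ℤ) : Cochain (restrict S X) X 0 :=
  Cochain.ofHoms (restrictι S X)

/-- The projection to the brutal restriction, as a cochain. -/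
def restrictProj (S : ℤ → Prop) (X : CochainComplex 𝔞 ℤ) : Cochain X (restrict S X) 0 :=
  Cochain.ofHoms (restrictπ S X)

@[simp]
theorem restrictInc_v (S : ℤ → Prop) (X : CochainComplex 𝔞 ℤ) (p : ℤ) :
    (restrictInc S X).v p p (add_zero p) = restrictι S X p := Cochain.ofHoms_v _ _

@[simp]
theorem restrictProj_v (S : ℤ → Prop) (X : CochainComplex 𝔞 ℤ) (p : ℤ) :
    (restrictProj S X).v p p (add_zero p) = restrictπ S X p := Cochain.ofHoms_v _ _

/-- Stated one degree at a time, since the inclusion can fail to commute with `d` only where `p`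
lies in `S` and `q` does not. Finitely many such places are harmless modulo bounded morphisms. -/
theorem restrictι_comp_d {S : ℤ → Prop} (X : CochainComplex 𝔞 ℤ) {p q : ℤ} (hS : S p → S q) :
    restrictι S X p ≫ X.d p q = (restrict S X).d p q ≫ restrictι S X q := by
  rw [restrict_d]
  by_cases hp : S p
  · simp [restrictπ_ι X (hS hp)]
  · simp [restrictι_eq_zero X hp]

theorem restrictπ_comp_d {S : ℤ → Prop} (X : CochainComplex 𝔞 ℤ) {p q : ℤ} (hS : S q → S p) :
    restrictπ S X p ≫ (restrict S X).d p q = X.d p q ≫ restrictπ S X q := by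
  rw [restrict_d]
  by_cases hq : S q
  · simp [restrictπ_ι_assoc X (hS hq)]
  · simp [restrictπ_eq_zero X hq]

theorem δ_restrictInc_v {S : ℤ → Prop} (X : CochainComplex 𝔞 ℤ) {p q : ℤ} (h : p + 1 = q)
    (hS : S p → S q) : (δ 0 1 (restrictInc S X)).v p q h = 0 := by
  rw [δ_zero_cochain_v, restrictInc_v, restrictInc_v, restrictι_comp_d X hS, sub_self]

theorem δ_restrictProj_v {S : ℤ → Prop} (X : CochainComplex 𝔞 ℤ) {p q : ℤ} (h : p + 1 = q)
    (hS : S q → S p) : (δ 0 1 (restrictProj S X)).v p q h = 0 := by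
  rw [δ_zero_cochain_v, restrictProj_v, restrictProj_v, restrictπ_comp_d X hS, sub_self]

theorem restrictInc_proj (S : ℤ → Prop) (X : CochainComplex 𝔞 ℤ) :
    (restrictInc S X).comp (restrictProj S X) (zero_add 0) = Cochain.ofHom (𝟙 _) := by
  ext p
  simp

/-- The subcomplex given by an upward closed set of degrees. -/
def restrictIncHom (S : ℤ → Prop) (hS : ∀ p, S p → S (p + 1)) (X : CochainComplex 𝔞 ℤ) :
    restrict S X ⟶ X where
  f := restrictι S X
  comm' p q h := restrictι_comp_d X fun hp => by
    obtain rfl : p + 1 = q := h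
    exact hS p hp

/-- The quotient complex given by a downward closed set of degrees. -/
def restrictProjHom (S : ℤ → Prop) (hS : ∀ p, S (p + 1) → S p) (X : CochainComplex 𝔞 ℤ) :
    X ⟶ restrict S X where
  f := restrictπ S X
  comm' p q h := restrictπ_comp_d X fun hq => by
    obtain rfl : p + 1 = q := h
    exact hS p hq

theorem isBoundedAbove_restrict {X : CochainComplex 𝔞 ℤ} (hX : IsBoundedAbove X) (S : ℤ → Prop) :
    IsBoundedAbove (restrict S X) := by
  obtain ⟨n, hn⟩ := hX
  exact ⟨n, fun p hp => isZero_restrict_X_of_isZero S (hn p hp)⟩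

theorem isBoundedBelow_restrict {X : CochainComplex 𝔞 ℤ} (hX : IsBoundedBelow X) (S : ℤ → Prop) :
    IsBoundedBelow (restrict S X) := by
  obtain ⟨n, hn⟩ := hX
  exact ⟨n, fun p hp => isZero_restrict_X_of_isZero S (hn p hp)⟩

theorem isBoundedBelow_restrict_nonneg (Z : CochainComplex 𝔞 ℤ) :
    IsBoundedBelow (restrict (fun p => 0 ≤ p) Z) :=
  ⟨0, fun _ hp => isZero_restrict_X Z (by lia)⟩

theorem isBoundedAbove_restrict_neg (Z : CochainComplex 𝔞 ℤ) :
    IsBoundedAbove (restrict (fun p => p < 0) Z) :=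
  ⟨0, fun _ hp => isZero_restrict_X Z (by lia)⟩

end Restrict

-- Cones in the Vogel dg category and the orthogonal decomposition

section Cones

variable {𝔞 : Type u} [Category.{v} 𝔞] [Preadditive 𝔞]

/-- The mapping cone of a cochain map is an internal cone. -/
def mappingConeInternal [HasBinaryBiproducts 𝔞] {X Y : CochainComplex 𝔞 ℤ} (f : X ⟶ Y) :
    InternalCone (X := (⟨X⟩ : Cdg 𝔞)) (Y := ⟨Y⟩) (Cochain.ofHom f) where
  obj := ⟨CochainComplex.mappingCone f⟩
  j := Cochain.ofHom (CochainComplex.mappingCone.inr f)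
  t := CochainComplex.mappingCone.snd f
  p := (CochainComplex.mappingCone.fst f).1
  s := CochainComplex.mappingCone.inl f
  j_p := CochainComplex.mappingCone.inr_fst f
  s_t := CochainComplex.mappingCone.inl_snd f
  id_obj := CochainComplex.mappingCone.id f
  j_t := CochainComplex.mappingCone.inr_snd f
  s_p := CochainComplex.mappingCone.inl_fst f
  d_j := δ_ofHom _
  d_p := Cocycle.δ_eq_zero _ _
  d_s := (CochainComplex.mappingCone.δ_inl f).trans (Cochain.ofHom_comp _ _)

/-- A homogeneous morphism of complexes, as a morphism of the Vogel dg category. -/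
def vogelMk {X Y : CochainComplex 𝔞 ℤ} {n : ℤ} (f : Cochain X Y n) :
    Hom (⟨⟨X⟩⟩ : Vogel 𝔞) ⟨⟨Y⟩⟩ n :=
  QuotientAddGroup.mk (s := (boundedIdeal 𝔞).carrier ⟨X⟩ ⟨Y⟩ n) f

theorem vogelMk_surjective {X Y : CochainComplex 𝔞 ℤ} {n : ℤ}
    (F : Hom (⟨⟨X⟩⟩ : Vogel 𝔞) ⟨⟨Y⟩⟩ n) : ∃ f : Cochain X Y n, vogelMk f = F :=
  QuotientAddGroup.mk_surjective F

theorem vogelMk_eq_zero_iff {X Y : CochainComplex 𝔞 ℤ} {n : ℤ} (f : Cochain X Y n) :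
    vogelMk f = 0 ↔ ∃ N : ℕ, ∀ (p q : ℤ) (h : p + n = q), N ≤ |p| → f.v p q h = 0 :=
  QuotientAddGroup.eq_zero_iff f

theorem vogelMk_eq_iff {X Y : CochainComplex 𝔞 ℤ} {n : ℤ} (f g : Cochain X Y n) :
    vogelMk f = vogelMk g ↔
      ∃ N : ℕ, ∀ (p q : ℤ) (h : p + n = q), N ≤ |p| → f.v p q h = g.v p q h := by
  have e : vogelMk f - vogelMk g = vogelMk (f - g) := rfl
  rw [← sub_eq_zero, e, vogelMk_eq_zero_iff]
  simp only [Cochain.sub_v, sub_eq_zero]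

/-- The source kills components in high degrees and the target those in low degrees, so every
representative is bounded. This holds in the dg category itself, before passing to cohomology. -/
theorem vogel_hom_eq_zero_of_above_below {X Y : Vogel 𝔞} (hX : IsBoundedAbove X.as.cpx)
    (hY : IsBoundedBelow Y.as.cpx) {n : ℤ} (f : Hom X Y n) : f = 0 := by
  obtain ⟨⟨X⟩⟩ := X
  obtain ⟨⟨Y⟩⟩ := Y
  obtain ⟨f, rfl⟩ := vogelMk_surjective f
  obtain ⟨a, ha⟩ := hX
  obtain ⟨b, hb⟩ := hY
  refine (vogelMk_eq_zero_iff _).2 ⟨a.natAbs + b.natAbs + n.natAbs + 1, fun p q h hp => ?_⟩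
  push_cast at hp
  simp only [Int.abs_eq_natAbs] at hp
  by_cases h0 : 0 ≤ p
  · exact (ha p (by lia)).eq_of_src _ _
  · exact (hb q (by lia)).eq_of_tgt _ _

theorem vogel_hom_eq_zero_of_below_above {X Y : Vogel 𝔞} (hX : IsBoundedBelow X.as.cpx)
    (hY : IsBoundedAbove Y.as.cpx) {n : ℤ} (f : Hom X Y n) : f = 0 := by
  obtain ⟨⟨X⟩⟩ := X
  obtain ⟨⟨Y⟩⟩ := Y
  obtain ⟨f, rfl⟩ := vogelMk_surjective f
  obtain ⟨a, ha⟩ := hX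
  obtain ⟨b, hb⟩ := hY
  refine (vogelMk_eq_zero_iff _).2 ⟨a.natAbs + b.natAbs + n.natAbs + 1, fun p q h hp => ?_⟩
  push_cast at hp
  simp only [Int.abs_eq_natAbs] at hp
  by_cases h0 : 0 ≤ p
  · exact (hb q (by lia)).eq_of_tgt _ _
  · exact (ha p (by lia)).eq_of_src _ _

theorem H0.hom_eq_zero {A : Type u} [DGCategory.{w} A] {X Y : H0 A}
    (h : ∀ f : Hom X.as Y.as 0, f = 0) (F : X ⟶ Y) : F = 0 := by
  obtain ⟨f, hf, rfl⟩ := homMk_surjective F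
  exact homMk_congr (h f) hf (map_zero _)

variable [HasZeroObject 𝔞]

theorem d_vogelMk_restrictInc {S : ℤ → Prop} (X : CochainComplex 𝔞 ℤ) (N : ℕ)
    (hS : ∀ p : ℤ, N ≤ |p| → S p → S (p + 1)) :
    d (zero_add 1) (vogelMk (restrictInc S X)) = 0 :=
  (vogelMk_eq_zero_iff _).2 ⟨N, fun p q h hp =>
    δ_restrictInc_v X h fun hp' => by subst h; exact hS p hp hp'⟩

theorem d_vogelMk_restrictProj {S : ℤ → Prop} (X : CochainComplex 𝔞 ℤ) (N : ℕ)
    (hS : ∀ p : ℤ, N ≤ |p| → S (p + 1) → S p) :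
    d (zero_add 1) (vogelMk (restrictProj S X)) = 0 :=
  (vogelMk_eq_zero_iff _).2 ⟨N, fun p q h hp =>
    δ_restrictProj_v X h fun hp' => by subst h; exact hS p hp hp'⟩

/-- A complex is isomorphic in the Vogel dg category to its brutal restriction to the degrees of
large absolute value. -/
def restrictIso (N : ℕ) (X : CochainComplex 𝔞 ℤ) :
    ClosedIso (⟨⟨X⟩⟩ : Vogel 𝔞) ⟨⟨restrict (fun p => (N : ℤ) ≤ |p|) X⟩⟩ where
  hom := vogelMk (restrictProj _ X)
  inv := vogelMk (restrictInc _ X)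
  d_hom := d_vogelMk_restrictProj X (N + 1) fun p hp _ => by push_cast at hp; lia
  -- The bound `N + 1` leaves room for the neighbour `p + 1`, whose absolute value may be smaller by
  -- one.
  d_inv := d_vogelMk_restrictInc X (N + 1) fun p hp _ => by
    push_cast at hp
    rw [Int.abs_eq_natAbs] at *
    lia
  hom_inv := (vogelMk_eq_iff _ _).2 ⟨N, fun p q h hp => by
    obtain rfl : p = q := by lia
    refine (Cochain.comp_zero_cochain_v _ _ _ _ _).trans ?_
    rw [restrictInc_v, restrictProj_v, restrictπ_ι X (S := fun p => (N : ℤ) ≤ |p|) hp]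
    exact (Cochain.ofHom_v (𝟙 X) p).symm⟩
  inv_hom := congrArg vogelMk (restrictInc_proj _ X)

variable [HasBinaryBiproducts 𝔞]

/-- Away from finitely many degrees a representative of `f` commutes with the differentials;
removing those degrees from both complexes leaves a cochain map. The bounds on the same cone are
recorded so that it also lies in the two full subcategories. -/
theorem exists_internalCone_vogel {X Y : Vogel 𝔞} (f : Hom X Y 0) (hf : d (zero_add 1) f = 0) :
    ∃ c : InternalCone f,
      (IsBoundedAbove X.as.cpx → IsBoundedAbove Y.as.cpx → IsBoundedAbove c.obj.as.cpx) ∧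
      (IsBoundedBelow X.as.cpx → IsBoundedBelow Y.as.cpx → IsBoundedBelow c.obj.as.cpx) := by
  obtain ⟨⟨X⟩⟩ := X
  obtain ⟨⟨Y⟩⟩ := Y
  obtain ⟨f, rfl⟩ := vogelMk_surjective f
  obtain ⟨N, hN⟩ := (vogelMk_eq_zero_iff _).1 hf
  let S : ℤ → Prop := fun p => (N : ℤ) ≤ |p|
  let g : restrict S X ⟶ restrict S Y :=
    { f := fun p => restrictι S X p ≫ f.v p p (add_zero p) ≫ restrictπ S Y p
      comm' := fun p q h => by
        obtain rfl : p + 1 = q := h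
        simp only [Category.assoc, restrict_d]
        -- If both degrees are kept, this is the vanishing of `δ f` at `p`. If one is deleted, both
        -- sides begin or end with a zero morphism.
        by_cases hp : S p
        · by_cases hq : S (p + 1)
          · have e : (δ 0 1 f).v p (p + 1) rfl = 0 := hN p (p + 1) rfl hp
            rw [δ_zero_cochain_v, sub_eq_zero] at e
            rw [restrictπ_ι_assoc Y hp, restrictπ_ι_assoc X hq, reassoc_of% e]
          · rw [restrictπ_eq_zero Y hq]
            simp
        · rw [restrictι_eq_zero X hp]
          simp }
  refine ⟨((mappingConeInternal g).factor (boundedIdeal 𝔞)).ofIso (restrictIso N X)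
    (restrictIso N Y) ?_, fun hX hY => ?_, fun hX hY => ?_⟩
  · refine (vogelMk_eq_iff (f.comp (restrictProj S Y) (zero_add 0))
      ((restrictProj S X).comp (Cochain.ofHom g) (zero_add 0))).2 ⟨N, fun p q h hp => ?_⟩
    obtain rfl : p = q := by lia
    simp [g, restrictπ_ι_assoc X (S := S) hp]
  · exact (isBoundedAbove_restrict hX S).mappingCone g (isBoundedAbove_restrict hY S)
  · exact (isBoundedBelow_restrict hX S).mappingCone g (isBoundedBelow_restrict hY S)

variable (𝔞)

open ZeroObject

instance : HasInternalCones (Vogel 𝔞) :=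
  ⟨fun f hf => ⟨(exists_internalCone_vogel f hf).choose⟩⟩

instance : HasInternalCones (VogelMinus 𝔞) := ⟨fun {X Y} f hf =>
  have ⟨c, hc, _⟩ := exists_internalCone_vogel (X := X.obj) (Y := Y.obj) f hf
  ⟨c.full (hc X.property Y.property)⟩⟩

instance : HasInternalCones (VogelPlus 𝔞) := ⟨fun {X Y} f hf =>
  have ⟨c, _, hc⟩ := exists_internalCone_vogel (X := X.obj) (Y := Y.obj) f hf
  ⟨c.full (hc X.property Y.property)⟩⟩

instance : Nonempty (Vogel 𝔞) := ⟨⟨⟨0⟩⟩⟩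

instance : Nonempty (VogelMinus 𝔞) := ⟨⟨⟨⟨0⟩⟩, (IsBounded.of_isZero (isZero_zero _)).1⟩⟩

instance : Nonempty (VogelPlus 𝔞) := ⟨⟨⟨⟨0⟩⟩, (IsBounded.of_isZero (isZero_zero _)).2⟩⟩

variable {𝔞}

theorem restrict_triangle_mem (Z : CochainComplex 𝔞 ℤ) :
    Triangle.mk
      (X := (⟨⟨⟨restrict (fun p => 0 ≤ p) Z⟩⟩⟩ : H0 (Vogel 𝔞))) (Y := ⟨⟨⟨Z⟩⟩⟩)
      (Z := ⟨⟨⟨restrict (fun p => p < 0) Z⟩⟩⟩)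
      (H0.homMk (vogelMk (restrictInc _ Z)) (d_vogelMk_restrictInc Z 0 fun p _ _ => by lia))
      (H0.homMk (vogelMk (restrictProj _ Z)) (d_vogelMk_restrictProj Z 0 fun p _ _ => by lia))
      0 ∈ H0.exactTriangles (Vogel 𝔞) := by
  refine binaryBicone_triangle_mem _
    -- The splittings fail to commute with `d` only at `p = -1`, hence the bound `2`. The two
    -- morphisms of the triangle are cochain maps and need only the bound `0`.
    (H0.homMk (vogelMk (restrictProj _ Z)) (d_vogelMk_restrictProj Z 2 fun p hp _ => ?_)) _
    (H0.homMk (vogelMk (restrictInc _ Z)) (d_vogelMk_restrictInc Z 2 fun p hp _ => ?_))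
    ?_ ?_ ?_ ?_ ?_
  · rw [Int.abs_eq_natAbs] at hp
    lia
  · rw [Int.abs_eq_natAbs] at hp
    lia
  · exact H0.homMk_congr (congrArg vogelMk (restrictInc_proj _ Z)) _ _
  · exact H0.homMk_congr (congrArg vogelMk (restrictInc_proj _ Z)) _ _
  · exact H0.hom_eq_zero (fun f => vogel_hom_eq_zero_of_below_above
      (isBoundedBelow_restrict_nonneg Z) (isBoundedAbove_restrict_neg Z) f) _
  · exact H0.hom_eq_zero (fun f => vogel_hom_eq_zero_of_above_below
      (isBoundedAbove_restrict_neg Z) (isBoundedBelow_restrict_nonneg Z) f) _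
  · refine H0.homMk_congr (congrArg vogelMk (?_ : (restrictProj _ Z).comp (restrictInc _ Z)
      (zero_add 0) + (restrictProj _ Z).comp (restrictInc _ Z) (zero_add 0) =
        Cochain.ofHom (𝟙 Z))) _ _
    ext p
    rw [Cochain.add_v, Cochain.comp_zero_cochain_v, Cochain.comp_zero_cochain_v]
    simp only [restrictInc_v, restrictProj_v, Cochain.ofHom_v, HomologicalComplex.id_f]
    by_cases hp : 0 ≤ p
    · rw [restrictπ_ι Z (S := fun p => 0 ≤ p) hp,
        restrictπ_eq_zero Z (S := fun p => p < 0) (not_lt.2 hp), Limits.zero_comp, add_zero]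
    · rw [restrictπ_ι Z (S := fun p => p < 0) (not_le.1 hp),
        restrictπ_eq_zero Z (S := fun p => 0 ≤ p) hp, Limits.zero_comp, zero_add]

variable (𝔞)

/-- The orthogonal decomposition of the homotopy category of the Vogel dg category. -/
theorem isOrthogonalDecomposition_vogel :
    IsOrthogonalDecomposition
      (H0.incl _ : H0 (VogelMinus 𝔞) ⥤ H0 (Vogel 𝔞))
      (H0.incl _ : H0 (VogelPlus 𝔞) ⥤ H0 (Vogel 𝔞))
      (H0.exactTriangles (VogelMinus 𝔞)) (H0.exactTriangles (VogelPlus 𝔞))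
      (H0.exactTriangles (Vogel 𝔞)) where
  embedding_left := isTriangleEmbedding_incl _ fun n _ hX => hX.shift n
  embedding_right := isTriangleEmbedding_incl _ fun n _ hX => hX.shift n
  hom_eq_zero Y X f := H0.hom_eq_zero
    (fun f => vogel_hom_eq_zero_of_below_above Y.as.property X.as.property f) f
  hom_eq_zero' X Y f := H0.hom_eq_zero
    (fun f => vogel_hom_eq_zero_of_above_below X.as.property Y.as.property f) f
  exists_triangle Z :=
    ⟨⟨⟨_, isBoundedBelow_restrict_nonneg Z.as.as.cpx⟩⟩,
      ⟨⟨_, isBoundedAbove_restrict_neg Z.as.as.cpx⟩⟩, _, _, _,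
      restrict_triangle_mem Z.as.as.cpx⟩

end Cones

end VogelDG

-- The triangle functor from the homotopy category of complexes to `H⁰(V(𝔞))`

namespace VogelDG

open DGCategory DGShift CochainComplex.HomComplex

section FromComplexes

variable {𝔞 : Type u} [Category.{v} 𝔞] [Preadditive 𝔞]

/-- Conjugation by the structure morphisms is strictly the usual shift. Together with the same
comparison for the zero and addition isomorphisms, this lets `fromComplexes` commute with shifts
through identities. -/
theorem shiftHom_ofHom (n : ℤ) {X Y : CochainComplex 𝔞 ℤ} (f : X ⟶ Y) :
    H0.shiftHom n (X := (⟨X⟩ : Cdg 𝔞)) (Y := ⟨Y⟩) (Cochain.ofHom f) = Cochain.ofHom (f⟦n⟧') := by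
  refine Cochain.ext₀ _ _ fun p => ?_
  refine (Cochain.comp_v _ _ (add_neg_cancel n) p (p + n) p rfl (by lia)).trans ?_
  rw [Cochain.ofHom_v]
  refine (congrArg (fun z => z ≫ _) (Cochain.comp_v _ _ (add_zero n) p (p + n) (p + n) rfl
    (by lia))).trans ?_
  simp [τ, σ, Cochain.mk_v]
  exact (Category.comp_id _).trans (Category.id_comp _)

theorem shiftFunctorZero_ofHom (X : CochainComplex 𝔞 ℤ) :
    Cochain.ofHom ((shiftFunctorZero (CochainComplex 𝔞 ℤ) ℤ).hom.app X) =
      τ 0 (⟨X⟩ : Cdg 𝔞) := by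
  refine Cochain.ext₀ _ _ fun p => ?_
  rw [Cochain.ofHom_v, CochainComplex.shiftFunctorZero_hom_app_f]
  rfl

theorem shiftFunctorAdd_ofHom (m n : ℤ) (X : CochainComplex 𝔞 ℤ) :
    Cochain.ofHom ((shiftFunctorAdd (CochainComplex 𝔞 ℤ) m n).hom.app X) =
      H0.shiftAddHom m n (⟨X⟩ : Cdg 𝔞) := by
  refine Cochain.ext₀ _ _ fun p => ?_
  rw [Cochain.ofHom_v, CochainComplex.shiftFunctorAdd_hom_app_f]
  refine Eq.symm ?_
  refine (Cochain.comp_v (Cochain.comp (τ (m + n) (⟨X⟩ : Cdg 𝔞)) (σ m (⟨X⟩ : Cdg 𝔞))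
    (rfl : m + n + -m = _)) (σ n (shift m (⟨X⟩ : Cdg 𝔞))) (by lia) p (p + n) p (by lia)
    (by lia)).trans ?_
  refine (congrArg (fun z => z ≫ _) (Cochain.comp_v (τ (m + n) (⟨X⟩ : Cdg 𝔞)) (σ m (⟨X⟩ : Cdg 𝔞))
    rfl p (p + (m + n)) (p + n) rfl (by lia))).trans ?_
  rw [Category.assoc]
  have h (A B C D : 𝔞) (a : A = B) (b : B = C) (c : C = D) :
      eqToHom a ≫ eqToHom b ≫ eqToHom c = eqToHom (a.trans (b.trans c)) := by simp
  exact h (X.X (p + (m + n))) (X.X (p + (m + n))) (X.X (p + n + m)) (X.X (p + n + m)) rfl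
    (congrArg X.X (by lia)) rfl

theorem fromComplexes_map {X Y : CochainComplex 𝔞 ℤ} (f : X ⟶ Y) :
    fromComplexes.map f = H0.homMk (vogelMk (Cochain.ofHom f)) (congrArg vogelMk (δ_ofHom f)) := rfl

theorem H0.shiftFunctorZero_hom_app {A : Type u} [DGCategory.{w} A] [DGShift A] (X : H0 A) :
    (shiftFunctorZero (H0 A) ℤ).hom.app X =
      H0.homMk (X := shift 0 X.as) (τ 0 X.as) (d_τ 0 X.as _) := rfl

theorem H0.shiftFunctorAdd_hom_app {A : Type u} [DGCategory.{w} A] [DGShift A] (m n : ℤ)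
    (X : H0 A) : (shiftFunctorAdd (H0 A) m n).hom.app X =
      H0.homMk (H0.shiftAddHom m n X.as) (H0.d_shiftAddHom m n X.as) := rfl

theorem fromComplexes_map_shiftFunctorZero (X : CochainComplex 𝔞 ℤ) :
    fromComplexes.map ((shiftFunctorZero (CochainComplex 𝔞 ℤ) ℤ).hom.app X) =
      (shiftFunctorZero (H0 (Vogel 𝔞)) ℤ).hom.app (fromComplexes.obj X) := by
  rw [fromComplexes_map, H0.shiftFunctorZero_hom_app]
  exact H0.homMk_congr (congrArg vogelMk (shiftFunctorZero_ofHom X)) _ _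

theorem fromComplexes_map_shiftFunctorAdd (m n : ℤ) (X : CochainComplex 𝔞 ℤ) :
    fromComplexes.map ((shiftFunctorAdd (CochainComplex 𝔞 ℤ) m n).hom.app X) =
      (shiftFunctorAdd (H0 (Vogel 𝔞)) m n).hom.app (fromComplexes.obj X) := by
  rw [fromComplexes_map, H0.shiftFunctorAdd_hom_app]
  exact H0.homMk_congr (congrArg vogelMk (shiftFunctorAdd_ofHom m n X)) _ _

theorem fromComplexes_map_shift (n : ℤ) {X Y : CochainComplex 𝔞 ℤ} (f : X ⟶ Y) :
    fromComplexes.map (f⟦n⟧') = (fromComplexes.map f)⟦n⟧' := by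
  rw [fromComplexes_map, fromComplexes_map]
  have e : H0.shiftHom n (vogelMk (Cochain.ofHom f)) = vogelMk (Cochain.ofHom (f⟦n⟧')) :=
    congrArg vogelMk (shiftHom_ofHom n f)
  refine (H0.homMk_congr e.symm _ (H0.d_shiftHom (A := Vogel 𝔞) (X := ⟨⟨X⟩⟩) (Y := ⟨⟨Y⟩⟩) n
    (vogelMk (Cochain.ofHom f)) (congrArg vogelMk (δ_ofHom f)))).trans ?_
  exact (H0.shiftFun_map_homMk n _ _).symm

/-- The identification of the shifts of complexes with those of the homotopy category of the Vogel
dg category. -/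
def fromComplexesShiftIso (n : ℤ) : shiftFunctor (CochainComplex 𝔞 ℤ) n ⋙ fromComplexes ≅
    fromComplexes ⋙ shiftFunctor (H0 (Vogel 𝔞)) n :=
  NatIso.ofComponents (fun X => Iso.refl (fromComplexes.obj (X⟦n⟧)))
    (fun f => (Category.comp_id _).trans
      ((fromComplexes_map_shift n f).trans (Category.id_comp _).symm))


instance : (fromComplexes (𝔞 := 𝔞)).CommShift ℤ where
  commShiftIso n := fromComplexesShiftIso n
  commShiftIso_zero := by
    ext X
    rw [Functor.CommShift.isoZero_hom_app (fromComplexes (𝔞 := 𝔞)) ℤ X,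
      fromComplexes_map_shiftFunctorZero]
    exact ((shiftFunctorZero (H0 (Vogel 𝔞)) ℤ).app (fromComplexes.obj X)).hom_inv_id.symm
  commShiftIso_add m n := by
    ext X
    rw [Functor.CommShift.isoAdd_hom_app (F := fromComplexes (𝔞 := 𝔞)) _ _ X,
      fromComplexes_map_shiftFunctorAdd]
    refine ((shiftFunctorAdd (H0 (Vogel 𝔞)) m n).app
      (fromComplexes.obj X)).hom_inv_id.symm.trans ?_
    refine congrArg (fun z =>
      ((shiftFunctorAdd (H0 (Vogel 𝔞)) m n).app (fromComplexes.obj X)).hom ≫ z) ?_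
    refine (Category.id_comp _).symm.trans (congrArg (fun z => 𝟙 _ ≫ z) ?_)
    refine (Category.id_comp _).symm.trans (congrArg (fun z => z ≫ _) ?_)
    exact ((shiftFunctor (H0 (Vogel 𝔞)) n).map_id _).symm

variable (𝔞) in
theorem fromComplexes_sound {X Y : CochainComplex 𝔞 ℤ} (f g : X ⟶ Y)
    (h : homotopic 𝔞 (ComplexShape.up ℤ) f g) : fromComplexes.map f = fromComplexes.map g := by
  obtain ⟨h⟩ := h
  refine ((H0.cls_eq_iff _ _ _ _).2 ⟨vogelMk (Cochain.ofHomotopy h), ?_⟩).symm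
  exact congrArg vogelMk (δ_ofHomotopy h)

instance : (fromK 𝔞).CommShift ℤ :=
  Quotient.liftCommShift (r := homotopic 𝔞 (ComplexShape.up ℤ)) (F := fromComplexes) (A := ℤ)
    (hF := fun _ _ f g h => fromComplexes_sound 𝔞 f g h)

variable (𝔞) in
/-- The factorization of `fromComplexes` through the homotopy category. -/
def quotientCompFromK : HomotopyCategory.quotient 𝔞 (ComplexShape.up ℤ) ⋙ fromK 𝔞 ≅
    fromComplexes :=
  Quotient.lift.isLift _ _ fun _ _ f g h => fromComplexes_sound 𝔞 f g h

instance : NatTrans.CommShift (quotientCompFromK 𝔞).hom ℤ :=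
  Quotient.liftCommShift_compatibility (r := homotopic 𝔞 (ComplexShape.up ℤ))
    (F := fromComplexes) (A := ℤ) (hF := fun _ _ f g h => fromComplexes_sound 𝔞 f g h)

variable [HasBinaryBiproducts 𝔞]

/-- Both conventions have the sign `-p` on the connecting morphism, so mapping cone triangles are
sent to standard triangles without correction. -/
theorem ofHom_triangle_mor₃ {X Y : CochainComplex 𝔞 ℤ} (φ : X ⟶ Y) :
    Cochain.ofHom (CochainComplex.mappingCone.triangle φ).mor₃ =
      -(CochainComplex.mappingCone.fst φ).1.comp (σ 1 (⟨X⟩ : Cdg 𝔞)) (add_neg_cancel 1) := by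
  refine Cochain.ext₀ _ _ fun p => ?_
  rw [Cochain.ofHom_v]
  refine Eq.trans ?_ (congrArg (fun z => -z) (Cochain.comp_v (CochainComplex.mappingCone.fst φ).1
    (σ 1 (⟨X⟩ : Cdg 𝔞)) (add_neg_cancel 1) p (p + 1) p rfl (by lia)).symm)
  simp [CochainComplex.mappingCone.triangle,
    Cochain.rightShift_v _ 1 0 (zero_add 1) p p (add_zero p) (p + 1) rfl]
  rfl

theorem fromComplexes_mapTriangle {X Y : CochainComplex 𝔞 ℤ} (φ : X ⟶ Y) :
    fromComplexes.mapTriangle.obj (CochainComplex.mappingCone.triangle φ) =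
      H0.coneTriangle (X := (⟨⟨X⟩⟩ : Vogel 𝔞)) (Y := ⟨⟨Y⟩⟩) (vogelMk (Cochain.ofHom φ))
        (congrArg vogelMk (δ_ofHom φ)) ((mappingConeInternal φ).factor (boundedIdeal 𝔞)) := by
  refine congrArg (Triangle.mk (C := H0 (Vogel 𝔞)) (fromComplexes.map φ)
    (fromComplexes.map (CochainComplex.mappingCone.inr φ))) ?_
  refine (Category.comp_id _).trans ?_
  exact H0.homMk_congr (congrArg vogelMk (ofHom_triangle_mor₃ φ)) _ _

variable [HasZeroObject 𝔞]

instance : (fromK 𝔞).IsTriangulated := ⟨by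
  rintro T ⟨X, Y, φ, ⟨e⟩⟩
  refine H0.mem_exactTriangles_of_iso ((fromK 𝔞).mapTriangle.mapIso e ≪≫
    ((Functor.mapTriangleCompIso _ _).app _).symm ≪≫
    (Functor.mapTriangleIso (quotientCompFromK 𝔞)).app _) ?_
  rw [fromComplexes_mapTriangle φ]
  exact H0.coneTriangle_mem _ _ _⟩

end FromComplexes

end VogelDG

-- Functors out of Verdier quotients

namespace VogelDG

section VerdierQuotient

/-- A cone taken inside `P` is isomorphic to the given cone in `Q` but need not itself satisfy `Q`.
Passing to the isomorphism closure is harmless, as it does not change `trW`. -/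
theorem trW_inverseImage_ι {T : Type*} [Category* T] [HasZeroObject T] [HasShift T ℤ]
    [Preadditive T] [∀ n : ℤ, (shiftFunctor T n).Additive] [Pretriangulated T]
    (P Q : ObjectProperty T) [P.IsTriangulated] (h : Q ≤ P) {X Y : P.FullSubcategory}
    (s : X ⟶ Y) (hs : Q.trW s.hom) : (Q.inverseImage P.ι).trW s := by
  obtain ⟨Z, g, k, hT, hZ⟩ := hs
  obtain ⟨Z', g', k', hT'⟩ := distinguished_cocone_triangle s
  rw [← ObjectProperty.trW_isoClosure]
  let e := isoTriangleOfIso₁₂ _ _ (P.ι.map_distinguished _ hT') hT (Iso.refl _) (Iso.refl _)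
    ((Category.comp_id _).trans (Category.id_comp _).symm)
  exact ⟨Z', g', k', hT', ⟨⟨Z, h _ hZ⟩, hZ, ⟨P.fullyFaithfulι.preimageIso
    (Triangle.π₃.mapIso e)⟩⟩⟩

variable {T : Type u} [Category.{v} T] [HasZeroObject T] [HasShift T ℤ]
  [Preadditive T] [∀ n : ℤ, (shiftFunctor T n).Additive] [Pretriangulated T]
  {D : Type*} [Category* D] [HasZeroObject D] [HasShift D ℤ]
  [Preadditive D] [∀ n : ℤ, (shiftFunctor D n).Additive] [Pretriangulated D]
  (P : ObjectProperty T) (F : T ⥤ D) [F.CommShift ℤ] [F.IsTriangulated]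

theorem trW_isInvertedBy (h : ∀ X, P X → IsZero (F.obj X)) : P.trW.IsInvertedBy F := by
  rintro X Y s ⟨Z, g, k, hT, hZ⟩
  exact (Triangle.isZero₃_iff_isIso₁ _ (F.map_distinguished _ hT)).1 (h _ hZ)

/-- If morphisms in the image of `F` can be represented by left fractions, uniquely up to
refinement, then the functor induced by `F` on the localization is fully faithful. -/
theorem full_faithful_of_leftFractions {C C' E : Type*} [Category* C] [Category* C'] [Category* E]
    (W : MorphismProperty C) [W.HasLeftCalculusOfFractions] (L : C ⥤ C') [L.IsLocalization W]
    (hL : Function.Surjective L.obj) (G : C' ⥤ E) (F : C ⥤ E) (hF : L ⋙ G = F)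
    (h₁ : ∀ {X Y : C} (f : F.obj X ⟶ F.obj Y), ∃ (Y' : C) (s : Y ⟶ Y') (f' : X ⟶ Y'),
      W s ∧ F.map f' = f ≫ F.map s)
    (h₂ : ∀ {X Y : C} (f g : X ⟶ Y), F.map f = F.map g →
      ∃ (Y' : C) (s : Y ⟶ Y'), W s ∧ f ≫ s = g ≫ s) :
    G.Full ∧ G.Faithful := by
  subst hF
  refine ⟨⟨fun {X Y} f => ?_⟩, ⟨fun {X Y} a b hab => ?_⟩⟩
  · obtain ⟨X, rfl⟩ := hL X
    obtain ⟨Y, rfl⟩ := hL Y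
    obtain ⟨Y', s, f', hs, e⟩ := h₁ f
    have := Localization.inverts L W s hs
    refine ⟨L.map f' ≫ inv (L.map s), ?_⟩
    rw [G.map_comp, G.map_inv, IsIso.comp_inv_eq]
    exact e
  · obtain ⟨X, rfl⟩ := hL X
    obtain ⟨Y, rfl⟩ := hL Y
    obtain ⟨α, hα⟩ := Localization.exists_leftFraction L W a
    have := Localization.inverts L W α.s α.hs
    have e₁ : a ≫ L.map α.s = L.map α.f := by
      rw [hα, MorphismProperty.LeftFraction.map_comp_map_s]
    -- A fraction is chosen for `b` after `α.s`, not for `b`: then both morphisms, followed by `α.s`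
    -- and `β.s`, come from `C`, where the second hypothesis on `F` applies.
    obtain ⟨β, hβ⟩ := Localization.exists_leftFraction L W (b ≫ L.map α.s)
    have := Localization.inverts L W β.s β.hs
    have e₂ : b ≫ L.map α.s ≫ L.map β.s = L.map β.f := by
      rw [← Category.assoc, hβ, MorphismProperty.LeftFraction.map_comp_map_s]
    obtain ⟨Y', s, hs, e⟩ := h₂ (α.f ≫ β.s) β.f (by
      rw [Functor.comp_map, Functor.comp_map, ← e₂, L.map_comp, ← e₁, Category.assoc,
        G.map_comp, G.map_comp, G.map_comp, G.map_comp, hab])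
    have := Localization.inverts L W s hs
    rw [← cancel_mono (L.map α.s), ← cancel_mono (L.map β.s), Category.assoc, Category.assoc, e₂,
      ← Category.assoc, e₁, ← cancel_mono (L.map s), ← L.map_comp, ← L.map_comp, e, L.map_comp]

/-- If morphisms in the image of `F` can be represented by right fractions, uniquely up to
refinement, then the functor induced by `F` on the localization is fully faithful. -/
theorem full_faithful_of_rightFractions {C C' E : Type*} [Category* C] [Category* C']
    [Category* E] (W : MorphismProperty C) [W.HasRightCalculusOfFractions] (L : C ⥤ C')
    [L.IsLocalization W] (hL : Function.Surjective L.obj) (G : C' ⥤ E) (F : C ⥤ E)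
    (hF : L ⋙ G = F)
    (h₁ : ∀ {X Y : C} (f : F.obj X ⟶ F.obj Y), ∃ (X' : C) (s : X' ⟶ X) (f' : X' ⟶ Y),
      W s ∧ F.map f' = F.map s ≫ f)
    (h₂ : ∀ {X Y : C} (f g : X ⟶ Y), F.map f = F.map g →
      ∃ (X' : C) (s : X' ⟶ X), W s ∧ s ≫ f = s ≫ g) :
    G.Full ∧ G.Faithful := by
  subst hF
  refine ⟨⟨fun {X Y} f => ?_⟩, ⟨fun {X Y} a b hab => ?_⟩⟩
  · obtain ⟨X, rfl⟩ := hL X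
    obtain ⟨Y, rfl⟩ := hL Y
    obtain ⟨X', s, f', hs, e⟩ := h₁ f
    have := Localization.inverts L W s hs
    refine ⟨inv (L.map s) ≫ L.map f', ?_⟩
    rw [G.map_comp, G.map_inv, IsIso.inv_comp_eq]
    exact e
  · obtain ⟨X, rfl⟩ := hL X
    obtain ⟨Y, rfl⟩ := hL Y
    obtain ⟨α, hα⟩ := Localization.exists_rightFraction L W a
    have := Localization.inverts L W α.s α.hs
    have e₁ : L.map α.s ≫ a = L.map α.f := by
      rw [hα, MorphismProperty.RightFraction.map_s_comp_map]
    obtain ⟨β, hβ⟩ := Localization.exists_rightFraction L W (L.map α.s ≫ b)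
    have := Localization.inverts L W β.s β.hs
    have e₂ : L.map β.s ≫ L.map α.s ≫ b = L.map β.f := by
      rw [hβ, MorphismProperty.RightFraction.map_s_comp_map]
    obtain ⟨X', s, hs, e⟩ := h₂ (β.s ≫ α.f) β.f (by
      rw [Functor.comp_map, Functor.comp_map, ← e₂, L.map_comp, ← e₁, G.map_comp, G.map_comp,
        G.map_comp, G.map_comp, hab])
    have := Localization.inverts L W s hs
    rw [← cancel_epi (L.map α.s), ← cancel_epi (L.map β.s), e₂, e₁, ← cancel_epi (L.map s),
      ← L.map_comp, ← L.map_comp, e, L.map_comp]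

theorem isTriangleIsomorphism_lift [IsTriangulated T] [P.IsTriangulated]
    (hF : P.trW.IsInvertedBy F) (hbij : Function.Bijective F.obj)
    (h : (Localization.Construction.lift F hF).Full ∧
      (Localization.Construction.lift F hF).Faithful) :
    IsTriangleIsomorphism (Localization.Construction.lift F hF : VerdierQuotient P ⥤ D)
      (distTriang (VerdierQuotient P)) (distTriang D) := by
  let Φ : VerdierQuotient P ⥤ D := Localization.Construction.lift F hF
  have := h.1
  have := h.2
  let : Localization.Lifting P.trW.Q P.trW F Φ :=
    ⟨eqToIso (Localization.Construction.fac F hF)⟩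
  let : Φ.CommShift ℤ := Functor.commShiftOfLocalization P.trW.Q P.trW ℤ F Φ
  have := NatTrans.commShift_iso_hom_of_localization P.trW.Q P.trW ℤ F Φ
  -- Every morphism of the quotient is isomorphic to the image of one in `T`, which is what allows
  -- exactness of `Φ` to be deduced from that of `F`.
  have := Localization.essSurj_mapArrow P.trW.Q P.trW
  have : Φ.IsTriangulated :=
    Functor.isTriangulated_of_precomp_iso (Localization.Lifting.iso P.trW.Q P.trW F Φ)
  refine ⟨⟨h.1, h.2, ⟨inferInstance, fun X => (Φ.map_distinguished_iff X).symm⟩⟩, ?_⟩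
  exact hbij.comp (Localization.Construction.objEquiv P.trW).symm.bijective

end VerdierQuotient

end VogelDG

-- The canonical functors on `K⁻(𝔞)` and `K⁺(𝔞)`, and truncation triangles

namespace VogelDG

open DGCategory DGShift CochainComplex.HomComplex

section FromKPlusMinus

variable (𝔞 : Type u) [Category.{v} 𝔞] [Preadditive 𝔞]

theorem fromKMinus_bijective : Function.Bijective (fromKMinus 𝔞).obj :=
  Function.bijective_iff_has_inverse.2
    ⟨fun X => ⟨⟨X.as.obj.as.cpx⟩, X.as.property⟩, fun _ => rfl, fun _ => rfl⟩

theorem fromKPlus_bijective : Function.Bijective (fromKPlus 𝔞).obj :=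
  Function.bijective_iff_has_inverse.2
    ⟨fun X => ⟨⟨X.as.obj.as.cpx⟩, X.as.property⟩, fun _ => rfl, fun _ => rfl⟩

variable [HasZeroObject 𝔞] [HasBinaryBiproducts 𝔞]

instance : (H0.incl _ : H0 (VogelMinus 𝔞) ⥤ H0 (Vogel 𝔞)).CommShift ℤ :=
  inclCommShift _ fun n _ hX => hX.shift n

instance : (H0.incl _ : H0 (VogelPlus 𝔞) ⥤ H0 (Vogel 𝔞)).CommShift ℤ :=
  inclCommShift _ fun n _ hX => hX.shift n

instance : (H0.incl _ : H0 (VogelMinus 𝔞) ⥤ H0 (Vogel 𝔞)).IsTriangulated :=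
  incl_isTriangulated _ fun n _ hX => hX.shift n

instance : (H0.incl _ : H0 (VogelPlus 𝔞) ⥤ H0 (Vogel 𝔞)).IsTriangulated :=
  incl_isTriangulated _ fun n _ hX => hX.shift n

/-- The functor `fromKMinus` is a restriction of `fromK`. -/
def fromKMinusCompIncl :
    fromKMinus 𝔞 ⋙ H0.incl _ ≅ (boundedAbove 𝔞).ι ⋙ fromK 𝔞 :=
  Iso.refl ((boundedAbove 𝔞).ι ⋙ fromK 𝔞)

/-- The functor `fromKPlus` is a restriction of `fromK`. -/
def fromKPlusCompIncl :
    fromKPlus 𝔞 ⋙ H0.incl _ ≅ (boundedBelow 𝔞).ι ⋙ fromK 𝔞 :=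
  Iso.refl ((boundedBelow 𝔞).ι ⋙ fromK 𝔞)

/-- Compatibility with shifts, and below exactness, is inherited from `fromK` by composing with the
fully faithful inclusion into `H⁰(V(𝔞))`. -/
instance : (fromKMinus 𝔞).CommShift ℤ := Functor.CommShift.ofComp (fromKMinusCompIncl 𝔞) ℤ

instance : (fromKPlus 𝔞).CommShift ℤ := Functor.CommShift.ofComp (fromKPlusCompIncl 𝔞) ℤ

instance : NatTrans.CommShift (fromKMinusCompIncl 𝔞).hom ℤ :=
  Functor.CommShift.ofComp_compatibility (fromKMinusCompIncl 𝔞) ℤ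

instance : NatTrans.CommShift (fromKPlusCompIncl 𝔞).hom ℤ :=
  Functor.CommShift.ofComp_compatibility (fromKPlusCompIncl 𝔞) ℤ

instance : (fromKMinus 𝔞).IsTriangulated :=
  (Functor.isTriangulated_iff_comp_right (fromKMinusCompIncl 𝔞)).2 inferInstance

instance : (fromKPlus 𝔞).IsTriangulated :=
  (Functor.isTriangulated_iff_comp_right (fromKPlusCompIncl 𝔞)).2 inferInstance

/-- A bounded complex is both bounded-above and bounded-below, hence orthogonal to itself, so its
identity is zero. -/
theorem fromKMinus_isInvertedBy : (boundedInMinus 𝔞).trW.IsInvertedBy (fromKMinus 𝔞) :=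
  trW_isInvertedBy _ _ fun X (hX : IsBounded X.obj.as) => (IsZero.iff_id_eq_zero _).2
    (H0.hom_eq_zero (fun f => vogel_hom_eq_zero_of_above_below hX.1 hX.2 f) _)

theorem fromKPlus_isInvertedBy : (boundedInPlus 𝔞).trW.IsInvertedBy (fromKPlus 𝔞) :=
  trW_isInvertedBy _ _ fun X (hX : IsBounded X.obj.as) => (IsZero.iff_id_eq_zero _).2
    (H0.hom_eq_zero (fun f => vogel_hom_eq_zero_of_above_below hX.1 hX.2 f) _)

end FromKPlusMinus

section Restrict

variable {𝔞 : Type u} [Category.{v} 𝔞] [Preadditive 𝔞] [HasZeroObject 𝔞] [HasBinaryBiproducts 𝔞]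

/-- The degreewise split short exact sequence given by an upward closed set of degrees. -/
def restrictShortComplex (S : ℤ → Prop) (hS : ∀ p, S p → S (p + 1)) (X : CochainComplex 𝔞 ℤ) :
    ShortComplex (CochainComplex 𝔞 ℤ) :=
  ShortComplex.mk (restrictIncHom S hS X)
    (restrictProjHom (fun p => ¬S p) (fun p hp h => hp (hS p h)) X) (by
      ext p
      change restrictι S X p ≫ restrictπ (fun p => ¬S p) X p = 0
      by_cases hp : S p
      · rw [restrictπ_eq_zero X (S := fun p => ¬S p) (not_not.2 hp), Limits.comp_zero]
      · rw [restrictι_eq_zero X hp, Limits.zero_comp])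

/-- The splittings of `restrictShortComplex`. -/
def restrictSplitting (S : ℤ → Prop) (hS : ∀ p, S p → S (p + 1)) (X : CochainComplex 𝔞 ℤ) (p : ℤ) :
    ((restrictShortComplex S hS X).map (HomologicalComplex.eval 𝔞 _ p)).Splitting where
  r := restrictπ S X p
  s := restrictι (fun p => ¬S p) X p
  f_r := restrictι_π S X p
  s_g := restrictι_π (fun p => ¬S p) X p
  id := by
    change restrictπ S X p ≫ restrictι S X p +
      restrictπ (fun p => ¬S p) X p ≫ restrictι (fun p => ¬S p) X p = 𝟙 _
    by_cases hp : S p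
    · rw [restrictπ_eq_zero X (S := fun p => ¬S p) (not_not.2 hp), restrictπ_ι X hp,
        Limits.zero_comp, add_zero]
    · rw [restrictπ_eq_zero X hp, restrictπ_ι X (S := fun p => ¬S p) hp, Limits.zero_comp,
        zero_add]

theorem restrict_distinguished (S : ℤ → Prop) (hS : ∀ p, S p → S (p + 1))
    (X : CochainComplex 𝔞 ℤ) :
    CochainComplex.trianglehOfDegreewiseSplit _ (restrictSplitting S hS X) ∈ distTriang (K 𝔞) :=
  (HomotopyCategory.distinguished_iff_iso_trianglehOfDegreewiseSplit _).2
    ⟨_, _, ⟨Iso.refl _⟩⟩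

/-- The projection is the second morphism of a truncation triangle, so its cone is a shift of the
discarded part; this is where stability of `Q` under shifts enters. -/
theorem trW_restrictProjHom (Q : ObjectProperty (K 𝔞)) [Q.IsStableUnderShift ℤ] (S : ℤ → Prop)
    (hS : ∀ p, S (p + 1) → S p) (X : CochainComplex 𝔞 ℤ)
    (h : Q ((HomotopyCategory.quotient 𝔞 _).obj (restrict (fun p => ¬S p) X))) :
    Q.trW ((HomotopyCategory.quotient 𝔞 _).map (restrictProjHom S hS X)) := by
  obtain ⟨S, rfl⟩ : ∃ S' : ℤ → Prop, S = fun p => ¬S' p := ⟨fun p => ¬S p, by simp⟩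
  have hS' : ∀ p, S p → S (p + 1) := fun p hp => not_not.1 fun h => hS p h hp
  simp only [not_not] at h
  exact ObjectProperty.trW.mk' Q (restrict_distinguished S hS' X) h

theorem trW_restrictIncHom (Q : ObjectProperty (K 𝔞)) (S : ℤ → Prop)
    (hS : ∀ p, S p → S (p + 1)) (X : CochainComplex 𝔞 ℤ)
    (h : Q ((HomotopyCategory.quotient 𝔞 _).obj (restrict (fun p => ¬S p) X))) :
    Q.trW ((HomotopyCategory.quotient 𝔞 _).map (restrictIncHom S hS X)) :=
  ObjectProperty.trW.mk Q (restrict_distinguished S hS X) h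

end Restrict

end VogelDG

-- Calculus of fractions and the isomorphisms from the Verdier quotients

namespace VogelDG

open DGCategory DGShift CochainComplex.HomComplex

section Fractions

variable {𝔞 : Type u} [Category.{v} 𝔞] [Preadditive 𝔞]

theorem exists_cochain_of_fromComplexes_map_eq {X Y : CochainComplex 𝔞 ℤ} {f g : X ⟶ Y}
    (h : fromComplexes.map f = fromComplexes.map g) : ∃ (N : ℕ) (k : Cochain X Y (-1)),
      ∀ p : ℤ, N ≤ |p| → f.f p = (δ (-1) 0 k).v p p (add_zero p) + g.f p := by
  obtain ⟨k, hk⟩ := (H0.cls_eq_iff _ _ _ _).1 h.symm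
  obtain ⟨k, rfl⟩ := vogelMk_surjective (X := X) (Y := Y) k
  have hk' : vogelMk (δ (-1) 0 k) = vogelMk (Cochain.ofHom f - Cochain.ofHom g) := hk
  obtain ⟨N, hN⟩ := (vogelMk_eq_iff _ _).1 hk'
  refine ⟨N, k, fun p hp => ?_⟩
  rw [hN p p (add_zero p) hp, Cochain.sub_v, Cochain.ofHom_v, Cochain.ofHom_v, sub_add_cancel]

variable [HasZeroObject 𝔞]

theorem le_neg_of_succ (N : ℕ) (p : ℤ) (h : p + 1 ≤ -(N : ℤ)) : p ≤ -(N : ℤ) := by lia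

theorem le_succ_of_le (N : ℕ) (p : ℤ) (h : (N : ℤ) ≤ p) : (N : ℤ) ≤ p + 1 := by lia

/-- The projection to the brutal restriction to the degrees `≤ -N`. -/
abbrev projLE (N : ℕ) (X : CochainComplex 𝔞 ℤ) : X ⟶ restrict (fun p => p ≤ -(N : ℤ)) X :=
  restrictProjHom _ (le_neg_of_succ N) X

/-- The inclusion of the brutal restriction to the degrees `≥ N`. -/
abbrev incGE (N : ℕ) (X : CochainComplex 𝔞 ℤ) : restrict (fun p => (N : ℤ) ≤ p) X ⟶ X :=
  restrictIncHom _ (le_succ_of_le N) X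

/-- A closed morphism of the Vogel dg category is represented by a cochain map after projection to
the degrees `≤ -N`. -/
theorem exists_hom_projLE {X Y : CochainComplex 𝔞 ℤ} (g : Cochain X Y 0)
    (hg : d (zero_add 1) (vogelMk g) = 0) :
    ∃ (N : ℕ) (f : X ⟶ restrict (fun p => p ≤ -(N : ℤ)) Y),
      Cochain.ofHom f = g.comp (Cochain.ofHom (projLE N Y)) (zero_add 0) := by
  obtain ⟨N, hN⟩ := (vogelMk_eq_zero_iff _).1 hg
  let f : X ⟶ restrict (fun p => p ≤ -(N : ℤ)) Y :=
    { f := fun p => g.v p p (add_zero p) ≫ restrictπ _ Y p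
      comm' := fun p q h => by
        obtain rfl : p + 1 = q := h
        rw [Category.assoc, restrictπ_comp_d Y (le_neg_of_succ N p)]
        -- If `p + 1` is kept, then `|p| ≥ N` and `δ g` vanishes at `p`; otherwise the target is
        -- zero in degree `p + 1`.
        by_cases hq : p + 1 ≤ -(N : ℤ)
        · have e : (δ 0 1 g).v p (p + 1) rfl = 0 := hN p (p + 1) rfl (by
            rw [Int.abs_eq_natAbs]
            lia)
          rw [δ_zero_cochain_v, sub_eq_zero] at e
          rw [reassoc_of% e]
        · rw [restrictπ_eq_zero Y (S := fun p => p ≤ -(N : ℤ)) hq]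
          simp }
  refine ⟨N, f, Cochain.ext₀ _ _ fun p => ?_⟩
  rw [Cochain.ofHom_v, Cochain.comp_zero_cochain_v, Cochain.ofHom_v]
  rfl

/-- A closed morphism of the Vogel dg category is represented by a cochain map after restriction to
the degrees `≥ N`. -/
theorem exists_hom_incGE {X Y : CochainComplex 𝔞 ℤ} (g : Cochain X Y 0)
    (hg : d (zero_add 1) (vogelMk g) = 0) :
    ∃ (N : ℕ) (f : restrict (fun p => (N : ℤ) ≤ p) X ⟶ Y),
      Cochain.ofHom f = (Cochain.ofHom (incGE N X)).comp g (zero_add 0) := by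
  obtain ⟨N, hN⟩ := (vogelMk_eq_zero_iff _).1 hg
  let f : restrict (fun p => (N : ℤ) ≤ p) X ⟶ Y :=
    { f := fun p => restrictι _ X p ≫ g.v p p (add_zero p)
      comm' := fun p q h => by
        obtain rfl : p + 1 = q := h
        rw [← Category.assoc, ← restrictι_comp_d X (le_succ_of_le N p)]
        by_cases hp : (N : ℤ) ≤ p
        · have e : (δ 0 1 g).v p (p + 1) rfl = 0 := hN p (p + 1) rfl (by
            rw [Int.abs_eq_natAbs]
            lia)
          rw [δ_zero_cochain_v, sub_eq_zero] at e
          rw [Category.assoc, Category.assoc, e]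
        · rw [restrictι_eq_zero X (S := fun p => (N : ℤ) ≤ p) hp]
          simp }
  refine ⟨N, f, Cochain.ext₀ _ _ fun p => ?_⟩
  rw [Cochain.ofHom_v, Cochain.comp_zero_cochain_v, Cochain.ofHom_v]
  rfl

/-- Two cochain maps which agree in the Vogel dg category are homotopic after projection to the
degrees `≤ -N`. -/
theorem exists_homotopy_projLE {X Y : CochainComplex 𝔞 ℤ} {f g : X ⟶ Y}
    (h : fromComplexes.map f = fromComplexes.map g) :
    ∃ N : ℕ, Nonempty (Homotopy (f ≫ projLE N Y) (g ≫ projLE N Y)) := by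
  obtain ⟨N, k, hk⟩ := exists_cochain_of_fromComplexes_map_eq h
  -- Since the projection is a cochain map, composing `k` with it gives a cochain whose differential
  -- is the projection of `δ k`. In degrees above `-N` everything has become zero.
  refine ⟨N, ⟨(Cochain.equivHomotopy _ _).symm
    ⟨k.comp (Cochain.ofHom (projLE N Y)) (add_zero (-1)), ?_⟩⟩⟩
  rw [δ_comp_ofHom]
  refine Cochain.ext₀ _ _ fun p => ?_
  rw [Cochain.add_v, Cochain.ofHom_v, Cochain.ofHom_v, Cochain.comp_zero_cochain_v, Cochain.ofHom_v,
    HomologicalComplex.comp_f, HomologicalComplex.comp_f, ← Preadditive.add_comp]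
  by_cases hp : p ≤ -(N : ℤ)
  · rw [hk p (by rw [Int.abs_eq_natAbs]; lia)]
  · have e : (projLE N Y).f p = 0 := restrictπ_eq_zero Y (S := fun p => p ≤ -(N : ℤ)) hp
    rw [e, Limits.comp_zero, Limits.comp_zero]

/-- Two cochain maps which agree in the Vogel dg category are homotopic after restriction to the
degrees `≥ N`. -/
theorem exists_homotopy_incGE {X Y : CochainComplex 𝔞 ℤ} {f g : X ⟶ Y}
    (h : fromComplexes.map f = fromComplexes.map g) :
    ∃ N : ℕ, Nonempty (Homotopy (incGE N X ≫ f) (incGE N X ≫ g)) := by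
  obtain ⟨N, k, hk⟩ := exists_cochain_of_fromComplexes_map_eq h
  refine ⟨N, ⟨(Cochain.equivHomotopy _ _).symm
    ⟨(Cochain.ofHom (incGE N X)).comp k (zero_add (-1)), ?_⟩⟩⟩
  rw [δ_ofHom_comp]
  refine Cochain.ext₀ _ _ fun p => ?_
  rw [Cochain.add_v, Cochain.ofHom_v, Cochain.ofHom_v, Cochain.zero_cochain_comp_v, Cochain.ofHom_v,
    HomologicalComplex.comp_f, HomologicalComplex.comp_f, ← Preadditive.comp_add]
  by_cases hp : (N : ℤ) ≤ p
  · rw [hk p (by rw [Int.abs_eq_natAbs]; lia)]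
  · have e : (incGE N X).f p = 0 := restrictι_eq_zero X (S := fun p => (N : ℤ) ≤ p) hp
    rw [e, Limits.zero_comp, Limits.zero_comp]

variable [HasBinaryBiproducts 𝔞]

/-- The morphism of `K⁻(𝔞)` given by `projLE`. -/
def minusProj (N : ℕ) (Y : KMinus 𝔞) : Y ⟶ ⟨(HomotopyCategory.quotient 𝔞 _).obj
    (restrict (fun p => p ≤ -(N : ℤ)) Y.obj.as), isBoundedAbove_restrict Y.property _⟩ :=
  ObjectProperty.homMk ((HomotopyCategory.quotient 𝔞 _).map (projLE N Y.obj.as))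

/-- The morphism of `K⁺(𝔞)` given by `incGE`. -/
def plusInc (N : ℕ) (X : KPlus 𝔞) : (⟨(HomotopyCategory.quotient 𝔞 _).obj
    (restrict (fun p => (N : ℤ) ≤ p) X.obj.as), isBoundedBelow_restrict X.property _⟩ : KPlus 𝔞) ⟶
      X :=
  ObjectProperty.homMk ((HomotopyCategory.quotient 𝔞 _).map (incGE N X.obj.as))

/-- The discarded part lives in degrees above `-N` and inherits the upper bound of `Y`, so it is
bounded. Dually, in `trW_plusInc` the part in degrees below `N` is bounded because `X` is
bounded-below. -/
theorem trW_minusProj (N : ℕ) (Y : KMinus 𝔞) : (boundedInMinus 𝔞).trW (minusProj N Y) :=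
  trW_inverseImage_ι _ _ (fun _ hX => hX.1) _ (trW_restrictProjHom _ _ _ _
    ⟨isBoundedAbove_restrict Y.property _, ⟨-N, fun _ hp => isZero_restrict_X _
      (not_not.2 hp.le)⟩⟩)

theorem trW_plusInc (N : ℕ) (X : KPlus 𝔞) : (boundedInPlus 𝔞).trW (plusInc N X) :=
  trW_inverseImage_ι _ _ (fun _ hX => hX.2) _ (trW_restrictIncHom _ _ _ _
    ⟨⟨N, fun _ hp => isZero_restrict_X _ (not_not.2 hp.le)⟩, isBoundedBelow_restrict X.property _⟩)

theorem fromKMinus_exists_leftFraction {X Y : KMinus 𝔞}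
    (f : (fromKMinus 𝔞).obj X ⟶ (fromKMinus 𝔞).obj Y) :
    ∃ (Y' : KMinus 𝔞) (s : Y ⟶ Y') (f' : X ⟶ Y'),
      (boundedInMinus 𝔞).trW s ∧ (fromKMinus 𝔞).map f' = f ≫ (fromKMinus 𝔞).map s := by
  obtain ⟨g, hg, rfl⟩ := H0.homMk_surjective f
  obtain ⟨g, rfl⟩ := vogelMk_surjective (X := X.obj.as) (Y := Y.obj.as) g
  obtain ⟨N, f, hf⟩ := exists_hom_projLE g hg
  refine ⟨_, minusProj N Y, ObjectProperty.homMk ((HomotopyCategory.quotient 𝔞 _).map f),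
    trW_minusProj N Y, ?_⟩
  exact H0.homMk_congr (congrArg vogelMk hf) _ _

theorem fromKPlus_exists_rightFraction {X Y : KPlus 𝔞}
    (f : (fromKPlus 𝔞).obj X ⟶ (fromKPlus 𝔞).obj Y) :
    ∃ (X' : KPlus 𝔞) (s : X' ⟶ X) (f' : X' ⟶ Y),
      (boundedInPlus 𝔞).trW s ∧ (fromKPlus 𝔞).map f' = (fromKPlus 𝔞).map s ≫ f := by
  obtain ⟨g, hg, rfl⟩ := H0.homMk_surjective f
  obtain ⟨g, rfl⟩ := vogelMk_surjective (X := X.obj.as) (Y := Y.obj.as) g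
  obtain ⟨N, f, hf⟩ := exists_hom_incGE g hg
  refine ⟨_, plusInc N X, ObjectProperty.homMk ((HomotopyCategory.quotient 𝔞 _).map f),
    trW_plusInc N X, ?_⟩
  exact H0.homMk_congr (congrArg vogelMk hf) _ _

theorem fromKMinus_exists_comp_eq {X Y : KMinus 𝔞} (f g : X ⟶ Y)
    (h : (fromKMinus 𝔞).map f = (fromKMinus 𝔞).map g) :
    ∃ (Y' : KMinus 𝔞) (s : Y ⟶ Y'), (boundedInMinus 𝔞).trW s ∧ f ≫ s = g ≫ s := by
  obtain ⟨f₀ : X.obj.as ⟶ Y.obj.as, hf⟩ := (HomotopyCategory.quotient 𝔞 _).map_surjective f.hom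
  obtain ⟨g₀ : X.obj.as ⟶ Y.obj.as, hg⟩ := (HomotopyCategory.quotient 𝔞 _).map_surjective g.hom
  have h' : (fromK 𝔞).map f.hom = (fromK 𝔞).map g.hom := h
  rw [← hf, ← hg] at h'
  obtain ⟨N, ⟨e⟩⟩ := exists_homotopy_projLE (f := f₀) (g := g₀) h'
  refine ⟨_, minusProj N Y, trW_minusProj N Y, ObjectProperty.hom_ext _ ?_⟩
  have := HomotopyCategory.eq_of_homotopy _ _ e
  rw [Functor.map_comp, Functor.map_comp] at this
  refine (congrArg (fun z => z ≫ _) hf.symm).trans (this.trans (congrArg (fun z => z ≫ _) hg))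

theorem fromKPlus_exists_comp_eq {X Y : KPlus 𝔞} (f g : X ⟶ Y)
    (h : (fromKPlus 𝔞).map f = (fromKPlus 𝔞).map g) :
    ∃ (X' : KPlus 𝔞) (s : X' ⟶ X), (boundedInPlus 𝔞).trW s ∧ s ≫ f = s ≫ g := by
  obtain ⟨f₀ : X.obj.as ⟶ Y.obj.as, hf⟩ := (HomotopyCategory.quotient 𝔞 _).map_surjective f.hom
  obtain ⟨g₀ : X.obj.as ⟶ Y.obj.as, hg⟩ := (HomotopyCategory.quotient 𝔞 _).map_surjective g.hom
  have h' : (fromK 𝔞).map f.hom = (fromK 𝔞).map g.hom := h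
  rw [← hf, ← hg] at h'
  obtain ⟨N, ⟨e⟩⟩ := exists_homotopy_incGE (f := f₀) (g := g₀) h'
  refine ⟨_, plusInc N X, trW_plusInc N X, ObjectProperty.hom_ext _ ?_⟩
  have := HomotopyCategory.eq_of_homotopy _ _ e
  rw [Functor.map_comp, Functor.map_comp] at this
  refine (congrArg (fun z => _ ≫ z) hf.symm).trans (this.trans (congrArg (fun z => _ ≫ z) hg))

variable (𝔞)

theorem exists_verdierQuotient_iso_minus :
    ∃ Φ : VerdierQuotient (boundedInMinus 𝔞) ⥤ H0 (VogelMinus 𝔞),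
      (boundedInMinus 𝔞).trW.Q ⋙ Φ = fromKMinus 𝔞 ∧
      IsTriangleIsomorphism Φ (distTriang (VerdierQuotient (boundedInMinus 𝔞)))
        (H0.exactTriangles (VogelMinus 𝔞)) :=
  have hF := fromKMinus_isInvertedBy 𝔞
  ⟨_, Localization.Construction.fac _ hF,
    isTriangleIsomorphism_lift _ _ hF (fromKMinus_bijective 𝔞)
      (full_faithful_of_leftFractions _ _ (Localization.Construction.objEquiv _).surjective _ _
        (Localization.Construction.fac _ hF) fromKMinus_exists_leftFraction
        fromKMinus_exists_comp_eq)⟩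

theorem exists_verdierQuotient_iso_plus :
    ∃ Φ : VerdierQuotient (boundedInPlus 𝔞) ⥤ H0 (VogelPlus 𝔞),
      (boundedInPlus 𝔞).trW.Q ⋙ Φ = fromKPlus 𝔞 ∧
      IsTriangleIsomorphism Φ (distTriang (VerdierQuotient (boundedInPlus 𝔞)))
        (H0.exactTriangles (VogelPlus 𝔞)) :=
  have hF := fromKPlus_isInvertedBy 𝔞
  ⟨_, Localization.Construction.fac _ hF,
    isTriangleIsomorphism_lift _ _ hF (fromKPlus_bijective 𝔞)
      (full_faithful_of_rightFractions _ _ (Localization.Construction.objEquiv _).surjective _ _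
        (Localization.Construction.fac _ hF) fromKPlus_exists_rightFraction
        fromKPlus_exists_comp_eq)⟩

end Fractions

end VogelDG

end

theorem theorem3p9 (𝔞 : Type u) [Category.{v} 𝔞] [Preadditive 𝔞] [HasZeroObject 𝔞]
    [HasBinaryBiproducts 𝔞] :
    -- the homotopy categories of the Vogel dg categories are triangulated
    IsTriangulatedCategory (H0 (Vogel 𝔞)) (H0.exactTriangles (Vogel 𝔞)) ∧
    IsTriangulatedCategory (H0 (VogelMinus 𝔞)) (H0.exactTriangles (VogelMinus 𝔞)) ∧
    IsTriangulatedCategory (H0 (VogelPlus 𝔞)) (H0.exactTriangles (VogelPlus 𝔞)) ∧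
    -- the orthogonal decomposition
    IsOrthogonalDecomposition
      (H0.incl _ : H0 (VogelMinus 𝔞) ⥤ H0 (Vogel 𝔞))
      (H0.incl _ : H0 (VogelPlus 𝔞) ⥤ H0 (Vogel 𝔞))
      (H0.exactTriangles (VogelMinus 𝔞)) (H0.exactTriangles (VogelPlus 𝔞))
      (H0.exactTriangles (Vogel 𝔞)) ∧
    -- the isomorphisms of triangulated categories
    (∃ Φ : VerdierQuotient (boundedInMinus 𝔞) ⥤ H0 (VogelMinus 𝔞),
      (boundedInMinus 𝔞).trW.Q ⋙ Φ = fromKMinus 𝔞 ∧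
      IsTriangleIsomorphism Φ (distTriang (VerdierQuotient (boundedInMinus 𝔞)))
        (H0.exactTriangles (VogelMinus 𝔞))) ∧
    (∃ Φ : VerdierQuotient (boundedInPlus 𝔞) ⥤ H0 (VogelPlus 𝔞),
      (boundedInPlus 𝔞).trW.Q ⋙ Φ = fromKPlus 𝔞 ∧
      IsTriangleIsomorphism Φ (distTriang (VerdierQuotient (boundedInPlus 𝔞)))
        (H0.exactTriangles (VogelPlus 𝔞))) := by
  exact ⟨⟨inferInstance, inferInstance, inferInstance, rfl, inferInstance⟩,
    ⟨inferInstance, inferInstance, inferInstance, rfl, inferInstance⟩,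
    ⟨inferInstance, inferInstance, inferInstance, rfl, inferInstance⟩,
    isOrthogonalDecomposition_vogel 𝔞, exists_verdierQuotient_iso_minus 𝔞,
    exists_verdierQuotient_iso_plus 𝔞⟩
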